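/- **Setting.** Let $G$ be a (real, finite-dimensional) Lie group with Lie algebra $\mathfrak g=T_eG$ (bracket of left invariant fields), $H\subset G$ a closed subgroup with Lie algebra $\mathfrak h$, and $G/H$ the smooth coset space with origin $o=eH$, i.e. with the smooth structure for which $g\mapsto g\cdot o$ is a smooth submersion. Let $\mathbf G$ be a $G$-invariant spray structure on $G/H$, that is, a $G$-invariant smooth vector field on $T(G/H)\setminus 0$ which in all standard local coordinates has the form $\mathbf G=y^i\partial_{x^i}-2\mathbf G^i\partial_{y^i}$ with $\mathbf G^i(x,\lambda y)=\lambda^2\mathbf G^i(x,y)$ for $\lambda>0$. Geodesics are the smooth curves $c$ with nowhere vanishing $\dot c$ such that $(c,\dot c)$ is an integral curve of $\mathbf G$. A smooth vector field $X^i(t)\partial_{x^i}$ along $c$ is linearly parallel if $\tfrac{d}{dt}X^i+\tfrac{\partial \mathbf G^i}{\partial y^j}(c,\dot c)X^j=0$. The Riemann curvature $\mathbf R_y:T_x(G/H)\to T_x(G/H)$, $0\ne y\in T_x(G/H)$, has the components $$\mathbf R^i_k=2\tfrac{\partial \mathbf G^i}{\partial x^k}-y^j\tfrac{\partial^2\mathbf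 G^i}{\partial x^j\partial y^k}+2\mathbf G^j\tfrac{\partial^2\mathbf G^i}{\partial y^j\partial y^k}-\tfrac{\partial \mathbf G^i}{\partial y^j}\tfrac{\partial \mathbf G^j}{\partial y^k}.$$ Fix a linear decomposition $\mathfrak g=\mathfrak h\oplus\mathfrak m$ (not necessarily $\mathrm{Ad}(H)$-invariant), with projections $v\mapsto v_{\mathfrak h},v_{\mathfrak m}$, and identify $\mathfrak m$ with $T_o(G/H)$ by the tangent map of $g\mapsto g\cdot o$. A smooth curve $c$ in $G/H$ with $c(0)=o$ and nowhere vanishing $\dot c$ has, near $t=0$, a unique smooth lift $\overline c$ to $G$ with $\overline c(0)=e$, $c(t)=\overline c(t)\cdot o$ and $y(t):=(L_{\overline c(t)^{-1}})_*\dot{\overline c}(t)\in\mathfrak m\setminus\{0\}$. The spray vector field $\eta:\mathfrak m\setminus\{0\}\to\mathfrak m$ is $\eta(y)=-\tfrac{d}{dt}\big|_{t=0}y(t)$, where $y(t)$ belongs in this way to the geodesic $c$ with $c(0)=o$, $\dot c(0)=y$. The connection operator is $N(y,v)=\tfrac12 D\eta(y,v)-\tfrac12[y,v]_{\mathfrak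 m}$ with $D\eta(y,v)=\tfrac{d}{dt}\big|_{t=0}\eta(y+tv)$, for $y\in\mathfrak m\setminus\{0\}$, $v\in\mathfrak m$. For a vector field $X$ on $\mathfrak m\setminus\{0\}$ and a smooth vector field $Y(t)$ along an integral curve $\gamma(t)$ of $X$, the generalized bracket is $[X,Y(t)]=-[Y(t),X]:=\tfrac{d}{dt}Y(t)-DX(\gamma(t),Y(t))$. For a vector field $Y(t)$ along an integral curve of $-\eta$ one puts accordingly $[Y(t),\eta]=-[\eta,Y(t)]:=[-\eta,Y(t)]$. **Statement.** Let $a<0<b$, let $c:(a,b)\to G/H$ be a geodesic with $c(0)=o$ whose lift $\overline c$ as above is defined on $(a,b)$, with corresponding curve $y(t)$ in $\mathfrak m\setminus\{0\}$, and let $W(t)=(\overline c(t))_*w(t)$, with $w:(a,b)\to\mathfrak m$ smooth, be a linearly parallel vector field along $c$. Then $\eta$ is smooth on $\mathfrak m\setminus\{0\}$, $y(t)$ is an integral curve of $-\eta$, and $N(t)=N(y(t),w(t))$ is smooth, so that the brackets below, of vector fields along $y(t)$, are defined; and for all $t\in(a,b)$ $$N(t)=[w(t),\eta],\qquad \mathbf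 R_{y(t)}(w(t))=\big[y(t),[w(t),y(t)]_{\mathfrak h}\big]_{\mathfrak m}+[\eta,N(t)].$$ -/

import Mathlib

open Set Bundle
open scoped Manifold ContDiff Topology

noncomputable section

namespace SprayGeometry

/-! ## Spray structures on a manifold

Manifolds are smooth, real, finite dimensional and without boundary: they are modelled on a
real normed space `F` with the model `𝓘(ℝ, F)`.  A vector `y : F` plays the role of the
coordinate column `(y¹, …, yⁿ)`. -/

section Spray

variable {F : Type*} [NormedAddCommGroup F] [NormedSpace ℝ F]
  {M : Type*} [TopologicalSpace M] [ChartedSpace F M]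

/-- The standard local coordinates `(x, y)` on `TM` belonging to a chart `e` of `M`. -/
def tangentCoord (e : OpenPartialHomeomorph M F) (p : TangentBundle 𝓘(ℝ, F) M) : F × F :=
  (e p.1, mfderiv 𝓘(ℝ, F) 𝓘(ℝ, F) e p.1 p.2)

/-- The tangent vector `yⁱ ∂_{xⁱ}` at the point with coordinates `x`, in the chart `e`. -/
def tangentPoint (e : OpenPartialHomeomorph M F) (x y : F) : TangentBundle 𝓘(ℝ, F) M :=
  ⟨e.symm x, mfderiv 𝓘(ℝ, F) 𝓘(ℝ, F) e.symm x y⟩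

/-- The velocity `(c(t), ċ(t))` of a curve, as a point of the tangent bundle. -/
def velocity (c : ℝ → M) (t : ℝ) : TangentBundle 𝓘(ℝ, F) M :=
  ⟨c t, mfderiv 𝓘(ℝ, ℝ) 𝓘(ℝ, F) c t (1 : ℝ)⟩

variable [IsManifold 𝓘(ℝ, F) ∞ M]

/-- The components of a vector field `X` on `TM` in the standard local coordinates of the
chart `e`: the pair `(Xⁱ, X̂ʲ)` with `X = Xⁱ ∂_{xⁱ} + X̂ʲ ∂_{yʲ}` at the point `(x, y)`. -/
def localVec (X : (p : TangentBundle 𝓘(ℝ, F) M) → TangentSpace 𝓘(ℝ, F).tangent p)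
    (e : OpenPartialHomeomorph M F) (x y : F) : F × F :=
  mfderiv 𝓘(ℝ, F).tangent 𝓘(ℝ, F × F) (tangentCoord e) (tangentPoint e x y)
    (X (tangentPoint e x y))

/-- The functions `Gⁱ(x, y) = -½ X̂ⁱ(x, y)` of a vector field on `TM` in the chart `e`. -/
def localCoeff (X : (p : TangentBundle 𝓘(ℝ, F) M) → TangentSpace 𝓘(ℝ, F).tangent p)
    (e : OpenPartialHomeomorph M F) (x y : F) : F :=
  -(1 / 2 : ℝ) • (localVec X e x y).2

variable (F M) in
/-- A spray structure on `M`: a smooth vector field on the slit tangent bundle `TM \ 0` which in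
all standard local coordinates is `yⁱ ∂_{xⁱ} - 2 Gⁱ ∂_{yⁱ}`, with `Gⁱ` smooth for `y ≠ 0` and
positively 2-homogeneous in `y`.  The values of `vec` on the zero section play no role. -/
structure Spray where
  /-- the vector field -/
  vec : (p : TangentBundle 𝓘(ℝ, F) M) → TangentSpace 𝓘(ℝ, F).tangent p
  fst_localVec : ∀ e ∈ IsManifold.maximalAtlas 𝓘(ℝ, F) ∞ M, ∀ x ∈ e.target, ∀ y : F, y ≠ 0 →
    (localVec vec e x y).1 = y
  contDiffOn_coeff : ∀ e ∈ IsManifold.maximalAtlas 𝓘(ℝ, F) ∞ M,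
    ContDiffOn ℝ ∞ (fun z : F × F ↦ localCoeff vec e z.1 z.2) (e.target ×ˢ {0}ᶜ)
  coeff_smul : ∀ e ∈ IsManifold.maximalAtlas 𝓘(ℝ, F) ∞ M, ∀ x ∈ e.target, ∀ y : F, y ≠ 0 →
    ∀ r : ℝ, 0 < r → localCoeff vec e x (r • y) = r ^ 2 • localCoeff vec e x y

namespace Spray

variable (S : Spray F M)

/-- The spray coefficients `Gⁱ(x, y)` in the chart `e`. -/
def coeff (e : OpenPartialHomeomorph M F) (x y : F) : F := localCoeff S.vec e x y

/-- `Nⁱⱼ(x, y) uʲ`, where `Nⁱⱼ = ∂Gⁱ/∂yʲ`. -/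
def conn (e : OpenPartialHomeomorph M F) (x y u : F) : F :=
  fderiv ℝ (fun y' ↦ S.coeff e x y') y u

/-- A geodesic on the (open) parameter set `s`: a smooth curve with nowhere vanishing velocity
whose lift `(c, ċ)` is an integral curve of the spray. -/
structure IsGeodesic (c : ℝ → M) (s : Set ℝ) : Prop where
  contMDiffOn : ContMDiffOn 𝓘(ℝ, ℝ) 𝓘(ℝ, F) ∞ c s
  velocity_ne_zero : ∀ t ∈ s, (velocity (F := F) c t).2 ≠ 0
  isIntegralCurve : IsMIntegralCurveOn (I := 𝓘(ℝ, F).tangent) (velocity c) S.vec s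

/-- The components `dXⁱ/dt + Nⁱⱼ(c, ċ) Xʲ`, in the chart `e`, of the linearly covariant derivative
along `c` of the vector field `X` along `c`. -/
def covDeriv (e : OpenPartialHomeomorph M F) (c : ℝ → M) (X : ℝ → TangentBundle 𝓘(ℝ, F) M)
    (t : ℝ) : F :=
  deriv (fun τ ↦ (tangentCoord e (X τ)).2) t +
    S.conn e (tangentCoord e (velocity c t)).1 (tangentCoord e (velocity c t)).2
      (tangentCoord e (X t)).2

/-- `X` is a smooth vector field along `c`, and it is linearly parallel: its linearly covariant
derivative vanishes in every standard local coordinate. -/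
structure IsLinearlyParallel (c : ℝ → M) (X : ℝ → TangentBundle 𝓘(ℝ, F) M) (s : Set ℝ) :
    Prop where
  proj_eq : ∀ t ∈ s, (X t).1 = c t
  contMDiffOn : ContMDiffOn 𝓘(ℝ, ℝ) 𝓘(ℝ, F).tangent ∞ X s
  covDeriv_eq_zero : ∀ e ∈ IsManifold.maximalAtlas 𝓘(ℝ, F) ∞ M, ∀ t ∈ s, c t ∈ e.source →
    S.covDeriv e c X t = 0

/-- The Riemann curvature in the chart `e`, i.e. `Rⁱₖ(x, y) uᵏ` with
`Rⁱₖ = 2 ∂Gⁱ/∂xᵏ - yʲ ∂²Gⁱ/∂xʲ∂yᵏ + 2 Gʲ ∂²Gⁱ/∂yʲ∂yᵏ - (∂Gⁱ/∂yʲ) (∂Gʲ/∂yᵏ)`. -/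
def localRiemann (e : OpenPartialHomeomorph M F) (x y u : F) : F :=
  (2 : ℝ) • fderiv ℝ (fun x' ↦ S.coeff e x' y) x u
    - fderiv ℝ (fun x' ↦ S.conn e x' y u) x y
    + (2 : ℝ) • fderiv ℝ (fun y' ↦ S.conn e x y' u) y (S.coeff e x y)
    - S.conn e x y (S.conn e x y u)

/-- The Riemann curvature `R_y : T_x M → T_x M` for `y ∈ T_x M \ {0}`, computed in the preferred
chart at `x` (the result does not depend on the chart). -/
def riemann (x : M) (y u : TangentSpace 𝓘(ℝ, F) x) : TangentSpace 𝓘(ℝ, F) x :=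
  (tangentPoint (chartAt F x) (chartAt F x x)
    (S.localRiemann (chartAt F x) (chartAt F x x)
      (tangentCoord (chartAt F x) ⟨x, y⟩).2 (tangentCoord (chartAt F x) ⟨x, u⟩).2)).2

end Spray

end Spray

/-! ## Coset spaces -/

section Coset

variable {E : Type*} [NormedAddCommGroup E] [NormedSpace ℝ E]
  {F : Type*} [NormedAddCommGroup F] [NormedSpace ℝ F]
  {G : Type*} [Group G] [TopologicalSpace G] [ChartedSpace E G]

/-- `𝔤 = T_e G` carries the norm of the model space (any other norm gives the same notions of
derivative and of smoothness). -/
instance instNormedAddCommGroupLie : NormedAddCommGroup (GroupLieAlgebra 𝓘(ℝ, E) G) :=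
  inferInstanceAs (NormedAddCommGroup E)

instance instNormedSpaceLie : NormedSpace ℝ (GroupLieAlgebra 𝓘(ℝ, E) G) :=
  inferInstanceAs (NormedSpace ℝ E)

variable (E) in
/-- The Lie algebra `𝔥 = T_e H ⊆ 𝔤` of a subgroup `H` of `G`: the vectors tangent at `e` to smooth
curves of `G` that run in `H`.  (For closed `H` these vectors form a subspace already.) -/
def isotropyAlgebra (H : Subgroup G) : Submodule ℝ (GroupLieAlgebra 𝓘(ℝ, E) G) :=
  Submodule.span ℝ {v | ∃ γ : ℝ → G, ContMDiffAt 𝓘(ℝ, ℝ) 𝓘(ℝ, E) ∞ γ 0 ∧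
    (∀ᶠ t in 𝓝 (0 : ℝ), γ t ∈ H) ∧ velocity γ 0 = ⟨1, v⟩}

/-- The origin `o = eH`. -/
def origin (H : Subgroup G) : G ⧸ H := ((1 : G) : G ⧸ H)

variable {H : Subgroup G}

section Brackets

variable {𝔪 : Submodule ℝ (GroupLieAlgebra 𝓘(ℝ, E) G)} (hdec : IsCompl (isotropyAlgebra E H) 𝔪)

/-- `[u, v]_𝔪`, for the linear decomposition `𝔤 = 𝔥 + 𝔪`. -/
def bracketM (u v : GroupLieAlgebra 𝓘(ℝ, E) G) : 𝔪 :=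
  Submodule.projectionOnto 𝔪 (isotropyAlgebra E H) hdec.symm ⁅u, v⁆

/-- `[u, v]_𝔥`, for the linear decomposition `𝔤 = 𝔥 + 𝔪`. -/
def bracketH (u v : GroupLieAlgebra 𝓘(ℝ, E) G) : isotropyAlgebra E H :=
  Submodule.projectionOnto (isotropyAlgebra E H) 𝔪 hdec ⁅u, v⁆

end Brackets

variable [ChartedSpace F (G ⧸ H)]

variable (E F H) in
/-- The tangent map `𝔤 = T_e G → T_o(G/H)` of the projection `g ↦ g · o`.  Its restriction to `𝔪`
is the identification of `𝔪` with `T_o(G/H)`. -/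
def projTangent (v : GroupLieAlgebra 𝓘(ℝ, E) G) : TangentSpace 𝓘(ℝ, F) (origin H) :=
  mfderiv 𝓘(ℝ, E) 𝓘(ℝ, F) (fun g : G ↦ (g : G ⧸ H)) 1 v

/-- `c̄` is, on the parameter set `s ∋ 0`, the smooth curve on `G` with `c̄(0) = e`,
`c(t) = c̄(t) · o` and `(L_{c̄(t)⁻¹})_* (dc̄/dt) = y(t) ∈ 𝔪 \ {0}`.  (The last equation is written
as `dc̄/dt = (L_{c̄(t)})_* y(t)`.) -/
structure IsHorizontalLift (𝔪 : Submodule ℝ (GroupLieAlgebra 𝓘(ℝ, E) G)) (c : ℝ → G ⧸ H)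
    (cbar : ℝ → G) (y : ℝ → 𝔪) (s : Set ℝ) : Prop where
  contMDiffOn : ContMDiffOn 𝓘(ℝ, ℝ) 𝓘(ℝ, E) ∞ cbar s
  map_zero : cbar 0 = 1
  proj_eq : ∀ t ∈ s, c t = cbar t • origin H
  velocity_eq : ∀ t ∈ s, (velocity (F := E) cbar t).2 =
    mulInvariantVectorField (y t : GroupLieAlgebra 𝓘(ℝ, E) G) (cbar t)
  ne_zero : ∀ t ∈ s, y t ≠ 0

variable [IsManifold 𝓘(ℝ, F) ∞ (G ⧸ H)]

/-- The spray is `G`-invariant: `(g_*)_* 𝐆 = 𝐆` on `T(G/H) \ 0` for all `g ∈ G`. -/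
def Spray.IsInvariant (S : Spray F (G ⧸ H)) : Prop :=
  ∀ (g : G) (p : TangentBundle 𝓘(ℝ, F) (G ⧸ H)), p.2 ≠ 0 →
    mfderiv 𝓘(ℝ, F).tangent 𝓘(ℝ, F).tangent
        (tangentMap 𝓘(ℝ, F) 𝓘(ℝ, F) (fun x : G ⧸ H ↦ g • x)) p (S.vec p) =
      S.vec (tangentMap 𝓘(ℝ, F) 𝓘(ℝ, F) (fun x : G ⧸ H ↦ g • x) p)

/-- `z = -(d/dt)|_{t=0} y(t)`, where `y(t) = (L_{c̄(t)⁻¹})_* (dc̄/dt)` belongs to the geodesic `c`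
with `c(0) = o` and `ċ(0) = y`. -/
def IsSprayVector (S : Spray F (G ⧸ H)) (𝔪 : Submodule ℝ (GroupLieAlgebra 𝓘(ℝ, E) G))
    (y z : 𝔪) : Prop :=
  ∃ ε > (0 : ℝ), ∃ (c : ℝ → G ⧸ H) (cbar : ℝ → G) (yc : ℝ → 𝔪),
    S.IsGeodesic c (Ioo (-ε) ε) ∧ velocity c 0 = ⟨origin H, projTangent E F H y⟩ ∧
    IsHorizontalLift 𝔪 c cbar yc (Ioo (-ε) ε) ∧ HasDerivAt yc (-z) 0

open Classical in
/-- The spray vector field `η : 𝔪 \ {0} → 𝔪`. -/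
def sprayVectorField (S : Spray F (G ⧸ H)) (𝔪 : Submodule ℝ (GroupLieAlgebra 𝓘(ℝ, E) G))
    (y : 𝔪) : 𝔪 :=
  if h : ∃ z, IsSprayVector S 𝔪 y z then h.choose else 0

/-- The connection operator `N(y, v) = ½ Dη(y, v) - ½ [y, v]_𝔪`, where
`Dη(y, v) = (d/dt)|_{t=0} η(y + t v)`. -/
def connectionOperator (S : Spray F (G ⧸ H)) {𝔪 : Submodule ℝ (GroupLieAlgebra 𝓘(ℝ, E) G)}
    (hdec : IsCompl (isotropyAlgebra E H) 𝔪) (y v : 𝔪) : 𝔪 :=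
  (1 / 2 : ℝ) • deriv (fun t : ℝ ↦ sprayVectorField S 𝔪 (y + t • v)) 0
    - (1 / 2 : ℝ) • bracketM hdec (y : GroupLieAlgebra 𝓘(ℝ, E) G) v

end Coset

/-! ## The bracket with a vector field along one of its integral curves -/

section Bracket

variable {V : Type*} [NormedAddCommGroup V] [NormedSpace ℝ V]

/-- The generalized bracket `[X, Y(t)]` of a vector field `X` on (an open set of) a vector space
and a vector field `Y(t)` along an integral curve `γ` of `X`:
`(dYⁱ/dt ∂_{xⁱ} - Yⁱ ∂Xʲ/∂xⁱ ∂_{xʲ})|_{γ(t)}`. -/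
def curveBracket (X : V → V) (γ Y : ℝ → V) (t : ℝ) : V :=
  deriv Y t - fderiv ℝ X (γ t) (Y t)

/-- `[Y(t), η] = [-η, Y(t)]`, for a vector field `Y(t)` along an integral curve `γ` of `-η`. -/
def bracketRight (η : V → V) (γ Y : ℝ → V) (t : ℝ) : V :=
  curveBracket (fun v ↦ -η v) γ Y t

/-- `[η, Y(t)] = -[-η, Y(t)]`, for a vector field `Y(t)` along an integral curve `γ` of `-η`. -/
def bracketLeft (η : V → V) (γ Y : ℝ → V) (t : ℝ) : V :=
  -curveBracket (fun v ↦ -η v) γ Y t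

end Bracket

end SprayGeometry

end

open SprayGeometry

/-! Everything is read in the preferred charts at `1` and at `o`. There the projection becomes a map
`P`, and the left invariant fields become a frame `A` on an open set of `E`. For Lie algebra
elements, `Q u v` is the derivative of `P` along the field of `v`; `B` and `C` are the iterated
derivatives along two and three fields. If `k' = k_* y(t)` in `G`, the coordinates of `k · o` have
velocity `Q(y)` and acceleration `B(y, y) + Q(y')`. So the geodesic equation with `y' = -η(y)` reads
`2 G(P, Q y) = Q(η y) - B(y, y)`.

At `o` the map `Q` restricts to an isomorphism on `𝔪`, because the projection is a submersion with
kernel `𝔥`. The equation therefore defines a smooth `η` there (`localSprayField`). Invariance of the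
spray then spreads the equation to an open set of points `u` (`spray_equation`): a curve with `k' =
k_* y`, `y' = -η(y)` projects to a geodesic wherever it starts, since each of its points can be
translated to `o`. The same computation shows that every geodesic has `y' = -η(y)`, so this `η` is
the spray vector field of the statement (`isSprayVector_iff`).

An identity valid on an open set of pairs `(u, y)` can be differentiated. Its vertical derivative
expresses `∂G/∂y`, and with it linear parallelism becomes `w' = -(½ Dη(y, w) + ½ [y, w]_𝔪)`
(`eq_of_isLinearlyParallel`). Hence `[w, η] = w' + Dη(y, w) = N`.

For the curvature, group the second order terms into one derivative of `∂G/∂y` along the spray: `R v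
= 2 ∂ₓG v - (D²G along the spray) v - ∂_yG ∂_yG v`. The first term comes from differentiating the
identity along the field of `v`, the second from differentiating its vertical derivative along the
geodesic flow (`curvature_of_spray_equation`). The third derivatives `C` cancel through the
commutators of the frame. These leave `B([v, y], y)` and `B(y, [v, y])`. Because `Q` kills `𝔥` on a
whole neighbourhood, the `𝔥`-part of `[v, y]` contributes only `[y, [v, y]_𝔥]_𝔪`. What remains is
`-(N' + Dη(y, N)) = [η, N]`, by differentiating `N` along `y' = -η`, `w' = -m`, with `m` the
bracketed expression above. -/

namespace SprayGeometry

/-! ### Calculus of a frame on a vector space: the curvature identity in coordinates. -/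

section Frame

variable {E 𝔤 F V : Type*} [NormedAddCommGroup E] [NormedSpace ℝ E]
  [NormedAddCommGroup 𝔤] [NormedSpace ℝ 𝔤] [NormedAddCommGroup F] [NormedSpace ℝ F]
  [NormedAddCommGroup V] [NormedSpace ℝ V]

theorem two_le_infty : (2 : WithTop ℕ∞) ≤ ∞ := by
  exact WithTop.coe_le_coe.2 (le_top : (2 : ℕ∞) ≤ ⊤)

/-- The derivatives of `f` along the vector fields `u ↦ A u v`, for `v : 𝔤`. -/
noncomputable def frameDeriv (f : E → F) (A : E → 𝔤 →L[ℝ] E) (u : E) : 𝔤 →L[ℝ] F :=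
  fderiv ℝ f u ∘L A u

theorem frameDeriv_apply (f : E → F) (A : E → 𝔤 →L[ℝ] E) (u : E) (v : 𝔤) :
    frameDeriv f A u v = fderiv ℝ f u (A u v) := rfl

theorem _root_.ContDiffAt.frameDeriv {f : E → F} {A : E → 𝔤 →L[ℝ] E} {u : E}
    (hf : ContDiffAt ℝ ∞ f u) (hA : ContDiffAt ℝ ∞ A u) :
    ContDiffAt ℝ ∞ (frameDeriv f A) u :=
  (hf.fderiv_right (m := ∞) (by simp)).clm_comp hA

/-- The second derivatives of `f` cancel by symmetry; what is left is `f` differentiated along the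
bracket of the two frame fields, which `hz` identifies with the field of `z`. -/
theorem frameDeriv_commutator {f : E → F} {A : E → 𝔤 →L[ℝ] E} {u : E}
    (hf : ContDiffAt ℝ ∞ f u) (hA : ContDiffAt ℝ ∞ A u) {v w z : 𝔤}
    (hz : fderiv ℝ A u (A u v) w - fderiv ℝ A u (A u w) v = A u z) :
    frameDeriv (frameDeriv f A) A u v w - frameDeriv (frameDeriv f A) A u w v =
      frameDeriv f A u z := by
  have h1 : HasFDerivAt (fderiv ℝ f) (fderiv ℝ (fderiv ℝ f) u) u :=
    ((hf.fderiv_right (m := ∞) (by simp)).differentiableAt (by simp)).hasFDerivAt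
  have h2 : HasFDerivAt A (fderiv ℝ A u) u := (hA.differentiableAt (by simp)).hasFDerivAt
  have h3 : ∀ a b : 𝔤, frameDeriv (frameDeriv f A) A u a b =
      fderiv ℝ (fderiv ℝ f) u (A u a) (A u b) + fderiv ℝ f u (fderiv ℝ A u (A u a) b) := by
    intro a b
    have := (h1.clm_comp h2).fderiv
    rw [frameDeriv_apply]
    change fderiv ℝ (fun y ↦ fderiv ℝ f y ∘L A y) u (A u a) b = _
    rw [this]
    simp [add_comm]
  have hs : IsSymmSndFDerivAt ℝ f u := hf.isSymmSndFDerivAt (by simpa using two_le_infty)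
  rw [h3, h3, hs.eq (A u v) (A u w), frameDeriv_apply, ← hz, map_sub]
  abel

variable {P : E → F} {A : E → 𝔤 →L[ℝ] E} {G : F × F → F} {η : V → V} {ι : V →L[ℝ] 𝔤}
  {u₀ : E} {y : V}

-- In `B u v w` and `C u v w x` the last argument is the innermost derivative: `B u v w` is the
-- field of `v` applied to the field of `w` applied to `P`.
local notation "Q" => frameDeriv P A
local notation "B" => frameDeriv (frameDeriv P A) A
local notation "C" => frameDeriv (frameDeriv (frameDeriv P A) A) A

/-- The first derivative of the equation that relates the spray coefficients `G` in a chart of the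
quotient to the spray vector field `η`. -/
theorem fderiv_spray_equation (hP : ContDiffAt ℝ ∞ P u₀) (hA : ContDiffAt ℝ ∞ A u₀)
    (hG : ContDiffAt ℝ ∞ G (P u₀, Q u₀ (ι y))) (hη : ContDiffAt ℝ ∞ η y)
    (h : ∀ᶠ p : E × V in 𝓝 (u₀, y), (2 : ℝ) • G (P p.1, Q p.1 (ι p.2)) =
      Q p.1 (ι (η p.2)) - B p.1 (ι p.2) (ι p.2)) (a : E) (b : V) :
    (2 : ℝ) • fderiv ℝ G (P u₀, Q u₀ (ι y)) (fderiv ℝ P u₀ a, fderiv ℝ Q u₀ a (ι y) + Q u₀ (ι b)) =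
      fderiv ℝ Q u₀ a (ι (η y)) + Q u₀ (ι (fderiv ℝ η y b)) -
        (fderiv ℝ B u₀ a (ι y) (ι y) + B u₀ (ι b) (ι y) + B u₀ (ι y) (ι b)) := by
  have hQ := hP.frameDeriv hA
  have hB := hQ.frameDeriv hA
  have d1 : HasFDerivAt (fun p : E × V ↦ p.1) (ContinuousLinearMap.fst ℝ E V) (u₀, y) :=
    hasFDerivAt_fst
  have d2 : HasFDerivAt (fun p : E × V ↦ ι p.2) (ι ∘L ContinuousLinearMap.snd ℝ E V) (u₀, y) :=
    (ι ∘L ContinuousLinearMap.snd ℝ E V).hasFDerivAt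
  have dP : HasFDerivAt (fun p : E × V ↦ P p.1) _ (u₀, y) :=
    HasFDerivAt.comp (u₀, y) (hP.differentiableAt (by simp)).hasFDerivAt d1
  have dQ : HasFDerivAt (fun p : E × V ↦ Q p.1) _ (u₀, y) :=
    HasFDerivAt.comp (g := Q) (u₀, y) (hQ.differentiableAt (by simp)).hasFDerivAt d1
  have dB : HasFDerivAt (fun p : E × V ↦ B p.1) _ (u₀, y) :=
    HasFDerivAt.comp (g := B) (u₀, y) (hB.differentiableAt (by simp)).hasFDerivAt d1
  have dη : HasFDerivAt (fun p : E × V ↦ ι (η p.2)) _ (u₀, y) :=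
    ι.hasFDerivAt.comp (u₀, y) (HasFDerivAt.comp (u₀, y)
      (hη.differentiableAt (by simp)).hasFDerivAt hasFDerivAt_snd)
  have dl := ((hG.differentiableAt (by simp)).hasFDerivAt.comp (u₀, y)
    (dP.prodMk (dQ.clm_apply d2))).const_smul (2 : ℝ)
  have dr := (dQ.clm_apply dη).sub ((dB.clm_apply d2).clm_apply d2)
  have := DFunLike.congr_fun (dl.unique (dr.congr_of_eventuallyEq h)) (a, b)
  simp at this
  rw [add_comm (fderiv ℝ Q u₀ a (ι y)), this]
  abel

/-- The derivative of the equation for the vertical derivatives of the spray coefficients, along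
the flow of the geodesics. -/
theorem fderiv_vertical_equation (hP : ContDiffAt ℝ ∞ P u₀) (hA : ContDiffAt ℝ ∞ A u₀)
    (hG : ContDiffAt ℝ ∞ G (P u₀, Q u₀ (ι y))) (hη : ContDiffAt ℝ ∞ η y) {v : V}
    (h : ∀ᶠ p : E × V in 𝓝 (u₀, y),
      (2 : ℝ) • fderiv ℝ G (P p.1, Q p.1 (ι p.2)) (0, Q p.1 (ι v)) =
      Q p.1 (ι (fderiv ℝ η p.2 v)) - (B p.1 (ι v) (ι p.2) + B p.1 (ι p.2) (ι v))) (a : E) (b : V) :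
    (2 : ℝ) • (fderiv ℝ (fderiv ℝ G) (P u₀, Q u₀ (ι y))
        (fderiv ℝ P u₀ a, fderiv ℝ Q u₀ a (ι y) + Q u₀ (ι b)) (0, Q u₀ (ι v)) +
      fderiv ℝ G (P u₀, Q u₀ (ι y)) (0, fderiv ℝ Q u₀ a (ι v))) =
      fderiv ℝ Q u₀ a (ι (fderiv ℝ η y v)) + Q u₀ (ι (fderiv ℝ (fderiv ℝ η) y b v)) -
        (fderiv ℝ B u₀ a (ι v) (ι y) + B u₀ (ι v) (ι b) +
          (fderiv ℝ B u₀ a (ι y) (ι v) + B u₀ (ι b) (ι v))) := by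
  have hQ := hP.frameDeriv hA
  have hB := hQ.frameDeriv hA
  have d1 : HasFDerivAt (fun p : E × V ↦ p.1) (ContinuousLinearMap.fst ℝ E V) (u₀, y) :=
    hasFDerivAt_fst
  have d2 : HasFDerivAt (fun p : E × V ↦ ι p.2) (ι ∘L ContinuousLinearMap.snd ℝ E V) (u₀, y) :=
    (ι ∘L ContinuousLinearMap.snd ℝ E V).hasFDerivAt
  have dv (x : 𝔤) : HasFDerivAt (fun _ : E × V ↦ x) (0 : E × V →L[ℝ] 𝔤) (u₀, y) :=
    hasFDerivAt_const _ _
  have dP : HasFDerivAt (fun p : E × V ↦ P p.1) _ (u₀, y) :=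
    HasFDerivAt.comp (u₀, y) (hP.differentiableAt (by simp)).hasFDerivAt d1
  have dQ : HasFDerivAt (fun p : E × V ↦ Q p.1) _ (u₀, y) :=
    HasFDerivAt.comp (g := Q) (u₀, y) (hQ.differentiableAt (by simp)).hasFDerivAt d1
  have dB : HasFDerivAt (fun p : E × V ↦ B p.1) _ (u₀, y) :=
    HasFDerivAt.comp (g := B) (u₀, y) (hB.differentiableAt (by simp)).hasFDerivAt d1
  have dη : HasFDerivAt (fun p : E × V ↦ fderiv ℝ η p.2) _ (u₀, y) :=
    HasFDerivAt.comp (u₀, y) ((hη.fderiv_right (m := ∞) (by simp)).differentiableAt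
      (by simp)).hasFDerivAt hasFDerivAt_snd
  have dηv : HasFDerivAt (fun p : E × V ↦ ι (fderiv ℝ η p.2 v)) _ (u₀, y) :=
    ι.hasFDerivAt.comp (u₀, y) (dη.clm_apply (hasFDerivAt_const v _))
  have dG : HasFDerivAt (fun p : E × V ↦ fderiv ℝ G (P p.1, Q p.1 (ι p.2))) _ (u₀, y) :=
    HasFDerivAt.comp (g := fderiv ℝ G) (u₀, y) ((hG.fderiv_right (m := ∞) (by simp)).differentiableAt
      (by simp)).hasFDerivAt (dP.prodMk (dQ.clm_apply d2))
  have dl := (dG.clm_apply ((hasFDerivAt_const (0 : F) (u₀, y)).prodMk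
    (dQ.clm_apply (dv (ι v))))).const_smul (2 : ℝ)
  have dr := (dQ.clm_apply dηv).sub
    (((dB.clm_apply (dv (ι v))).clm_apply d2).add ((dB.clm_apply d2).clm_apply (dv (ι v))))
  have := DFunLike.congr_fun (dl.unique (dr.congr_of_eventuallyEq h)) (a, b)
  simp at this
  rw [add_comm (fderiv ℝ Q u₀ a (ι y)), add_comm _ (fderiv ℝ G _ _), smul_add, this]
  abel

/-- The curvature of the spray with coefficients `G`, in terms of the spray vector field `η` and the
bracket `br` of the frame. -/
theorem curvature_of_spray_equation (hP' : ∀ᶠ u in 𝓝 u₀, ContDiffAt ℝ ∞ P u)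
    (hA' : ∀ᶠ u in 𝓝 u₀, ContDiffAt ℝ ∞ A u)
    (hG' : ∀ᶠ z in 𝓝 (P u₀, Q u₀ (ι y)), ContDiffAt ℝ ∞ G z)
    (hη' : ∀ᶠ z in 𝓝 y, ContDiffAt ℝ ∞ η z)
    {br : 𝔤 →L[ℝ] 𝔤 →L[ℝ] 𝔤} (hbr : ∀ᶠ u in 𝓝 u₀, ∀ v w,
      fderiv ℝ A u (A u v) w - fderiv ℝ A u (A u w) v = A u (br v w))
    (hswap : ∀ v w, br v w = -br w v) {pm : 𝔤 →L[ℝ] V} {ph : 𝔤 → 𝔤}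
    (hdec : ∀ x, x = ι (pm x) + ph x) (hQ : ∀ᶠ u in 𝓝 u₀, ∀ x, Q u (ph x) = 0)
    (h : ∀ᶠ p : E × V in 𝓝 (u₀, y), (2 : ℝ) • G (P p.1, Q p.1 (ι p.2)) =
      Q p.1 (ι (η p.2)) - B p.1 (ι p.2) (ι p.2)) {v m n : V}
    (hm : m = (1 / 2 : ℝ) • fderiv ℝ η y v + (1 / 2 : ℝ) • pm (br (ι y) (ι v)))
    (hn : n = (1 / 2 : ℝ) • fderiv ℝ η y v - (1 / 2 : ℝ) • pm (br (ι y) (ι v))) :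
    (2 : ℝ) • fderiv ℝ G (P u₀, Q u₀ (ι y)) (Q u₀ (ι v), 0) -
      fderiv ℝ (fderiv ℝ G) (P u₀, Q u₀ (ι y))
        (Q u₀ (ι y), -(2 : ℝ) • G (P u₀, Q u₀ (ι y))) (0, Q u₀ (ι v)) -
      fderiv ℝ G (P u₀, Q u₀ (ι y)) (0, fderiv ℝ G (P u₀, Q u₀ (ι y)) (0, Q u₀ (ι v))) =
    Q u₀ (ι (pm (br (ι y) (ph (br (ι v) (ι y)))) -
      (-(1 / 2 : ℝ) • fderiv ℝ (fderiv ℝ η) y (η y) v - (1 / 2 : ℝ) • fderiv ℝ η y m +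
        (1 / 2 : ℝ) • pm (br (ι (η y)) (ι v)) + (1 / 2 : ℝ) • pm (br (ι y) (ι m)) +
        fderiv ℝ η y n))) := by
  have hP := hP'.self_of_nhds
  have hA := hA'.self_of_nhds
  have hG := hG'.self_of_nhds
  have hη := hη'.self_of_nhds
  have hQs := hP.frameDeriv hA
  have hbr0 := hbr.self_of_nhds
  have hQ0 := hQ.self_of_nhds
  have ev {f : E → Prop} (hf : ∀ᶠ u in 𝓝 u₀, f u) : ∀ᶠ p : E × V in 𝓝 (u₀, y), f p.1 :=
    continuousAt_fst.eventually hf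
  -- the vertical derivatives
  have vert : ∀ᶠ p : E × V in 𝓝 (u₀, y), ∀ w : V,
      (2 : ℝ) • fderiv ℝ G (P p.1, Q p.1 (ι p.2)) (0, Q p.1 (ι w)) =
      Q p.1 (ι (fderiv ℝ η p.2 w)) - (B p.1 (ι w) (ι p.2) + B p.1 (ι p.2) (ι w)) := by
    have hGc : ContinuousAt (fun p : E × V ↦ (P p.1, Q p.1 (ι p.2))) (u₀, y) := by
      have c1 : ContinuousAt (fun p : E × V ↦ P p.1) (u₀, y) :=
        ContinuousAt.comp (f := Prod.fst) (g := P) hP.continuousAt continuousAt_fst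
      have c2 : ContinuousAt (fun p : E × V ↦ Q p.1) (u₀, y) :=
        ContinuousAt.comp (f := Prod.fst) (g := Q) hQs.continuousAt continuousAt_fst
      exact c1.prodMk (c2.clm_apply (ι.continuous.comp continuous_snd).continuousAt)
    -- The equation is differentiated at every point near `(u₀, y)`, not only there, because the
    -- result is to be differentiated once more.
    filter_upwards [h.eventually_nhds, ev hP', ev hA',
      hGc.eventually hG',
      continuousAt_snd.eventually hη'] with p h1 h2 h3 h4 h5 w
    have := fderiv_spray_equation (u₀ := p.1) (y := p.2) h2 h3 h4 h5 h1 0 w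
    simpa using this
  have E3 := vert.self_of_nhds
  -- Moving along the field of `v` with `y` fixed produces the horizontal derivative `∂ₓG (Q v)`, up
  -- to a vertical correction.
  have E1 := fderiv_spray_equation hP hA hG hη h (A u₀ (ι v)) 0
  -- The direction `(A y, -η y)` is the geodesic flow on `G × 𝔪`; by the equation itself it maps to
  -- the spray direction `(Q y, -2G)`, which is `hG2` below.
  have E2 := fderiv_vertical_equation hP hA hG hη (v := v) (vert.mono fun p hp ↦ hp v)
    (A u₀ (ι y)) (-η y)
  have E0 := h.self_of_nhds
  simp only [← frameDeriv_apply] at E1 E2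
  have K1 := frameDeriv_commutator hQs hA (hbr0 (ι v) (ι y))
  have K3 : ∀ᶠ u in 𝓝 u₀, ∀ a b, B u a b - B u b a = Q u (br a b) := by
    filter_upwards [hbr, hP', hA'] with u h1 h2 h3 a b
    exact frameDeriv_commutator h2 h3 (h1 a b)
  -- `K1` commutes the outer two derivatives; the inner two are commuted by differentiating the
  -- identity `K3`, valid near `u₀`, along the field of `y`.
  have K2 : C u₀ (ι y) (ι v) (ι y) - C u₀ (ι y) (ι y) (ι v) =
      B u₀ (ι y) (br (ι v) (ι y)) := by
    have hBd : HasFDerivAt B (fderiv ℝ B u₀) u₀ :=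
      ((hQs.frameDeriv hA).differentiableAt (by simp)).hasFDerivAt
    have hQd : HasFDerivAt Q (fderiv ℝ Q u₀) u₀ := (hQs.differentiableAt (by simp)).hasFDerivAt
    have c (x : 𝔤) : HasFDerivAt (fun _ : E ↦ x) (0 : E →L[ℝ] 𝔤) u₀ := hasFDerivAt_const _ _
    have d1 := ((hBd.clm_apply (c (ι v))).clm_apply (c (ι y))).sub
      ((hBd.clm_apply (c (ι y))).clm_apply (c (ι v)))
    have d2 := hQd.clm_apply (c (br (ι v) (ι y)))
    have := DFunLike.congr_fun (d1.unique (d2.congr_of_eventuallyEq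
      (K3.mono fun u hu ↦ hu (ι v) (ι y)))) (A u₀ (ι y))
    simpa [frameDeriv_apply] using this
  -- `Q` vanishes on the isotropy part near `u₀`, so its derivative does too. In the other order,
  -- `B` of an isotropy vector and `y` is not zero: `e2` gives minus the image of their bracket `[y,
  -- ·]_𝔪`.
  have hBh (x : 𝔤) (z : 𝔤) : B u₀ z (ph x) = 0 := by
    have hQd : HasFDerivAt Q (fderiv ℝ Q u₀) u₀ := (hQs.differentiableAt (by simp)).hasFDerivAt
    have d2 := hQd.clm_apply (hasFDerivAt_const (ph x) u₀)
    have := DFunLike.congr_fun (d2.unique ((hasFDerivAt_const (0 : F) u₀).congr_of_eventuallyEq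
      (hQ.mono fun u hu ↦ hu x))) (A u₀ z)
    simpa [frameDeriv_apply] using this
  have hQm (x : 𝔤) : Q u₀ x = Q u₀ (ι (pm x)) := by
    conv_lhs => rw [hdec x, map_add, hQ0, add_zero]
  obtain ⟨p, hp⟩ : ∃ p, p = pm (br (ι v) (ι y)) := ⟨_, rfl⟩
  obtain ⟨k, hk⟩ : ∃ k, k = ph (br (ι v) (ι y)) := ⟨_, rfl⟩
  have hvy : br (ι v) (ι y) = ι p + k := by rw [hp, hk]; exact hdec _
  have hyv : pm (br (ι y) (ι v)) = -p := by rw [hswap, map_neg, hp]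
  have hBk (z : 𝔤) : B u₀ z k = 0 := by rw [hk]; exact hBh _ _
  have K30 := K3.self_of_nhds
  have e1 : B u₀ (ι v) (ι y) = B u₀ (ι y) (ι v) + Q u₀ (ι p) := by
    rw [← sub_eq_iff_eq_add', K30, hQm, hp]
  have e2 : B u₀ k (ι y) = -Q u₀ (ι (pm (br (ι y) k))) := by
    have := K30 k (ι y)
    rw [hBk, sub_zero, hswap, map_neg, hQm] at this
    exact this
  have e3 : B u₀ (ι p) (ι y) = B u₀ (ι y) (ι p) - Q u₀ (ι (pm (br (ι y) (ι p)))) := by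
    have := K30 (ι p) (ι y)
    rw [hswap, map_neg, hQm] at this
    rw [sub_eq_iff_eq_add'.mp this, sub_eq_add_neg]
  have e4 : B u₀ (ι (η y)) (ι v) =
      B u₀ (ι v) (ι (η y)) + Q u₀ (ι (pm (br (ι (η y)) (ι v)))) := by
    rw [← sub_eq_iff_eq_add', K30, hQm]
  have e5 : B u₀ (ι m) (ι y) = B u₀ (ι y) (ι m) - Q u₀ (ι (pm (br (ι y) (ι m)))) := by
    have := K30 (ι m) (ι y)
    rw [hswap, map_neg, hQm] at this
    rw [sub_eq_iff_eq_add'.mp this, sub_eq_add_neg]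
  rw [hyv] at hm hn
  have hG2 : B u₀ (ι y) (ι y) + Q u₀ (ι (-η y)) = -(2 : ℝ) • G (P u₀, Q u₀ (ι y)) := by
    rw [map_neg, map_neg, neg_smul, E0]; abel
  have hsplit (a b : F) : fderiv ℝ G (P u₀, Q u₀ (ι y)) (a, b) =
      fderiv ℝ G (P u₀, Q u₀ (ι y)) (a, 0) + fderiv ℝ G (P u₀, Q u₀ (ι y)) (0, b) := by
    rw [← map_add]; simp
  have hadd (a b : F) : fderiv ℝ G (P u₀, Q u₀ (ι y)) (0, a + b) =
      fderiv ℝ G (P u₀, Q u₀ (ι y)) (0, a) + fderiv ℝ G (P u₀, Q u₀ (ι y)) (0, b) := by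
    rw [← map_add]; simp
  have hsub (a b : F) : fderiv ℝ G (P u₀, Q u₀ (ι y)) (0, a - b) =
      fderiv ℝ G (P u₀, Q u₀ (ι y)) (0, a) - fderiv ℝ G (P u₀, Q u₀ (ι y)) (0, b) := by
    rw [← map_sub]; simp
  -- The vertical equation solved for `∂G/∂y`. The derivative of `G` in the vertical direction `B(y,
  -- v)`, which reappears when this is iterated, is never evaluated: it cancels between `E1`, `E2`
  -- and the iterate.
  have hGv : fderiv ℝ G (P u₀, Q u₀ (ι y)) (0, Q u₀ (ι v)) =
      Q u₀ (ι m) - B u₀ (ι y) (ι v) := by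
    have := E3 v
    dsimp only at this
    rw [e1] at this
    rw [hm]
    simp only [map_add, map_smul, map_neg]
    linear_combination (norm := module) (1 / 2 : ℝ) • this
  rw [hG2] at E2
  rw [hvy] at K1 K2
  rw [hGv, hsub, ← hk]
  have E3m := E3 m
  have E3p := E3 p
  dsimp only at E3m E3p
  rw [hsplit] at E1
  simp only [map_zero, add_zero, zero_apply,
    e1, hadd] at E1
  rw [e5] at E3m
  rw [e3] at E3p
  have K1' := DFunLike.congr_fun K1 (ι y)
  simp only [map_add, add_apply, sub_apply, hBk, e2, e3] at K1' K2
  simp only [map_neg, neg_apply, e4] at E2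
  have hDv : fderiv ℝ η y v = (2 : ℝ) • m + p := by rw [hm]; module
  have hnm : n = m + p := by rw [hn, hDv]; module
  rw [hDv] at E2
  rw [hnm]
  simp only [map_add, map_sub, map_smul] at E2 ⊢
  -- `E1 - ½ E2` brings in the third derivatives `-C(v,y,y) + ½ C(y,v,y) + ½ C(y,y,v)`, which `K1'`
  -- and `½ K2` remove; `E3m` and `E3p` supply the vertical derivatives in the directions `m` and
  -- `p`.
  linear_combination (norm := module) E1 - (1 / 2 : ℝ) • E2 - (1 / 2 : ℝ) • E3m - E3p - K1' - (1 / 2 : ℝ) • K2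

end Frame


/-! ### Smoothness of tangent maps, and the tangent bundle of a vector space. -/

section TangentBundle

variable {E E' M N : Type*} [NormedAddCommGroup E] [NormedSpace ℝ E]
  [NormedAddCommGroup E'] [NormedSpace ℝ E']
  [TopologicalSpace M] [ChartedSpace E M] [IsManifold 𝓘(ℝ, E) ∞ M]
  [TopologicalSpace N] [ChartedSpace E' N] [IsManifold 𝓘(ℝ, E') ∞ N]

theorem contMDiffAt_tangentMap {f : M → N} {s : Set M} (hs : IsOpen s)
    (hf : ContMDiffOn 𝓘(ℝ, E) 𝓘(ℝ, E') ∞ f s) {p : TangentBundle 𝓘(ℝ, E) M} (hp : p.1 ∈ s) :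
    ContMDiffAt 𝓘(ℝ, E).tangent 𝓘(ℝ, E').tangent ∞ (tangentMap 𝓘(ℝ, E) 𝓘(ℝ, E') f) p := by
  have h := hf.contMDiffOn_tangentMapWithin (m := ∞) (by simp) hs.uniqueMDiffOn
  have ho : IsOpen (π E (TangentSpace 𝓘(ℝ, E) : M → Type _) ⁻¹' s) :=
    hs.preimage (FiberBundle.continuous_proj E _)
  refine (h.contMDiffAt (ho.mem_nhds hp)).congr_of_eventuallyEq ?_
  filter_upwards [ho.mem_nhds hp] with q hq
  exact (tangentMapWithin_eq_tangentMap (hs.uniqueMDiffWithinAt hq)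
    ((hf.contMDiffAt (hs.mem_nhds hq)).mdifferentiableAt (by simp))).symm

theorem contMDiff_tangentBundle_mk :
    ContMDiff 𝓘(ℝ, E × E) 𝓘(ℝ, E).tangent ∞
      (fun z : E × E ↦ (⟨z.1, z.2⟩ : TangentBundle 𝓘(ℝ, E) E)) := by
  intro z
  rw [contMDiffAt_totalSpace]
  refine ⟨contDiff_fst.contMDiff.contMDiffAt, ?_⟩
  simpa using (contDiff_snd (𝕜 := ℝ) (E := E) (F := E) (n := ∞)).contMDiff.contMDiffAt

theorem contMDiff_tangentBundle_vectorSpace_prod :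
    ContMDiff 𝓘(ℝ, E).tangent 𝓘(ℝ, E × E) ∞
      (fun p : TangentBundle 𝓘(ℝ, E) E ↦ ((p.1, p.2) : E × E)) := by
  have h1 : ContMDiff 𝓘(ℝ, E).tangent 𝓘(ℝ, E) ∞ (fun p : TangentBundle 𝓘(ℝ, E) E ↦ (p.1 : E)) :=
    contMDiff_proj _
  have h2 : ContMDiff 𝓘(ℝ, E).tangent 𝓘(ℝ, E) ∞ (fun p : TangentBundle 𝓘(ℝ, E) E ↦ (p.2 : E)) :=
    contMDiff_snd_tangentBundle_modelSpace E 𝓘(ℝ, E)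
  exact h1.prodMk_space h2

end TangentBundle

/-! ### Sprays in charts: the geodesic equation and transport by diffeomorphisms. -/

section Spray

variable {F : Type*} [NormedAddCommGroup F] [NormedSpace ℝ F]
  {M : Type*} [TopologicalSpace M] [ChartedSpace F M]
  {e : OpenPartialHomeomorph M F}

theorem mdifferentiable_of_mem_maximalAtlas (he : e ∈ IsManifold.maximalAtlas 𝓘(ℝ, F) ∞ M) :
    e.MDifferentiable 𝓘(ℝ, F) 𝓘(ℝ, F) :=
  ⟨(contMDiffOn_of_mem_maximalAtlas he).mdifferentiableOn (by simp),
    (contMDiffOn_symm_of_mem_maximalAtlas he).mdifferentiableOn (by simp)⟩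

/-- The chart `e ∘ f⁻¹`, for a diffeomorphism `f` of `M`. -/
noncomputable def transportChart (f : Diffeomorph 𝓘(ℝ, F) 𝓘(ℝ, F) M M ∞)
    (e : OpenPartialHomeomorph M F) : OpenPartialHomeomorph M F :=
  f.symm.toHomeomorph.toOpenPartialHomeomorph.trans e

theorem transportChart_source (f : Diffeomorph 𝓘(ℝ, F) 𝓘(ℝ, F) M M ∞) {x : M} :
    x ∈ (transportChart f e).source ↔ f.symm x ∈ e.source := by
  simp [transportChart]

theorem tangentPoint_tangentCoord (he : e ∈ IsManifold.maximalAtlas 𝓘(ℝ, F) ∞ M)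
    {p : TangentBundle 𝓘(ℝ, F) M} (hp : p.1 ∈ e.source) :
    tangentPoint e (tangentCoord e p).1 (tangentCoord e p).2 = p := by
  obtain ⟨x, v⟩ := p
  have h1 := (mdifferentiable_of_mem_maximalAtlas he).symm_comp_deriv hp
  have h2 := DFunLike.congr_fun h1 v
  have h3 : e.symm (e x) = x := e.left_inv hp
  have h4 : (tangentPoint e (tangentCoord e ⟨x, v⟩).1 (tangentCoord e ⟨x, v⟩).2) =
      (⟨e.symm (e x), v⟩ : TangentBundle 𝓘(ℝ, F) M) := by
    unfold tangentPoint tangentCoord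
    congr 1
  rw [h4, h3]

theorem tangentCoord_tangentPoint (he : e ∈ IsManifold.maximalAtlas 𝓘(ℝ, F) ∞ M)
    {x : F} (hx : x ∈ e.target) (v : F) :
    tangentCoord e (tangentPoint e x v) = (x, v) := by
  have h1 := (mdifferentiable_of_mem_maximalAtlas he).comp_symm_deriv hx
  have h2 := DFunLike.congr_fun h1 v
  exact Prod.ext (e.right_inv hx) h2

theorem tangentCoord_velocity (he : e ∈ IsManifold.maximalAtlas 𝓘(ℝ, F) ∞ M) {c : ℝ → M} {t : ℝ}
    (hc : MDifferentiableAt 𝓘(ℝ, ℝ) 𝓘(ℝ, F) c t) (ht : c t ∈ e.source) :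
    tangentCoord e (velocity c t) = (e (c t), deriv (fun τ ↦ e (c τ)) t) := by
  have h1 : MDifferentiableAt 𝓘(ℝ, F) 𝓘(ℝ, F) e (c t) :=
    (mdifferentiable_of_mem_maximalAtlas he).mdifferentiableAt ht
  have h2 := mfderiv_comp t h1 hc
  refine Prod.ext rfl ?_
  have h3 := DFunLike.congr_fun h2 (1 : ℝ)
  rw [← fderiv_apply_one_eq_deriv, ← mfderiv_eq_fderiv]
  exact h3.symm

variable [IsManifold 𝓘(ℝ, F) ∞ M]

theorem contMDiffAt_tangentCoord (he : e ∈ IsManifold.maximalAtlas 𝓘(ℝ, F) ∞ M)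
    {p : TangentBundle 𝓘(ℝ, F) M} (hp : p.1 ∈ e.source) :
    ContMDiffAt 𝓘(ℝ, F).tangent 𝓘(ℝ, F × F) ∞ (tangentCoord e) p :=
  contMDiff_tangentBundle_vectorSpace_prod.contMDiffAt.comp p
    (contMDiffAt_tangentMap e.open_source (contMDiffOn_of_mem_maximalAtlas he) hp)

theorem contMDiffAt_tangentPoint (he : e ∈ IsManifold.maximalAtlas 𝓘(ℝ, F) ∞ M)
    {z : F × F} (hz : z.1 ∈ e.target) :
    ContMDiffAt 𝓘(ℝ, F × F) 𝓘(ℝ, F).tangent ∞ (fun z : F × F ↦ tangentPoint e z.1 z.2) z :=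
  ContMDiffAt.comp (g := tangentMap 𝓘(ℝ, F) 𝓘(ℝ, F) e.symm) z
    (contMDiffAt_tangentMap e.open_target (contMDiffOn_symm_of_mem_maximalAtlas he) hz)
    contMDiff_tangentBundle_mk.contMDiffAt

/-- `tangentPoint` is a differentiable left inverse near `p`. This lets an equation between vectors
tangent to `TM` be checked on coordinates. -/
theorem mfderiv_tangentCoord_injective (he : e ∈ IsManifold.maximalAtlas 𝓘(ℝ, F) ∞ M)
    {p : TangentBundle 𝓘(ℝ, F) M} (hp : p.1 ∈ e.source) :
    Function.Injective (mfderiv 𝓘(ℝ, F).tangent 𝓘(ℝ, F × F) (tangentCoord e) p) := by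
  have h1 : MDifferentiableAt 𝓘(ℝ, F).tangent 𝓘(ℝ, F × F) (tangentCoord e) p :=
    (contMDiffAt_tangentCoord he hp).mdifferentiableAt (by simp)
  have h2 : MDifferentiableAt 𝓘(ℝ, F × F) 𝓘(ℝ, F).tangent
      (fun z : F × F ↦ tangentPoint e z.1 z.2) (tangentCoord e p) :=
    (contMDiffAt_tangentPoint he (e.map_source hp)).mdifferentiableAt (by simp)
  have h3 := (h2.hasMFDerivAt.comp p h1.hasMFDerivAt)
  have ho : IsOpen (π F (TangentSpace 𝓘(ℝ, F) : M → Type _) ⁻¹' e.source) :=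
    e.open_source.preimage (FiberBundle.continuous_proj F _)
  have h4 : HasMFDerivAt 𝓘(ℝ, F).tangent 𝓘(ℝ, F).tangent
      ((fun z : F × F ↦ tangentPoint e z.1 z.2) ∘ tangentCoord e) p
      (ContinuousLinearMap.id ℝ (TangentSpace 𝓘(ℝ, F).tangent p)) := by
    refine (hasMFDerivAt_id p).congr_of_eventuallyEq ?_
    filter_upwards [ho.mem_nhds hp] with q hq
    exact tangentPoint_tangentCoord he hq
  have h5 := hasMFDerivAt_unique h3 h4
  intro a b hab
  have ha := DFunLike.congr_fun h5 a
  have hb := DFunLike.congr_fun h5 b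
  refine ha.symm.trans (Eq.trans ?_ hb)
  change mfderiv 𝓘(ℝ, F × F) 𝓘(ℝ, F).tangent _ _ _ = mfderiv 𝓘(ℝ, F × F) 𝓘(ℝ, F).tangent _ _ _
  exact congrArg _ hab

theorem localVec_tangentCoord (he : e ∈ IsManifold.maximalAtlas 𝓘(ℝ, F) ∞ M)
    (X : (p : TangentBundle 𝓘(ℝ, F) M) → TangentSpace 𝓘(ℝ, F).tangent p)
    {p : TangentBundle 𝓘(ℝ, F) M} (hp : p.1 ∈ e.source) :
    localVec X e (tangentCoord e p).1 (tangentCoord e p).2 =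
      mfderiv 𝓘(ℝ, F).tangent 𝓘(ℝ, F × F) (tangentCoord e) p (X p) := by
  unfold localVec
  rw [tangentPoint_tangentCoord he hp]

theorem contMDiffAt_velocity {c : ℝ → M} {s : Set ℝ} (hs : IsOpen s)
    (hc : ContMDiffOn 𝓘(ℝ, ℝ) 𝓘(ℝ, F) ∞ c s) {t : ℝ} (ht : t ∈ s) :
    ContMDiffAt 𝓘(ℝ, ℝ) 𝓘(ℝ, F).tangent ∞ (velocity (F := F) c) t := by
  have h1 : ContMDiffAt 𝓘(ℝ, ℝ) 𝓘(ℝ, ℝ × ℝ) ∞ (fun τ : ℝ ↦ (τ, (1 : ℝ))) t :=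
    (contDiff_id.prodMk contDiff_const).contMDiff.contMDiffAt
  exact ContMDiffAt.comp (g := tangentMap 𝓘(ℝ, ℝ) 𝓘(ℝ, F) c) t
    (contMDiffAt_tangentMap hs hc ht)
    (ContMDiffAt.comp (g := fun z : ℝ × ℝ ↦ (⟨z.1, z.2⟩ : TangentBundle 𝓘(ℝ, ℝ) ℝ)) t
      contMDiff_tangentBundle_mk.contMDiffAt h1)

/-- The geodesic equation `x'' = -2 G(x, x')` in the chart `e`. -/
theorem hasMFDerivAt_velocity_iff (S : Spray F M)
    (he : e ∈ IsManifold.maximalAtlas 𝓘(ℝ, F) ∞ M) {c : ℝ → M} {s : Set ℝ} (hs : IsOpen s)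
    (hc : ContMDiffOn 𝓘(ℝ, ℝ) 𝓘(ℝ, F) ∞ c s) {t : ℝ} (ht : t ∈ s) (hte : c t ∈ e.source)
    (hne : deriv (fun τ ↦ e (c τ)) t ≠ 0) :
    HasMFDerivAt 𝓘(ℝ, ℝ) 𝓘(ℝ, F).tangent (velocity (F := F) c) t
        ((1 : ℝ →L[ℝ] ℝ).smulRight (S.vec (velocity c t))) ↔
      deriv (deriv (fun τ ↦ e (c τ))) t =
        -(2 : ℝ) • S.coeff e (e (c t)) (deriv (fun τ ↦ e (c τ)) t) := by
  have hv : MDifferentiableAt 𝓘(ℝ, ℝ) 𝓘(ℝ, F).tangent (velocity (F := F) c) t :=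
    (contMDiffAt_velocity hs hc ht).mdifferentiableAt (by simp)
  have hcd : ∀ τ ∈ s, MDifferentiableAt 𝓘(ℝ, ℝ) 𝓘(ℝ, F) c τ := fun τ hτ ↦
    (hc.contMDiffAt (hs.mem_nhds hτ)).mdifferentiableAt (by simp)
  have hsrc : (velocity (F := F) c t).1 ∈ e.source := hte
  have hφ := ((contMDiffAt_tangentCoord he hsrc).mdifferentiableAt (by simp)).hasMFDerivAt
  have hco := tangentCoord_velocity he (hcd t ht) hte
  have hev : (fun τ ↦ tangentCoord e (velocity c τ)) =ᶠ[𝓝 t]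
      fun τ ↦ (e (c τ), deriv (fun τ ↦ e (c τ)) τ) := by
    filter_upwards [hs.mem_nhds ht, (hcd t ht).continuousAt.preimage_mem_nhds
      (e.open_source.mem_nhds hte)] with τ h1 h2
    exact tangentCoord_velocity he (hcd τ h1) h2
  -- Whatever vector `D` is the derivative of the velocity curve, its coordinates must be `(x',
  -- x'')`; used with `D` the spray vector and with `D` the actual derivative.
  have key : ∀ D : TangentSpace 𝓘(ℝ, F).tangent (velocity (F := F) c t),
      HasMFDerivAt 𝓘(ℝ, ℝ) 𝓘(ℝ, F).tangent (velocity (F := F) c) t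
        ((1 : ℝ →L[ℝ] ℝ).smulRight D) →
      mfderiv 𝓘(ℝ, F).tangent 𝓘(ℝ, F × F) (tangentCoord e) (velocity c t) D =
        (deriv (fun τ ↦ e (c τ)) t, deriv (deriv (fun τ ↦ e (c τ))) t) := by
    intro D hD
    obtain ⟨z, hz⟩ : ∃ z : F × F,
      z = mfderiv 𝓘(ℝ, F).tangent 𝓘(ℝ, F × F) (tangentCoord e) (velocity c t) D := ⟨_, rfl⟩
    have h1 : HasDerivAt (fun τ ↦ tangentCoord e (velocity c τ)) z t := by
      have h0 : HasFDerivAt (fun τ ↦ tangentCoord e (velocity c τ))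
        (ContinuousLinearMap.toSpanSingleton ℝ z) t := by
        have := hasMFDerivAt_iff_hasFDerivAt.1 (hφ.comp t hD)
        refine HasFDerivAt.congr_fderiv this (ContinuousLinearMap.ext fun (r : ℝ) ↦ ?_)
        have h3 := ContinuousLinearMap.map_smul
          (mfderiv 𝓘(ℝ, F).tangent 𝓘(ℝ, F × F) (tangentCoord e) (velocity c t)) r D
        exact h3.trans (congrArg (fun w : F × F ↦ r • w) hz.symm)
      exact hasDerivAt_iff_hasFDerivAt.2 h0
    have h2 : HasDerivAt (fun τ ↦ (e (c τ), deriv (fun τ ↦ e (c τ)) τ)) z t :=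
      h1.congr_of_eventuallyEq hev.symm
    have h3 : HasDerivAt (fun τ ↦ e (c τ)) z.1 t :=
      (ContinuousLinearMap.fst ℝ F F).hasFDerivAt.comp_hasDerivAt t h2
    have h4 : HasDerivAt (deriv fun τ ↦ e (c τ)) z.2 t :=
      (ContinuousLinearMap.snd ℝ F F).hasFDerivAt.comp_hasDerivAt t h2
    rw [← hz, h3.deriv, h4.deriv]
  -- The first component is the spray condition `fst_localVec`, available only off the zero section;
  -- this is where `hne` enters.
  have hX : mfderiv 𝓘(ℝ, F).tangent 𝓘(ℝ, F × F) (tangentCoord e) (velocity c t)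
      (S.vec (velocity c t)) = (deriv (fun τ ↦ e (c τ)) t,
        -(2 : ℝ) • S.coeff e (e (c t)) (deriv (fun τ ↦ e (c τ)) t)) := by
    rw [← localVec_tangentCoord he S.vec hsrc, hco]
    refine Prod.ext (S.fst_localVec e he _ (e.map_source hte) _ hne) ?_
    simp [Spray.coeff, localCoeff, smul_smul]
  constructor
  · intro h
    have := (key _ h).symm.trans hX
    exact congrArg Prod.snd this
  · intro h
    have hD : HasMFDerivAt 𝓘(ℝ, ℝ) 𝓘(ℝ, F).tangent (velocity (F := F) c) t
        ((1 : ℝ →L[ℝ] ℝ).smulRight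
          (mfderiv 𝓘(ℝ, ℝ) 𝓘(ℝ, F).tangent (velocity (F := F) c) t (1 : ℝ))) := by
      refine hv.hasMFDerivAt.congr_mfderiv (ContinuousLinearMap.ext fun (r : ℝ) ↦ ?_)
      have h1 := ContinuousLinearMap.map_smul
        (mfderiv 𝓘(ℝ, ℝ) 𝓘(ℝ, F).tangent (velocity (F := F) c) t) r (1 : ℝ)
      have h2 : r • (1 : ℝ) = r := mul_one r
      exact (congrArg _ h2).symm.trans h1
    have h1 := key _ hD
    rw [h, ← hX] at h1
    rwa [mfderiv_tangentCoord_injective he hsrc h1] at hD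

theorem transportChart_mem_maximalAtlas (f : Diffeomorph 𝓘(ℝ, F) 𝓘(ℝ, F) M M ∞)
    (he : e ∈ IsManifold.maximalAtlas 𝓘(ℝ, F) ∞ M) :
    transportChart f e ∈ IsManifold.maximalAtlas 𝓘(ℝ, F) ∞ M := by
  rw [IsManifold.mem_maximalAtlas_iff_contMDiffOn]
  constructor
  · refine (contMDiffOn_of_mem_maximalAtlas he).comp f.symm.contMDiff.contMDiffOn ?_
    intro x hx
    simpa [transportChart] using hx
  · refine f.contMDiff.comp_contMDiffOn
      ((contMDiffOn_symm_of_mem_maximalAtlas he).mono ?_)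
    intro x hx
    simpa [transportChart] using hx

/-- `f` carries the coordinates of `e` to those of `e ∘ f⁻¹` on the tangent bundle, so a vector
field preserved by the tangent map of `f` has equal components in the two charts. Invariance enters
the proof through this. -/
theorem localCoeff_transportChart {X : (p : TangentBundle 𝓘(ℝ, F) M) →
      TangentSpace 𝓘(ℝ, F).tangent p} {f : Diffeomorph 𝓘(ℝ, F) 𝓘(ℝ, F) M M ∞}
    (hf : ∀ p : TangentBundle 𝓘(ℝ, F) M, p.2 ≠ 0 →
      mfderiv 𝓘(ℝ, F).tangent 𝓘(ℝ, F).tangent (tangentMap 𝓘(ℝ, F) 𝓘(ℝ, F) f) p (X p) =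
        X (tangentMap 𝓘(ℝ, F) 𝓘(ℝ, F) f p))
    (he : e ∈ IsManifold.maximalAtlas 𝓘(ℝ, F) ∞ M) {x v : F} (hx : x ∈ e.target) (hv : v ≠ 0) :
    localCoeff X (transportChart f e) x v = localCoeff X e x v := by
  obtain ⟨p, hp⟩ : ∃ p, p = tangentPoint e x v := ⟨_, rfl⟩
  have hpe : p.1 ∈ e.source := by rw [hp]; exact e.map_target hx
  have hpc : tangentCoord e p = (x, v) := by rw [hp]; exact tangentCoord_tangentPoint he hx v
  have hp2 : p.2 ≠ 0 := by
    intro h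
    have h1 : mfderiv 𝓘(ℝ, F) 𝓘(ℝ, F) e p.1 p.2 = v := congrArg Prod.snd hpc
    rw [h] at h1
    exact hv (h1.symm.trans (map_zero _))
  have hfp : (tangentMap 𝓘(ℝ, F) 𝓘(ℝ, F) f p).1 ∈ (transportChart f e).source := by
    rw [transportChart_source]
    change f.symm (f p.1) ∈ _
    rwa [f.symm_apply_apply]
  have he' := transportChart_mem_maximalAtlas f he
  have hcomp (q : TangentBundle 𝓘(ℝ, F) M) (hq : q.1 ∈ e.source) :
      tangentCoord (transportChart f e) (tangentMap 𝓘(ℝ, F) 𝓘(ℝ, F) f q) = tangentCoord e q := by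
    have h1 : (transportChart f e : M → F) ∘ f = e := by
      ext z
      simp [transportChart]
    have hq' : f q.1 ∈ (transportChart f e).source := by
      rw [transportChart_source, f.symm_apply_apply]; exact hq
    have h2 := mfderiv_comp q.1
      ((mdifferentiable_of_mem_maximalAtlas he').mdifferentiableAt hq')
      (f.contMDiff.mdifferentiable (by simp) q.1)
    rw [h1] at h2
    exact Prod.ext (congrFun h1 q.1) (DFunLike.congr_fun h2 q.2).symm
  have hT : ContMDiffAt 𝓘(ℝ, F).tangent 𝓘(ℝ, F).tangent ∞ (tangentMap 𝓘(ℝ, F) 𝓘(ℝ, F) f) p :=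
    contMDiffAt_tangentMap isOpen_univ f.contMDiff.contMDiffOn (mem_univ _)
  have ho : IsOpen (π F (TangentSpace 𝓘(ℝ, F) : M → Type _) ⁻¹' e.source) :=
    e.open_source.preimage (FiberBundle.continuous_proj F _)
  have h1 : mfderiv 𝓘(ℝ, F).tangent 𝓘(ℝ, F × F) (tangentCoord e) p =
      mfderiv 𝓘(ℝ, F).tangent 𝓘(ℝ, F × F)
        (tangentCoord (transportChart f e) ∘ tangentMap 𝓘(ℝ, F) 𝓘(ℝ, F) f) p := by
    refine Filter.EventuallyEq.mfderiv_eq ?_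
    filter_upwards [ho.mem_nhds hpe] with q hq
    exact (hcomp q hq).symm
  rw [mfderiv_comp p ((contMDiffAt_tangentCoord he' hfp).mdifferentiableAt (by simp))
    (hT.mdifferentiableAt (by simp))] at h1
  have h2 := DFunLike.congr_fun h1 (X p)
  have h3 : localVec X (transportChart f e) x v = localVec X e x v := by
    have h4 := localVec_tangentCoord he X hpe
    have h5 := localVec_tangentCoord he' X hfp
    rw [hcomp p hpe, hpc] at h5
    rw [hpc] at h4
    rw [h4, h5, ← hf p hp2]
    exact h2.symm
  rw [localCoeff, localCoeff, h3]

end Spray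


/-! ### Left invariant vector fields in the chart at `1`. -/

section LeftFrame

variable {E : Type*} [NormedAddCommGroup E] [NormedSpace ℝ E]
  {G : Type*} [Group G] [TopologicalSpace G] [ChartedSpace E G]

variable (G) in
/-- The left invariant vector fields of `G`, in the preferred chart at `1`. -/
noncomputable def leftFrame (u : E) : E →L[ℝ] E :=
  fderiv ℝ (fun z ↦ chartAt E (1 : G) ((chartAt E (1 : G)).symm u * (chartAt E (1 : G)).symm z))
    (chartAt E (1 : G) 1)

variable [LieGroup 𝓘(ℝ, E) ∞ G]

theorem chartAt_mem_maximalAtlas {F M : Type*} [NormedAddCommGroup F] [NormedSpace ℝ F]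
    [TopologicalSpace M] [ChartedSpace F M] [IsManifold 𝓘(ℝ, F) ∞ M] (x : M) :
    chartAt F x ∈ IsManifold.maximalAtlas 𝓘(ℝ, F) ∞ M :=
  IsManifold.chart_mem_maximalAtlas x

theorem hasDerivAt_of_hasMFDerivAt {F : Type*} [NormedAddCommGroup F] [NormedSpace ℝ F]
    {f : ℝ → F} {t : ℝ} {D : ℝ →L[ℝ] F} (h : HasMFDerivAt 𝓘(ℝ, ℝ) 𝓘(ℝ, F) f t D) :
    HasDerivAt f (D 1) t := by
  have h1 : HasFDerivAt f D t := hasMFDerivAt_iff_hasFDerivAt.1 h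
  exact h1.hasDerivAt

theorem mfderiv_chartAt_self {F M : Type*} [NormedAddCommGroup F] [NormedSpace ℝ F]
    [TopologicalSpace M] [ChartedSpace F M] [IsManifold 𝓘(ℝ, F) ∞ M] (x : M)
    (v : TangentSpace 𝓘(ℝ, F) x) :
    mfderiv 𝓘(ℝ, F) 𝓘(ℝ, F) (chartAt F x) x v = v := by
  have : IsManifold 𝓘(ℝ, F) 1 M := IsManifold.of_le (n := ∞) (by simp)
  have h := mfderiv_extChartAt_self (I := 𝓘(ℝ, F)) (x := x)
  simp only [mfld_simps] at h
  rw [h]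
  rfl

theorem contDiffAt_chart_mul {u : E} (hu : u ∈ (chartAt E (1 : G)).target) :
    ContDiffAt ℝ ∞ (fun p : E × E ↦ chartAt E (1 : G)
      ((chartAt E (1 : G)).symm p.1 * (chartAt E (1 : G)).symm p.2)) (u, chartAt E (1 : G) 1) := by
  have hφ := chartAt_mem_maximalAtlas (F := E) (1 : G)
  have h1 : ContMDiffAt 𝓘(ℝ, E × E) 𝓘(ℝ, E) ∞
      (fun p : E × E ↦ (chartAt E (1 : G)).symm p.1) (u, chartAt E (1 : G) 1) :=
    ContMDiffAt.comp (g := (chartAt E (1 : G)).symm) _ (contMDiffAt_symm_of_mem_maximalAtlas hφ hu)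
      contDiff_fst.contMDiff.contMDiffAt
  have h2 : ContMDiffAt 𝓘(ℝ, E × E) 𝓘(ℝ, E) ∞
      (fun p : E × E ↦ (chartAt E (1 : G)).symm p.2) (u, chartAt E (1 : G) 1) :=
    ContMDiffAt.comp (g := (chartAt E (1 : G)).symm) _ (contMDiffAt_symm_of_mem_maximalAtlas hφ
      (mem_chart_target E (1 : G))) contDiff_snd.contMDiff.contMDiffAt
  refine ContMDiffAt.contDiffAt (ContMDiffAt.comp (g := chartAt E (1 : G)) _
    (contMDiffAt_of_mem_maximalAtlas hφ ?_) (h1.mul h2))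
  simpa using (chartAt E (1 : G)).map_target hu

/-- The frame is a partial derivative of the multiplication in the chart, hence smooth in the
remaining variable. -/
theorem contDiffAt_leftFrame {u : E} (hu : u ∈ (chartAt E (1 : G)).target) :
    ContDiffAt ℝ ∞ (leftFrame G) u :=
  ContDiffAt.fderiv (f := fun u z ↦ chartAt E (1 : G)
      ((chartAt E (1 : G)).symm u * (chartAt E (1 : G)).symm z))
    (g := fun _ ↦ chartAt E (1 : G) 1) (m := ∞) (n := ∞)
    (contDiffAt_chart_mul hu) contDiffAt_const (by simp)

theorem mdifferentiable_mul_left' (g : G) :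
    MDifferentiable 𝓘(ℝ, E) 𝓘(ℝ, E) (fun x : G ↦ g * x) :=
  (contMDiff_mul_left (I := 𝓘(ℝ, E)) (n := ∞)).mdifferentiable (by simp)

/-- Two chain rules for `x ↦ φ (g * x)` at `1`, with `φ` the chart: one through the group, one
through the coordinates. The derivative of the preferred chart at its own centre is the identity, so
Lie algebra elements need no conversion. -/
theorem mfderiv_chartAt_mulInvariantVectorField {g : G} (hg : g ∈ (chartAt E (1 : G)).source)
    (v : GroupLieAlgebra 𝓘(ℝ, E) G) :
    mfderiv 𝓘(ℝ, E) 𝓘(ℝ, E) (chartAt E (1 : G)) g (mulInvariantVectorField v g) =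
      leftFrame G (chartAt E (1 : G) g) v := by
  have hφ := chartAt_mem_maximalAtlas (F := E) (1 : G)
  have hd := mdifferentiable_of_mem_maximalAtlas hφ
  have h1 : MDifferentiableAt 𝓘(ℝ, E) 𝓘(ℝ, E) (fun x : G ↦ g * x) 1 :=
    mdifferentiable_mul_left' g 1
  have hg1 : g * 1 ∈ (chartAt E (1 : G)).source := by simpa using hg
  have h2 : HasMFDerivAt 𝓘(ℝ, E) 𝓘(ℝ, E) (fun x : G ↦ chartAt E (1 : G) (g * x)) 1
      ((mfderiv 𝓘(ℝ, E) 𝓘(ℝ, E) (chartAt E (1 : G)) (g * 1)).comp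
        (mfderiv 𝓘(ℝ, E) 𝓘(ℝ, E) (fun x : G ↦ g * x) 1)) :=
    HasMFDerivAt.comp (1 : G) (hd.mdifferentiableAt hg1).hasMFDerivAt h1.hasMFDerivAt
  have h3 : HasFDerivAt (fun z ↦ chartAt E (1 : G) ((chartAt E (1 : G)).symm
      (chartAt E (1 : G) g) * (chartAt E (1 : G)).symm z))
      (leftFrame G (chartAt E (1 : G) g)) (chartAt E (1 : G) 1) := by
    have := (contDiffAt_chart_mul (G := G) ((chartAt E (1 : G)).map_source hg)).comp
      (chartAt E (1 : G) 1) (contDiffAt_const.prodMk contDiffAt_id)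
    exact (this.differentiableAt (by simp)).hasFDerivAt
  rw [(chartAt E (1 : G)).left_inv hg] at h3
  have h4 : HasMFDerivAt 𝓘(ℝ, E) 𝓘(ℝ, E) (fun x : G ↦ chartAt E (1 : G) (g * x)) 1
      ((leftFrame G (chartAt E (1 : G) g)).comp
        (mfderiv 𝓘(ℝ, E) 𝓘(ℝ, E) (chartAt E (1 : G)) 1)) := by
    refine (HasMFDerivAt.comp (1 : G) h3.hasMFDerivAt
      (hd.mdifferentiableAt (mem_chart_source E (1 : G))).hasMFDerivAt).congr_of_eventuallyEq ?_
    filter_upwards [(chartAt E (1 : G)).open_source.mem_nhds (mem_chart_source E (1 : G))] with x hx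
    simp [(chartAt E (1 : G)).left_inv hx]
  have h5 := DFunLike.congr_fun (hasMFDerivAt_unique h2 h4) v
  have h6 : mfderiv 𝓘(ℝ, E) 𝓘(ℝ, E) (chartAt E (1 : G)) (g * 1)
      (mfderiv 𝓘(ℝ, E) 𝓘(ℝ, E) (fun x : G ↦ g * x) 1 v) = leftFrame G (chartAt E (1 : G) g)
        (mfderiv 𝓘(ℝ, E) 𝓘(ℝ, E) (chartAt E (1 : G)) 1 v) := h5
  rw [mfderiv_chartAt_self] at h6
  rw [← h6, mul_one]
  rfl

theorem mfderiv_mul_left_mulInvariantVectorField (g k : G) (v : GroupLieAlgebra 𝓘(ℝ, E) G) :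
    mfderiv 𝓘(ℝ, E) 𝓘(ℝ, E) (fun x : G ↦ g * x) k (mulInvariantVectorField v k) =
      mulInvariantVectorField v (g * k) := by
  have h := mfderiv_comp (1 : G) (mdifferentiable_mul_left' (E := E) g (k * 1))
    (mdifferentiable_mul_left' (E := E) k 1)
  have h1 : (fun x : G ↦ g * x) ∘ (fun x : G ↦ k * x) = fun x : G ↦ g * k * x := by
    ext x; simp [mul_assoc]
  rw [h1] at h
  have h2 := DFunLike.congr_fun h v
  have h3 : mulInvariantVectorField v (g * k) =
    mfderiv 𝓘(ℝ, E) 𝓘(ℝ, E) (fun x : G ↦ g * x) (k * 1) (mulInvariantVectorField v k) := h2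
  rw [h3, mul_one]

/-- A curve with velocity `k_* v`, after a left translation, in the preferred chart at `1`. -/
theorem hasDerivAt_chartAt_mul {k : ℝ → G} {t : ℝ}
    (hk : MDifferentiableAt 𝓘(ℝ, ℝ) 𝓘(ℝ, E) k t) {v : GroupLieAlgebra 𝓘(ℝ, E) G}
    (hv : (velocity (F := E) k t).2 = mulInvariantVectorField v (k t)) {g : G}
    (hg : g * k t ∈ (chartAt E (1 : G)).source) :
    HasDerivAt (fun τ ↦ chartAt E (1 : G) (g * k τ))
      (leftFrame G (chartAt E (1 : G) (g * k t)) v) t := by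
  have hφ := chartAt_mem_maximalAtlas (F := E) (1 : G)
  have hd := mdifferentiable_of_mem_maximalAtlas hφ
  have h1 : HasMFDerivAt 𝓘(ℝ, ℝ) 𝓘(ℝ, E) (fun τ ↦ g * k τ) t
      ((mfderiv 𝓘(ℝ, E) 𝓘(ℝ, E) (fun x : G ↦ g * x) (k t)).comp
        (mfderiv 𝓘(ℝ, ℝ) 𝓘(ℝ, E) k t)) :=
    HasMFDerivAt.comp t (mdifferentiable_mul_left' g (k t)).hasMFDerivAt hk.hasMFDerivAt
  have h2 := HasMFDerivAt.comp t (hd.mdifferentiableAt hg).hasMFDerivAt h1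
  have h3 := hasDerivAt_of_hasMFDerivAt h2
  rw [← mfderiv_chartAt_mulInvariantVectorField hg, ← mfderiv_mul_left_mulInvariantVectorField,
    ← hv]
  exact h3

section Bracket

variable [CompleteSpace E]

/-- Pullback by the inverse chart respects Lie brackets, the bracket of left invariant fields is the
left invariant field of the Lie algebra bracket, and on a vector space the manifold bracket is the
usual one. -/
theorem leftFrame_lie {u : E} (hu : u ∈ (chartAt E (1 : G)).target)
    (v w : GroupLieAlgebra 𝓘(ℝ, E) G) :
    fderiv ℝ (leftFrame G) u (leftFrame G u v) w - fderiv ℝ (leftFrame G) u (leftFrame G u w) v =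
      leftFrame G u (⁅v, w⁆ : GroupLieAlgebra 𝓘(ℝ, E) G) := by
  have hφ := chartAt_mem_maximalAtlas (F := E) (1 : G)
  have hd := mdifferentiable_of_mem_maximalAtlas hφ
  have : LieGroup 𝓘(ℝ, E) (minSmoothness ℝ 3) G := by
    have h3 : (3 : WithTop ℕ∞) ≤ ∞ := WithTop.coe_le_coe.2 (le_top : (3 : ℕ∞) ≤ ⊤)
    exact LieGroup.of_le (n := ∞) (by simpa using h3)
  have hpull (v : GroupLieAlgebra 𝓘(ℝ, E) G) {z : E} (hz : z ∈ (chartAt E (1 : G)).target) :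
      VectorField.mpullback 𝓘(ℝ, E) 𝓘(ℝ, E) (chartAt E (1 : G)).symm
        (mulInvariantVectorField v) z = leftFrame G z v := by
    have h1 := mfderiv_chartAt_mulInvariantVectorField ((chartAt E (1 : G)).map_target hz) v
    rw [(chartAt E (1 : G)).right_inv hz] at h1
    rw [← h1, VectorField.mpullback_apply]
    have hz' := (chartAt E (1 : G)).map_target hz
    have e1 := hd.symm_comp_deriv hz'
    have e2 := hd.comp_symm_deriv hz
    rw [(chartAt E (1 : G)).right_inv hz] at e1
    rw [ContinuousLinearMap.inverse_eq e1 e2]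
  have key := VectorField.mpullback_mlieBracket (I := 𝓘(ℝ, E)) (I' := 𝓘(ℝ, E))
    (f := (chartAt E (1 : G)).symm) (x₀ := u) (n := ∞)
    (mdifferentiableAt_mulInvariantVectorField v (g := (chartAt E (1 : G)).symm u))
    (mdifferentiableAt_mulInvariantVectorField w)
    (contMDiffAt_symm_of_mem_maximalAtlas hφ hu) (by simpa using two_le_infty)
  rw [← mulInvariantVector_mlieBracket, ← GroupLieAlgebra.bracket_def, hpull _ hu] at key
  rw [key]
  have hev (v : GroupLieAlgebra 𝓘(ℝ, E) G) :
      VectorField.mpullback 𝓘(ℝ, E) 𝓘(ℝ, E) (chartAt E (1 : G)).symm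
        (mulInvariantVectorField v) =ᶠ[𝓝 u] fun z ↦ leftFrame G z v := by
    filter_upwards [(chartAt E (1 : G)).open_target.mem_nhds hu] with z hz
    exact hpull v hz
  have hb (V W : (x : E) → TangentSpace 𝓘(ℝ, E) x) : VectorField.mlieBracket 𝓘(ℝ, E) V W u =
      VectorField.lieBracket ℝ (fun x ↦ (V x : E)) (fun x ↦ (W x : E)) u := by
    rw [← VectorField.mlieBracketWithin_univ, VectorField.mlieBracketWithin_eq_lieBracketWithin]
    exact congrFun VectorField.lieBracketWithin_univ u
  rw [Filter.EventuallyEq.mlieBracket_vectorField_eq (hev v) (hev w)]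
  refine Eq.trans ?_ (hb _ _).symm
  have hA (x : E) : HasFDerivAt (fun z ↦ leftFrame G z x)
      ((fderiv ℝ (leftFrame G) u).flip x) u := by
    have h1 : HasFDerivAt (leftFrame G) (fderiv ℝ (leftFrame G) u) u :=
      ((contDiffAt_leftFrame hu).differentiableAt (by simp)).hasFDerivAt
    have h2 := h1.clm_apply (hasFDerivAt_const x u)
    refine h2.congr_fderiv ?_
    ext; simp
  have h1 := (hA v).fderiv
  have h2 := (hA w).fderiv
  change _ = fderiv ℝ (fun z ↦ leftFrame (E := E) G z w) u (leftFrame G u v) -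
    fderiv ℝ (fun z ↦ leftFrame (E := E) G z v) u (leftFrame G u w)
  rw [h1, h2]
  rfl

end Bracket

end LeftFrame


/-! ### Submersions: local sections and curves in fibres. -/

section Submersion

variable {E F M N : Type*} [NormedAddCommGroup E] [NormedSpace ℝ E]
  [NormedAddCommGroup F] [NormedSpace ℝ F]
  [TopologicalSpace M] [ChartedSpace E M]
  [TopologicalSpace N] [ChartedSpace F N]
  {f : M → N} {x : M}

/-- The normal form of a submersion, from which both sections and fibre curves are read off. -/
theorem codChart_apply_of_isSubmersionAt
    (h : Manifold.IsSubmersionAt 𝓘(ℝ, E) 𝓘(ℝ, F) ∞ f x) {u : E} (hu : u ∈ h.domChart.target) :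
    h.codChart (f (h.domChart.symm u)) = (h.equiv u).1 := by
  have := h.writtenInCharts
    (show u ∈ (h.domChart.extend 𝓘(ℝ, E)).target by simpa using hu)
  simpa using this

/-- A submersion has smooth local sections. -/
theorem exists_section_of_isSubmersionAt
    (h : Manifold.IsSubmersionAt 𝓘(ℝ, E) 𝓘(ℝ, F) ∞ f x) :
    ∃ σ : N → M, ContMDiffAt 𝓘(ℝ, F) 𝓘(ℝ, E) ∞ σ (f x) ∧ σ (f x) = x ∧
      ∀ᶠ z in 𝓝 (f x), f (σ z) = z := by
  have hx := h.mem_domChart_source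
  have hfx := h.mem_codChart_source
  have h0 : h.equiv.symm (h.codChart (f x), (h.equiv (h.domChart x)).2) = h.domChart x := by
    have := codChart_apply_of_isSubmersionAt h (h.domChart.map_source hx)
    rw [h.domChart.left_inv hx] at this
    rw [this]
    simp
  have hψ : ContMDiffAt 𝓘(ℝ, F) 𝓘(ℝ, F) ∞ h.codChart (f x) :=
    contMDiffAt_of_mem_maximalAtlas h.codChart_mem_maximalAtlas hfx
  have hl : ContMDiffAt 𝓘(ℝ, F) 𝓘(ℝ, E) ∞
      (fun z ↦ h.equiv.symm (h.codChart z, (h.equiv (h.domChart x)).2)) (f x) := by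
    have : ContDiff ℝ ∞ (fun y : F ↦ h.equiv.symm (y, (h.equiv (h.domChart x)).2)) := by fun_prop
    exact this.contMDiff.contMDiffAt.comp (f x) hψ
  -- In normal form the section moves the base coordinate and freezes the complementary coordinate
  -- at its value for `x`.
  refine ⟨fun z ↦ h.domChart.symm (h.equiv.symm (h.codChart z, (h.equiv (h.domChart x)).2)),
    ?_, ?_, ?_⟩
  · refine ContMDiffAt.comp (g := h.domChart.symm) (f x) ?_ hl
    rw [h0]
    exact contMDiffAt_symm_of_mem_maximalAtlas h.domChart_mem_maximalAtlas
      (h.domChart.map_source hx)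
  · simp only [h0, h.domChart.left_inv hx]
  · have h1 := hl.continuousAt.preimage_mem_nhds (t := h.domChart.target) (by
      rw [h0]; exact h.domChart.open_target.mem_nhds (h.domChart.map_source hx))
    filter_upwards [h1, h.codChart.open_source.mem_nhds hfx] with z hz1 hz2
    refine h.codChart.injOn (h.source_subset_preimage_source (h.domChart.map_target hz1)) hz2 ?_
    rw [codChart_apply_of_isSubmersionAt h hz1]
    simp

/-- The kernel of the derivative of a submersion consists of velocities of curves in the fibre. -/
theorem exists_curve_of_mfderiv_eq_zero
    (h : Manifold.IsSubmersionAt 𝓘(ℝ, E) 𝓘(ℝ, F) ∞ f x) {v : TangentSpace 𝓘(ℝ, E) x}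
    (hv : mfderiv 𝓘(ℝ, E) 𝓘(ℝ, F) f x v = 0) :
    ∃ γ : ℝ → M, ContMDiffAt 𝓘(ℝ, ℝ) 𝓘(ℝ, E) ∞ γ 0 ∧ (∀ᶠ t in 𝓝 (0 : ℝ), f (γ t) = f x) ∧
      velocity γ 0 = ⟨x, v⟩ := by
  have hx := h.mem_domChart_source
  have hfx := h.mem_codChart_source
  have hd := mdifferentiable_of_mem_maximalAtlas h.domChart_mem_maximalAtlas
  have hd' := mdifferentiable_of_mem_maximalAtlas h.codChart_mem_maximalAtlas
  obtain ⟨w, hw⟩ : ∃ w : E, w = mfderiv 𝓘(ℝ, E) 𝓘(ℝ, E) h.domChart x v := ⟨_, rfl⟩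
  have hLw : (h.equiv w).1 = 0 := by
    have hf := (h.contMDiffAt.mdifferentiableAt (by simp)).hasMFDerivAt
    have h1 := (hd'.mdifferentiableAt hfx).hasMFDerivAt.comp x hf
    have h2 : HasFDerivAt (fun u ↦ (h.equiv u).1) ((ContinuousLinearMap.fst ℝ F h.complement).comp
        (h.equiv : E →L[ℝ] F × h.complement)) (h.domChart x) :=
      ((ContinuousLinearMap.fst ℝ F h.complement).comp
        (h.equiv : E →L[ℝ] F × h.complement)).hasFDerivAt
    have h3 := HasMFDerivAt.comp x h2.hasMFDerivAt (hd.mdifferentiableAt hx).hasMFDerivAt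
    have h4 : (h.codChart ∘ f) =ᶠ[𝓝 x] ((fun u ↦ (h.equiv u).1) ∘ h.domChart) := by
      filter_upwards [h.domChart.open_source.mem_nhds hx] with z hz
      have := codChart_apply_of_isSubmersionAt h (h.domChart.map_source hz)
      rw [h.domChart.left_inv hz] at this
      exact this
    have h5 := DFunLike.congr_fun (hasMFDerivAt_unique h1 (h3.congr_of_eventuallyEq h4)) v
    have h6 : mfderiv 𝓘(ℝ, F) 𝓘(ℝ, F) h.codChart (f x) (mfderiv 𝓘(ℝ, E) 𝓘(ℝ, F) f x v) =
      (h.equiv (mfderiv 𝓘(ℝ, E) 𝓘(ℝ, E) h.domChart x v)).1 := h5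
    rw [hw, ← h6, hv]
    exact map_zero _
  have h0 : h.domChart x + (0 : ℝ) • w = h.domChart x := by simp
  have hl : ContDiff ℝ ∞ (fun t : ℝ ↦ h.domChart x + t • w) := by fun_prop
  have hmem : h.domChart x + (0 : ℝ) • w ∈ h.domChart.target := by
    rw [h0]; exact h.domChart.map_source hx
  -- A straight line in the normal form chart; its direction has base component zero by `hLw`, so it
  -- stays in the fibre.
  refine ⟨fun t ↦ h.domChart.symm (h.domChart x + t • w), ?_, ?_, ?_⟩
  · exact ContMDiffAt.comp (g := h.domChart.symm) (0 : ℝ) (contMDiffAt_symm_of_mem_maximalAtlas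
      h.domChart_mem_maximalAtlas hmem) hl.contMDiff.contMDiffAt
  · have h1 := hl.continuous.continuousAt.preimage_mem_nhds
      (h.domChart.open_target.mem_nhds hmem)
    filter_upwards [h1] with t ht
    refine h.codChart.injOn (h.source_subset_preimage_source (h.domChart.map_target ht)) hfx ?_
    have h2 := codChart_apply_of_isSubmersionAt h (h.domChart.map_source hx)
    rw [h.domChart.left_inv hx] at h2
    rw [codChart_apply_of_isSubmersionAt h ht, h2]
    simp [hLw]
  · have h1 : HasDerivAt (fun t : ℝ ↦ h.domChart x + t • w) w 0 := by
      simpa using ((hasDerivAt_id (0 : ℝ)).smul_const w).const_add (h.domChart x)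
    have h2 := HasMFDerivAt.comp (0 : ℝ) (hd.mdifferentiableAt_symm hmem).hasMFDerivAt
      h1.hasFDerivAt.hasMFDerivAt
    have h3 := DFunLike.congr_fun h2.mfderiv (1 : ℝ)
    have h4 : velocity (F := E) (fun t ↦ h.domChart.symm (h.domChart x + t • w)) 0 =
        tangentPoint h.domChart (h.domChart x + (0 : ℝ) • w) w := by
      refine congrArg (TotalSpace.mk (F := E) (E := (TangentSpace 𝓘(ℝ, E) : M → Type _))
        (h.domChart.symm (h.domChart x + (0 : ℝ) • w))) (h3.trans ?_)
      refine congrArg (mfderiv 𝓘(ℝ, E) 𝓘(ℝ, E) h.domChart.symm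
        (h.domChart x + (0 : ℝ) • w)) ?_
      exact one_smul ℝ w
    rw [h4, h0, hw]
    exact tangentPoint_tangentCoord h.domChart_mem_maximalAtlas (p := ⟨x, v⟩) hx

end Submersion


/-! ### The coset projection and the left translations in charts. -/

section Congr

variable {E F M N : Type*} [NormedAddCommGroup E] [NormedSpace ℝ E]
  [NormedAddCommGroup F] [NormedSpace ℝ F] [TopologicalSpace M] [ChartedSpace E M]
  [TopologicalSpace N] [ChartedSpace F N]

/-- Values are compared in the model space `F`, so that base points such as `g * 1` and `g` can be
exchanged although the tangent spaces are formally different types. -/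
theorem mfderiv_congr_apply {f g : M → N} {x y : M} (h : f = g) (hxy : x = y) (v : E) :
    (mfderiv 𝓘(ℝ, E) 𝓘(ℝ, F) f x v : F) = mfderiv 𝓘(ℝ, E) 𝓘(ℝ, F) g y v := by
  subst h hxy
  rfl

end Congr

section Coset

variable {E : Type*} [NormedAddCommGroup E] [NormedSpace ℝ E]
  {F : Type*} [NormedAddCommGroup F] [NormedSpace ℝ F]
  {G : Type*} [Group G] [TopologicalSpace G] [ChartedSpace E G]
  {H : Subgroup G} [ChartedSpace F (G ⧸ H)]

theorem mfderiv_mk_one_mul (v : GroupLieAlgebra 𝓘(ℝ, E) G) :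
    (mfderiv 𝓘(ℝ, E) 𝓘(ℝ, F) (fun g : G ↦ ((1 * g : G) : G ⧸ H)) 1 v : F) =
      projTangent E F H v := by
  have h : (fun g : G ↦ ((1 * g : G) : G ⧸ H)) = fun g : G ↦ (g : G ⧸ H) := by
    ext g
    rw [one_mul]
  exact mfderiv_congr_apply (E := E) h rfl v

/-- A local section through `1` gives a right inverse of the derivative. -/
theorem projTangent_surjective
    (hsub : Manifold.IsSubmersion 𝓘(ℝ, E) 𝓘(ℝ, F) ∞ (fun g : G ↦ (g : G ⧸ H))) :
    Function.Surjective (projTangent E F H) := by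
  intro w
  obtain ⟨σ, h1, h2, h3⟩ := exists_section_of_isSubmersionAt (hsub.isSubmersionAt 1)
  have e1 := HasMFDerivAt.comp ((1 : G) : G ⧸ H)
    (hsub.contMDiff.mdifferentiable (by simp) (σ ((1 : G) : G ⧸ H))).hasMFDerivAt
    (h1.mdifferentiableAt (by simp)).hasMFDerivAt
  have e2 := (hasMFDerivAt_id (I := 𝓘(ℝ, F)) ((1 : G) : G ⧸ H)).congr_of_eventuallyEq h3
  have e3 := DFunLike.congr_fun (hasMFDerivAt_unique e1 e2) w
  have e4 : mfderiv 𝓘(ℝ, E) 𝓘(ℝ, F) (fun g : G ↦ (g : G ⧸ H)) (σ ((1 : G) : G ⧸ H))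
    (mfderiv 𝓘(ℝ, F) 𝓘(ℝ, E) σ ((1 : G) : G ⧸ H) w) = w := e3
  rw [h2] at e4
  exact ⟨_, e4⟩

variable (E F H) in
/-- The projection `G → G ⧸ H` in the preferred charts at `1` and at the origin. -/
noncomputable def cosetChart (u : E) : F :=
  chartAt F (origin H) (((chartAt E (1 : G)).symm u : G) : G ⧸ H)

theorem mem_cosetChart_nhds
    (hsub : Manifold.IsSubmersion 𝓘(ℝ, E) 𝓘(ℝ, F) ∞ (fun g : G ↦ (g : G ⧸ H))) :
    ∀ᶠ u in 𝓝 (chartAt E (1 : G) 1), u ∈ (chartAt E (1 : G)).target ∧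
      (((chartAt E (1 : G)).symm u : G) : G ⧸ H) ∈ (chartAt F (origin H)).source := by
  have h1 := (chartAt E (1 : G)).open_target.mem_nhds (mem_chart_target E (1 : G))
  have h2 : ContinuousAt (fun u ↦ (((chartAt E (1 : G)).symm u : G) : G ⧸ H))
      (chartAt E (1 : G) 1) :=
    hsub.contMDiff.continuous.continuousAt.comp
      ((chartAt E (1 : G)).continuousAt_symm (mem_chart_target E (1 : G)))
  filter_upwards [h1, h2.preimage_mem_nhds ((chartAt F (origin H)).open_source.mem_nhds
    (by rw [(chartAt E (1 : G)).left_inv (mem_chart_source E (1 : G))]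
        exact mem_chart_source F (origin H)))] with u hu1 hu2 using ⟨hu1, hu2⟩

variable [LieGroup 𝓘(ℝ, E) ∞ G]

/-- With a local section `σ` of the projection, the translation is `z ↦ g * σ z` followed by the
projection. -/
theorem contMDiff_smul_left
    (hsub : Manifold.IsSubmersion 𝓘(ℝ, E) 𝓘(ℝ, F) ∞ (fun g : G ↦ (g : G ⧸ H))) (g : G) :
    ContMDiff 𝓘(ℝ, F) 𝓘(ℝ, F) ∞ (fun x : G ⧸ H ↦ g • x) := by
  intro x
  obtain ⟨k, rfl⟩ := QuotientGroup.mk_surjective x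
  obtain ⟨σ, h1, h2, h3⟩ := exists_section_of_isSubmersionAt (hsub.isSubmersionAt k)
  have h4 : ContMDiffAt 𝓘(ℝ, F) 𝓘(ℝ, F) ∞ (fun z : G ⧸ H ↦ ((g * σ z : G) : G ⧸ H))
      (k : G ⧸ H) :=
    (hsub.contMDiff.comp (contMDiff_mul_left (a := g))).contMDiffAt.comp _ h1
  refine h4.congr_of_eventuallyEq ?_
  filter_upwards [h3] with z hz
  conv_lhs => rw [← hz]
  rfl

/-- The left translation by `g` on `G ⧸ H`. -/
def smulDiffeomorph
    (hsub : Manifold.IsSubmersion 𝓘(ℝ, E) 𝓘(ℝ, F) ∞ (fun g : G ↦ (g : G ⧸ H))) (g : G) :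
    Diffeomorph 𝓘(ℝ, F) 𝓘(ℝ, F) (G ⧸ H) (G ⧸ H) ∞ where
  toEquiv := MulAction.toPerm g
  contMDiff_toFun := contMDiff_smul_left hsub g
  contMDiff_invFun := contMDiff_smul_left hsub g⁻¹

/-- Along a curve in `H` the map is constantly the coset of `k`; linearity extends the vanishing
from such velocities to their span. -/
theorem mfderiv_mk_comp_mul_eq_zero
    (hsub : Manifold.IsSubmersion 𝓘(ℝ, E) 𝓘(ℝ, F) ∞ (fun g : G ↦ (g : G ⧸ H))) (k : G)
    {v : GroupLieAlgebra 𝓘(ℝ, E) G} (hv : v ∈ isotropyAlgebra E H) :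
    mfderiv 𝓘(ℝ, E) 𝓘(ℝ, F) (fun g : G ↦ ((k * g : G) : G ⧸ H)) 1 v = 0 := by
  have hd : MDifferentiable 𝓘(ℝ, E) 𝓘(ℝ, F) (fun g : G ↦ ((k * g : G) : G ⧸ H)) :=
    (hsub.contMDiff.comp (contMDiff_mul_left (a := k))).mdifferentiable (by simp)
  refine Submodule.span_induction (p := fun v _ ↦
    mfderiv 𝓘(ℝ, E) 𝓘(ℝ, F) (fun g : G ↦ ((k * g : G) : G ⧸ H)) 1 v = 0) ?_ ?_ ?_ ?_ hv
  · rintro x ⟨γ, h1, h2, h3⟩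
    have h4 : γ 0 = 1 := congrArg (fun p : TangentBundle 𝓘(ℝ, E) G ↦ p.1) h3
    have h5 : mfderiv 𝓘(ℝ, E) 𝓘(ℝ, F) (fun g : G ↦ ((k * g : G) : G ⧸ H))
        (velocity (F := E) γ 0).1 (velocity (F := E) γ 0).2 = 0 := by
      have e1 := HasMFDerivAt.comp (0 : ℝ) (hd (γ 0)).hasMFDerivAt
        (h1.mdifferentiableAt (by simp)).hasMFDerivAt
      have e2 : HasMFDerivAt 𝓘(ℝ, ℝ) 𝓘(ℝ, F) ((fun g : G ↦ ((k * g : G) : G ⧸ H)) ∘ γ) 0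
          (0 : TangentSpace 𝓘(ℝ, ℝ) (0 : ℝ) →L[ℝ] TangentSpace 𝓘(ℝ, F) (k : G ⧸ H)) := by
        refine (hasMFDerivAt_const (k : G ⧸ H) (0 : ℝ)).congr_of_eventuallyEq ?_
        filter_upwards [h2] with t ht
        exact QuotientGroup.eq.2 (by simpa using ht)
      exact DFunLike.congr_fun (hasMFDerivAt_unique e1 e2) (1 : ℝ)
    rw [h3] at h5
    exact h5
  · exact map_zero _
  · intro x y _ _ hx hy
    exact (map_add _ x y).trans (by rw [hx, hy, add_zero])
  · intro r x _ hx
    exact (ContinuousLinearMap.map_smul _ r x).trans (by rw [hx, smul_zero])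

/-- A vector in the kernel is the velocity of a curve in the fibre over `o`, which is `H`, and so
belongs to the isotropy algebra by definition. -/
theorem projTangent_eq_zero_iff
    (hsub : Manifold.IsSubmersion 𝓘(ℝ, E) 𝓘(ℝ, F) ∞ (fun g : G ↦ (g : G ⧸ H)))
    {v : GroupLieAlgebra 𝓘(ℝ, E) G} :
    projTangent E F H v = 0 ↔ v ∈ isotropyAlgebra E H := by
  constructor
  · intro h
    obtain ⟨γ, h1, h2, h3⟩ := exists_curve_of_mfderiv_eq_zero (hsub.isSubmersionAt 1) h
    refine Submodule.subset_span ⟨γ, h1, h2.mono fun t ht ↦ ?_, h3⟩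
    simpa using QuotientGroup.eq.1 ht
  · intro h
    exact (mfderiv_mk_one_mul v).symm.trans (mfderiv_mk_comp_mul_eq_zero hsub 1 h)

section Chart

variable [IsManifold 𝓘(ℝ, F) ∞ (G ⧸ H)]

theorem contDiffAt_cosetChart
    (hsub : Manifold.IsSubmersion 𝓘(ℝ, E) 𝓘(ℝ, F) ∞ (fun g : G ↦ (g : G ⧸ H))) {u : E}
    (hu : u ∈ (chartAt E (1 : G)).target)
    (hu' : (((chartAt E (1 : G)).symm u : G) : G ⧸ H) ∈ (chartAt F (origin H)).source) :
    ContDiffAt ℝ ∞ (cosetChart E F H) u := by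
  refine ContMDiffAt.contDiffAt ?_
  exact ContMDiffAt.comp (g := chartAt F (origin H)) u
    (contMDiffAt_of_mem_maximalAtlas (chartAt_mem_maximalAtlas _) hu')
    (hsub.contMDiff.contMDiffAt.comp u
      (contMDiffAt_symm_of_mem_maximalAtlas (chartAt_mem_maximalAtlas _) hu))

theorem mfderiv_chartAt_mk_mul
    (hsub : Manifold.IsSubmersion 𝓘(ℝ, E) 𝓘(ℝ, F) ∞ (fun g : G ↦ (g : G ⧸ H))) {g : G}
    (hg : g ∈ (chartAt E (1 : G)).source) (hg' : (g : G ⧸ H) ∈ (chartAt F (origin H)).source)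
    (v : GroupLieAlgebra 𝓘(ℝ, E) G) :
    mfderiv 𝓘(ℝ, E) 𝓘(ℝ, F) (fun z : G ↦ chartAt F (origin H) ((g * z : G) : G ⧸ H)) 1 v =
      frameDeriv (cosetChart E F H) (leftFrame G) (chartAt E (1 : G) g) v := by
  have hd := mdifferentiable_of_mem_maximalAtlas (chartAt_mem_maximalAtlas (F := E) (1 : G))
  have hg1 : g * 1 ∈ (chartAt E (1 : G)).source := by simpa using hg
  have hP : HasMFDerivAt 𝓘(ℝ, E) 𝓘(ℝ, F) (cosetChart E F H) (chartAt E (1 : G) (g * 1))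
      (fderiv ℝ (cosetChart E F H) (chartAt E (1 : G) g)) := by
    rw [mul_one]
    refine (((contDiffAt_cosetChart hsub ((chartAt E (1 : G)).map_source hg) ?_).differentiableAt
      (by simp)).hasFDerivAt).hasMFDerivAt
    rwa [(chartAt E (1 : G)).left_inv hg]
  have h1 := HasMFDerivAt.comp (1 : G) (hd.mdifferentiableAt hg1).hasMFDerivAt
    (mdifferentiable_mul_left' (E := E) g 1).hasMFDerivAt
  have h2 := HasMFDerivAt.comp (1 : G) hP h1
  have h3 : (fun z : G ↦ chartAt F (origin H) ((g * z : G) : G ⧸ H)) =ᶠ[𝓝 1]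
      (cosetChart E F H) ∘ (chartAt E (1 : G) ∘ fun z ↦ g * z) := by
    have hc : Continuous fun z : G ↦ g * z :=
      (contMDiff_mul_left (I := 𝓘(ℝ, E)) (n := ∞) (a := g)).continuous
    filter_upwards [hc.continuousAt.preimage_mem_nhds
      ((chartAt E (1 : G)).open_source.mem_nhds hg1)] with z hz
    simp only [cosetChart, Function.comp_apply]
    rw [(chartAt E (1 : G)).left_inv hz]
  have h4 := DFunLike.congr_fun (h2.congr_of_eventuallyEq h3).mfderiv v
  have h5 : mfderiv 𝓘(ℝ, E) 𝓘(ℝ, F) (fun z : G ↦ chartAt F (origin H) ((g * z : G) : G ⧸ H)) 1 v =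
      fderiv ℝ (cosetChart E F H) (chartAt E (1 : G) g)
        (mfderiv 𝓘(ℝ, E) 𝓘(ℝ, E) (chartAt E (1 : G)) (g * 1) (mulInvariantVectorField v g)) := h4
  refine h5.trans (congrArg (fderiv ℝ (cosetChart E F H) (chartAt E (1 : G) g)) ?_)
  exact (mfderiv_congr_apply rfl (mul_one g) _).trans (mfderiv_chartAt_mulInvariantVectorField hg v)

theorem mfderiv_chartAt_mk_mul_eq_comp
    (hsub : Manifold.IsSubmersion 𝓘(ℝ, E) 𝓘(ℝ, F) ∞ (fun g : G ↦ (g : G ⧸ H))) {g : G}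
    (hg' : (g : G ⧸ H) ∈ (chartAt F (origin H)).source)
    (v : GroupLieAlgebra 𝓘(ℝ, E) G) :
    mfderiv 𝓘(ℝ, E) 𝓘(ℝ, F) (fun z : G ↦ chartAt F (origin H) ((g * z : G) : G ⧸ H)) 1 v =
      mfderiv 𝓘(ℝ, F) 𝓘(ℝ, F) (chartAt F (origin H)) (g : G ⧸ H)
        (mfderiv 𝓘(ℝ, E) 𝓘(ℝ, F) (fun z : G ↦ ((g * z : G) : G ⧸ H)) 1 v) := by
  have hd := mdifferentiable_of_mem_maximalAtlas (chartAt_mem_maximalAtlas (F := F) (origin H))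
  have hg1 : ((g * 1 : G) : G ⧸ H) ∈ (chartAt F (origin H)).source := by simpa using hg'
  have hk : MDifferentiable 𝓘(ℝ, E) 𝓘(ℝ, F) (fun z : G ↦ ((g * z : G) : G ⧸ H)) :=
    (hsub.contMDiff.comp (contMDiff_mul_left (a := g))).mdifferentiable (by simp)
  have h1 := HasMFDerivAt.comp (1 : G) (hd.mdifferentiableAt hg1).hasMFDerivAt
    (hk 1).hasMFDerivAt
  have h2 := DFunLike.congr_fun h1.mfderiv v
  have h3 : mfderiv 𝓘(ℝ, E) 𝓘(ℝ, F)
      (fun z : G ↦ chartAt F (origin H) ((g * z : G) : G ⧸ H)) 1 v =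
      mfderiv 𝓘(ℝ, F) 𝓘(ℝ, F) (chartAt F (origin H)) ((g * 1 : G) : G ⧸ H)
        (mfderiv 𝓘(ℝ, E) 𝓘(ℝ, F) (fun z : G ↦ ((g * z : G) : G ⧸ H)) 1 v) := h2
  exact h3.trans (mfderiv_congr_apply rfl (by rw [mul_one]) _)

/-- This holds at every `u` where the charts apply, not only at the origin, since `g * h` and `g`
define the same coset. That allows the relation to be differentiated in `u`. -/
theorem frameDeriv_cosetChart_isotropy
    (hsub : Manifold.IsSubmersion 𝓘(ℝ, E) 𝓘(ℝ, F) ∞ (fun g : G ↦ (g : G ⧸ H))) {u : E}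
    (hu : u ∈ (chartAt E (1 : G)).target)
    (hu' : (((chartAt E (1 : G)).symm u : G) : G ⧸ H) ∈ (chartAt F (origin H)).source)
    {v : GroupLieAlgebra 𝓘(ℝ, E) G} (hv : v ∈ isotropyAlgebra E H) :
    frameDeriv (cosetChart E F H) (leftFrame G) u v = 0 := by
  have h1 := mfderiv_chartAt_mk_mul hsub ((chartAt E (1 : G)).map_target hu) hu' v
  rw [(chartAt E (1 : G)).right_inv hu] at h1
  rw [← h1, mfderiv_chartAt_mk_mul_eq_comp hsub hu', mfderiv_mk_comp_mul_eq_zero hsub _ hv]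
  exact map_zero _

theorem frameDeriv_cosetChart_one
    (hsub : Manifold.IsSubmersion 𝓘(ℝ, E) 𝓘(ℝ, F) ∞ (fun g : G ↦ (g : G ⧸ H)))
    (v : GroupLieAlgebra 𝓘(ℝ, E) G) :
    frameDeriv (cosetChart E F H) (leftFrame G) (chartAt E (1 : G) 1) v = projTangent E F H v := by
  have ho : ((1 : G) : G ⧸ H) ∈ (chartAt F (origin H)).source := mem_chart_source F (origin H)
  rw [← mfderiv_chartAt_mk_mul hsub (mem_chart_source E (1 : G)) ho,
    mfderiv_chartAt_mk_mul_eq_comp hsub ho]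
  refine (mfderiv_chartAt_self (origin H) _).trans ?_
  exact mfderiv_mk_one_mul v

end Chart

end Coset


/-! ### Smooth solutions of autonomous differential equations. -/

section ODE

variable {V : Type*} [NormedAddCommGroup V] [NormedSpace ℝ V]

/-- Bootstrapping: if `z` is `n` times differentiable, so is `z' = f(z)`. -/
theorem contDiffOn_of_hasDerivAt {f : V → V} {z : ℝ → V} {s : Set ℝ} (hs : IsOpen s)
    (hz : ∀ t ∈ s, HasDerivAt z (f (z t)) t) (hf : ∀ t ∈ s, ContDiffAt ℝ ∞ f (z t)) :
    ContDiffOn ℝ ∞ z s := by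
  refine contDiffOn_infty.2 fun n ↦ ?_
  induction n with
  | zero =>
    exact contDiffOn_zero.2 fun t ht ↦ (hz t ht).continuousAt.continuousWithinAt
  | succ n ih =>
    refine (contDiffOn_succ_iff_deriv_of_isOpen (n := (n : WithTop ℕ∞)) hs).2
      ⟨fun t ht ↦ (hz t ht).differentiableAt.differentiableWithinAt, by simp, ?_⟩
    refine ContDiffOn.congr (f := fun t ↦ f (z t)) ?_ fun t ht ↦ (hz t ht).deriv
    intro t ht
    exact (((hf t ht).of_le (by exact_mod_cast le_top)).comp t
      (ih.contDiffAt (hs.mem_nhds ht))).contDiffWithinAt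

theorem exists_contDiffOn_hasDerivAt [CompleteSpace V] {f : V → V} {U : Set V} (hU : IsOpen U)
    (hf : ∀ z ∈ U, ContDiffAt ℝ ∞ f z) {z₀ : V} (hz₀ : z₀ ∈ U) :
    ∃ ε > (0 : ℝ), ∃ z : ℝ → V, z 0 = z₀ ∧ ContDiffOn ℝ ∞ z (Ioo (-ε) ε) ∧
      ∀ t ∈ Ioo (-ε) ε, z t ∈ U ∧ HasDerivAt z (f (z t)) t := by
  obtain ⟨z, h0, ε, hε, hz⟩ := ((hf z₀ hz₀).of_le
    (by simp)).exists_forall_mem_closedBall_exists_eq_forall_mem_Ioo_hasDerivAt₀ 0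
  have h1 : ContinuousAt z 0 := (hz 0 (by simpa using hε)).continuousAt
  -- The Picard–Lindelöf interval is shrunk until the solution stays in `U`, where `f` is smooth.
  obtain ⟨δ, hδ, h2⟩ := Metric.mem_nhds_iff.1
    (h1.preimage_mem_nhds (hU.mem_nhds (by rwa [h0])))
  have h3 : ∀ t ∈ Ioo (-min ε δ) (min ε δ), z t ∈ U ∧ HasDerivAt z (f (z t)) t := by
    intro t ht
    have h4 : |t| < min ε δ := abs_lt.2 ht
    refine ⟨h2 (by simpa using h4.trans_le (min_le_right _ _)), hz t ?_⟩
    have := abs_lt.1 (h4.trans_le (min_le_left _ _))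
    simpa using this
  exact ⟨min ε δ, lt_min hε hδ, z, h0, contDiffOn_of_hasDerivAt isOpen_Ioo
    (fun t ht ↦ (h3 t ht).2) (fun t ht ↦ hf _ (h3 t ht).1), h3⟩

end ODE

/-! ### Curves in `G` with `k' = k_* y`. -/

section Group

variable {E : Type*} [NormedAddCommGroup E] [NormedSpace ℝ E]
  {V : Type*} [NormedAddCommGroup V] [NormedSpace ℝ V]
  {G : Type*} [Group G] [TopologicalSpace G] [ChartedSpace E G]

theorem mulInvariantVectorField_one (v : GroupLieAlgebra 𝓘(ℝ, E) G) :
    mulInvariantVectorField v (1 : G) = v := by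
  have h2 : (fun x : G ↦ 1 * x) = id := by ext; simp
  refine (mfderiv_congr_apply (E := E) (x := (1 : G)) h2 rfl v).trans ?_
  exact DFunLike.congr_fun (mfderiv_id (I := 𝓘(ℝ, E)) (x := (1 : G))) v

variable [LieGroup 𝓘(ℝ, E) ∞ G]

theorem leftFrame_chartAt_one :
    leftFrame G (chartAt E (1 : G) 1) = ContinuousLinearMap.id ℝ E := by
  ext v
  have h1 := mfderiv_chartAt_mulInvariantVectorField (mem_chart_source E (1 : G)) v
  rw [← h1]
  exact (mfderiv_chartAt_self (1 : G) _).trans (mulInvariantVectorField_one v)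

theorem velocity_chartAt_symm {u : ℝ → E} {t : ℝ} (hu : u t ∈ (chartAt E (1 : G)).target)
    {v : GroupLieAlgebra 𝓘(ℝ, E) G} (h : HasDerivAt u (leftFrame G (u t) v) t) :
    (velocity (F := E) (fun τ ↦ (chartAt E (1 : G)).symm (u τ)) t).2 =
      mulInvariantVectorField v ((chartAt E (1 : G)).symm (u t)) := by
  have hd := mdifferentiable_of_mem_maximalAtlas (chartAt_mem_maximalAtlas (F := E) (1 : G))
  have h1 := HasMFDerivAt.comp t (hd.mdifferentiableAt_symm hu).hasMFDerivAt
    h.hasFDerivAt.hasMFDerivAt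
  have h2 := DFunLike.congr_fun h1.mfderiv (1 : ℝ)
  have h3 := mfderiv_chartAt_mulInvariantVectorField ((chartAt E (1 : G)).map_target hu) v
  rw [(chartAt E (1 : G)).right_inv hu] at h3
  have h4 : (velocity (F := E) (fun τ ↦ (chartAt E (1 : G)).symm (u τ)) t).2 =
      mfderiv 𝓘(ℝ, E) 𝓘(ℝ, E) (chartAt E (1 : G)).symm (u t)
        ((1 : ℝ) • leftFrame G (u t) v) := h2
  have h5 : (1 : ℝ) • leftFrame G (u t) v = leftFrame G (u t) v := one_smul _ _
  refine h4.trans ((congrArg _ h5).trans ?_)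
  have h6 := DFunLike.congr_fun (hd.symm_comp_deriv ((chartAt E (1 : G)).map_target hu))
    (mulInvariantVectorField v ((chartAt E (1 : G)).symm (u t)))
  refine Eq.trans ?_ h6
  refine (congrArg _ h3.symm).trans ?_
  exact mfderiv_congr_apply rfl ((chartAt E (1 : G)).right_inv hu).symm _

/-- Curves `k` in `G` with `k' = k_* y`, for an integral curve `y` of a vector field. -/
theorem exists_curve_velocity_eq [CompleteSpace E] [CompleteSpace V] (ι : V →L[ℝ] E) {η : V → V}
    {U : Set V} (hU : IsOpen U) (hη : ∀ y ∈ U, ContDiffAt ℝ ∞ η y) {y₀ : V} (hy₀ : y₀ ∈ U) {u₀ : E}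
    (hu₀ : u₀ ∈ (chartAt E (1 : G)).target) :
    ∃ ε > (0 : ℝ), ∃ (k : ℝ → G) (y : ℝ → V), k 0 = (chartAt E (1 : G)).symm u₀ ∧ y 0 = y₀ ∧
      ContMDiffOn 𝓘(ℝ, ℝ) 𝓘(ℝ, E) ∞ k (Ioo (-ε) ε) ∧
      ∀ t ∈ Ioo (-ε) ε, (velocity (F := E) k t).2 =
          mulInvariantVectorField (ι (y t) : GroupLieAlgebra 𝓘(ℝ, E) G) (k t) ∧
        y t ∈ U ∧ HasDerivAt y (η (y t)) t := by
  -- The curve in `G` and the curve in `V` are solved for together, as one autonomous system in the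
  -- chart.
  obtain ⟨ε, hε, z, h0, hz, h⟩ := exists_contDiffOn_hasDerivAt
    (f := fun z : E × V ↦ (leftFrame G z.1 (ι z.2), η z.2))
    ((chartAt E (1 : G)).open_target.prod hU) (z₀ := (u₀, y₀)) (by
      rintro ⟨u, y⟩ ⟨hu, hy⟩
      have h1 : ContDiffAt ℝ ∞ (fun z : E × V ↦ leftFrame G z.1) (u, y) :=
        ContDiffAt.comp (g := leftFrame G) _ (contDiffAt_leftFrame hu) contDiffAt_fst
      have h2 : ContDiffAt ℝ ∞ (fun z : E × V ↦ η z.2) (u, y) :=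
        ContDiffAt.comp (g := η) _ (hη y hy) contDiffAt_snd
      exact (h1.clm_apply (ι.contDiff.contDiffAt.comp _ contDiffAt_snd)).prodMk h2)
    ⟨hu₀, hy₀⟩
  refine ⟨ε, hε, fun t ↦ (chartAt E (1 : G)).symm (z t).1, fun t ↦ (z t).2, by simp only [h0],
    by simp only [h0], ?_, fun t ht ↦ ⟨?_, (h t ht).1.2, ?_⟩⟩
  · exact (contMDiffOn_symm_of_mem_maximalAtlas
      (chartAt_mem_maximalAtlas (F := E) (1 : G))).comp hz.fst.contMDiffOn
      fun t ht ↦ (h t ht).1.1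
  · refine velocity_chartAt_symm (u := fun t ↦ (z t).1) (h t ht).1.1 ?_
    exact (hasFDerivAt_fst (𝕜 := ℝ) (E := E) (F := V) (p := z t)).comp_hasDerivAt t (h t ht).2
  · exact (hasFDerivAt_snd (𝕜 := ℝ) (E := E) (F := V) (p := z t)).comp_hasDerivAt t (h t ht).2

/-- The curve `y` is smooth if `k' = k_* y` for a smooth curve `k`. -/
theorem contDiffOn_of_velocity_eq {k : ℝ → G} {s : Set ℝ} (hs : IsOpen s)
    (hk : ContMDiffOn 𝓘(ℝ, ℝ) 𝓘(ℝ, E) ∞ k s) [CompleteSpace E] {y : ℝ → E}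
    (hy : ∀ t ∈ s, (velocity (F := E) k t).2 =
      mulInvariantVectorField (y t : GroupLieAlgebra 𝓘(ℝ, E) G) (k t)) :
    ContDiffOn ℝ ∞ y s := by
  intro t ht
  refine ContDiffAt.contDiffWithinAt ?_
  have hφ := chartAt_mem_maximalAtlas (F := E) (1 : G)
  -- Translating by `(k t)⁻¹` moves the curve to `1` at time `t`. There the frame is the identity,
  -- so it is invertible nearby and `y` is recovered as its inverse applied to the coordinate
  -- velocity.
  have hkt : ContMDiffAt 𝓘(ℝ, ℝ) 𝓘(ℝ, E) ∞ (fun τ ↦ (k t)⁻¹ * k τ) t :=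
    (contMDiff_mul_left (I := 𝓘(ℝ, E)) (n := ∞) (a := (k t)⁻¹)).contMDiffAt.comp t
      (hk.contMDiffAt (hs.mem_nhds ht))
  have h1 : (k t)⁻¹ * k t ∈ (chartAt E (1 : G)).source := by
    rw [inv_mul_cancel]; exact mem_chart_source E (1 : G)
  have hu : ContDiffAt ℝ ∞ (fun τ ↦ chartAt E (1 : G) ((k t)⁻¹ * k τ)) t :=
    ContMDiffAt.contDiffAt
      (ContMDiffAt.comp (g := chartAt E (1 : G)) t (contMDiffAt_of_mem_maximalAtlas hφ h1) hkt)
  have hut : chartAt E (1 : G) ((k t)⁻¹ * k t) = chartAt E (1 : G) 1 := by rw [inv_mul_cancel]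
  have hA : ContDiffAt ℝ ∞ (fun τ ↦ leftFrame G (chartAt E (1 : G) ((k t)⁻¹ * k τ))) t :=
    ContDiffAt.comp (g := leftFrame G) t
      (contDiffAt_leftFrame ((chartAt E (1 : G)).map_source h1)) hu
  have hinv : ContDiffAt ℝ ∞
      (fun τ ↦ (leftFrame G (chartAt E (1 : G) ((k t)⁻¹ * k τ))).inverse) t := by
    refine ContDiffAt.comp (g := ContinuousLinearMap.inverse) t ?_ hA
    rw [hut, leftFrame_chartAt_one]
    exact contDiffAt_map_inverse (ContinuousLinearEquiv.refl ℝ E)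
  have hone : ∀ᶠ B : E →L[ℝ] E in 𝓝 (ContinuousLinearMap.id ℝ E), ∃ e : E ≃L[ℝ] E, ↑e = B := by
    filter_upwards [(ContinuousLinearEquiv.nhds (ContinuousLinearEquiv.refl ℝ E))] with B hB
    exact hB
  have hev := hA.continuousAt.eventually (p := fun B : E →L[ℝ] E ↦ ∃ e : E ≃L[ℝ] E, ↑e = B)
    (by simpa only [hut, leftFrame_chartAt_one] using hone)
  have hd : ContDiffAt ℝ ∞ (deriv fun τ ↦ chartAt E (1 : G) ((k t)⁻¹ * k τ)) t :=
    (hu.fderiv_right (m := ∞) (by simp)).clm_apply contDiffAt_const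
  refine (hinv.clm_apply hd).congr_of_eventuallyEq ?_
  filter_upwards [hev, hs.mem_nhds ht, hkt.continuousAt.preimage_mem_nhds
    ((chartAt E (1 : G)).open_source.mem_nhds h1)] with τ hτ hτs hτc
  have h2 := hasDerivAt_chartAt_mul ((hk.contMDiffAt (hs.mem_nhds hτs)).mdifferentiableAt (by simp))
    (hy τ hτs) hτc
  rw [h2.deriv]
  obtain ⟨e, he⟩ := hτ
  rw [← he, ContinuousLinearMap.inverse_equiv]
  exact (e.symm_apply_apply _).symm

end Group


/-! ### The geodesic equation of a projected curve. -/

section Geodesic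

variable {E : Type*} [NormedAddCommGroup E] [NormedSpace ℝ E]
  {F : Type*} [NormedAddCommGroup F] [NormedSpace ℝ F]
  {G : Type*} [Group G] [TopologicalSpace G] [ChartedSpace E G] [LieGroup 𝓘(ℝ, E) ∞ G]
  {H : Subgroup G} [ChartedSpace F (G ⧸ H)]

omit [NormedSpace ℝ E] [NormedSpace ℝ F] [LieGroup 𝓘(ℝ, E) ∞ G] in
theorem cosetChart_chartAt {g : G} (hg : g ∈ (chartAt E (1 : G)).source) :
    cosetChart E F H (chartAt E (1 : G) g) = chartAt F (origin H) (g : G ⧸ H) := by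
  rw [cosetChart, (chartAt E (1 : G)).left_inv hg]

theorem transportChart_smulDiffeomorph
    (hsub : Manifold.IsSubmersion 𝓘(ℝ, E) 𝓘(ℝ, F) ∞ (fun g : G ↦ (g : G ⧸ H))) (g : G)
    (e : OpenPartialHomeomorph (G ⧸ H) F) (x : G ⧸ H) :
    transportChart (smulDiffeomorph hsub g⁻¹) e x = e (g • x) := by
  have h : (smulDiffeomorph hsub g⁻¹).symm x = g⁻¹⁻¹ • x := rfl
  rw [inv_inv] at h
  rw [← h]
  rfl

theorem mem_transportChart_smulDiffeomorph_source
    (hsub : Manifold.IsSubmersion 𝓘(ℝ, E) 𝓘(ℝ, F) ∞ (fun g : G ↦ (g : G ⧸ H))) (g : G)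
    (e : OpenPartialHomeomorph (G ⧸ H) F) {x : G ⧸ H} (hx : g • x ∈ e.source) :
    x ∈ (transportChart (smulDiffeomorph hsub g⁻¹) e).source := by
  rw [transportChart_source]
  have h : (smulDiffeomorph hsub g⁻¹).symm x = g⁻¹⁻¹ • x := rfl
  rwa [h, inv_inv]

/-- Computes the acceleration of a projected curve when `y` generates it, and the derivative of a
vector field along it when `y` is the field. -/
theorem hasDerivAt_frameDeriv_apply {V : Type*} [NormedAddCommGroup V] [NormedSpace ℝ V]
    {P : E → F} {A : E → V →L[ℝ] E} {u : ℝ → E} {y : ℝ → V} {t : ℝ} {v y' : V}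
    (hP : ContDiffAt ℝ ∞ P (u t)) (hA : ContDiffAt ℝ ∞ A (u t)) (hu : HasDerivAt u (A (u t) v) t)
    (hy : HasDerivAt y y' t) :
    HasDerivAt (fun τ ↦ frameDeriv P A (u τ) (y τ))
      (frameDeriv (frameDeriv P A) A (u t) v (y t) + frameDeriv P A (u t) y') t := by
  have h1 : HasFDerivAt (frameDeriv P A) (fderiv ℝ (frameDeriv P A) (u t)) (u t) :=
    ((hP.frameDeriv hA).differentiableAt (by simp)).hasFDerivAt
  exact (h1.comp_hasDerivAt t hu).clm_apply hy

variable [IsManifold 𝓘(ℝ, F) ∞ (G ⧸ H)]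

/-- The coordinates of `π ∘ k` in a translate of the preferred chart at the origin. -/
theorem hasDerivAt_cosetChart
    (hsub : Manifold.IsSubmersion 𝓘(ℝ, E) 𝓘(ℝ, F) ∞ (fun g : G ↦ (g : G ⧸ H)))
    {k : ℝ → G} {t : ℝ} (hk : MDifferentiableAt 𝓘(ℝ, ℝ) 𝓘(ℝ, E) k t)
    {v : GroupLieAlgebra 𝓘(ℝ, E) G}
    (hv : (velocity (F := E) k t).2 = mulInvariantVectorField v (k t)) {g : G}
    (hg : g * k t ∈ (chartAt E (1 : G)).source)
    (hg' : ((g * k t : G) : G ⧸ H) ∈ (chartAt F (origin H)).source) :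
    HasDerivAt (fun τ ↦ chartAt F (origin H) ((g * k τ : G) : G ⧸ H))
      (frameDeriv (cosetChart E F H) (leftFrame G) (chartAt E (1 : G) (g * k t)) v) t := by
  have h1 := hasDerivAt_chartAt_mul hk hv hg
  have h2 : ContDiffAt ℝ ∞ (cosetChart E F H) (chartAt E (1 : G) (g * k t)) :=
    contDiffAt_cosetChart hsub ((chartAt E (1 : G)).map_source hg)
      (by rwa [(chartAt E (1 : G)).left_inv hg])
  have h3 := (h2.differentiableAt (by simp)).hasFDerivAt.comp_hasDerivAt t h1
  refine h3.congr_of_eventuallyEq ?_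
  have hc : ContinuousAt (fun τ ↦ g * k τ) t :=
    (contMDiff_mul_left (I := 𝓘(ℝ, E)) (n := ∞) (a := g)).continuous.continuousAt.comp
      hk.continuousAt
  filter_upwards [hc.preimage_mem_nhds ((chartAt E (1 : G)).open_source.mem_nhds hg)] with τ hτ
  exact (cosetChart_chartAt hτ).symm

omit [LieGroup 𝓘(ℝ, E) ∞ G] [IsManifold 𝓘(ℝ, F) ∞ (G ⧸ H)] in
theorem contMDiffOn_mk
    (hsub : Manifold.IsSubmersion 𝓘(ℝ, E) 𝓘(ℝ, F) ∞ (fun g : G ↦ (g : G ⧸ H)))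
    {k : ℝ → G} {s : Set ℝ} (hk : ContMDiffOn 𝓘(ℝ, ℝ) 𝓘(ℝ, E) ∞ k s) :
    ContMDiffOn 𝓘(ℝ, ℝ) 𝓘(ℝ, F) ∞ (fun τ ↦ (k τ : G ⧸ H)) s :=
  hsub.contMDiff.comp_contMDiffOn hk

/-- The geodesic equation for `π ∘ k`, in terms of the curve `y` with `k' = k_* y`. -/
theorem hasMFDerivAt_velocity_mk_iff
    (hsub : Manifold.IsSubmersion 𝓘(ℝ, E) 𝓘(ℝ, F) ∞ (fun g : G ↦ (g : G ⧸ H)))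
    {S : Spray F (G ⧸ H)} (hS : S.IsInvariant)
    {k : ℝ → G} {s : Set ℝ} (hs : IsOpen s) (hk : ContMDiffOn 𝓘(ℝ, ℝ) 𝓘(ℝ, E) ∞ k s) {y : ℝ → E}
    (hy : ∀ t ∈ s, (velocity (F := E) k t).2 =
      mulInvariantVectorField (y t : GroupLieAlgebra 𝓘(ℝ, E) G) (k t)) {t : ℝ} (ht : t ∈ s)
    {y' : E} (hy' : HasDerivAt y y' t) {g : G} (hg : g * k t ∈ (chartAt E (1 : G)).source)
    (hg' : ((g * k t : G) : G ⧸ H) ∈ (chartAt F (origin H)).source) {u : E}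
    (hu : u = chartAt E (1 : G) (g * k t))
    (hne : frameDeriv (cosetChart E F H) (leftFrame G) u (y t) ≠ 0) :
    HasMFDerivAt 𝓘(ℝ, ℝ) 𝓘(ℝ, F).tangent (velocity (F := F) fun τ ↦ (k τ : G ⧸ H)) t
        ((1 : ℝ →L[ℝ] ℝ).smulRight (S.vec (velocity (fun τ ↦ (k τ : G ⧸ H)) t))) ↔
      frameDeriv (frameDeriv (cosetChart E F H) (leftFrame G)) (leftFrame G) u (y t) (y t) +
          frameDeriv (cosetChart E F H) (leftFrame G) u y' =
        -(2 : ℝ) • S.coeff (chartAt F (origin H)) (cosetChart E F H u)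
          (frameDeriv (cosetChart E F H) (leftFrame G) u (y t)) := by
  have he := chartAt_mem_maximalAtlas (F := F) (origin H)
  have hkd : ∀ τ ∈ s, MDifferentiableAt 𝓘(ℝ, ℝ) 𝓘(ℝ, E) k τ := fun τ hτ ↦
    (hk.contMDiffAt (hs.mem_nhds hτ)).mdifferentiableAt (by simp)
  have hc : ContinuousAt (fun τ ↦ g * k τ) t :=
    (contMDiff_mul_left (I := 𝓘(ℝ, E)) (n := ∞) (a := g)).continuous.continuousAt.comp
      (hkd t ht).continuousAt
  have hev : deriv (fun τ ↦ chartAt F (origin H) ((g * k τ : G) : G ⧸ H)) =ᶠ[𝓝 t] fun τ ↦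
      frameDeriv (cosetChart E F H) (leftFrame G) (chartAt E (1 : G) (g * k τ)) (y τ) := by
    filter_upwards [hs.mem_nhds ht,
      hc.preimage_mem_nhds ((chartAt E (1 : G)).open_source.mem_nhds hg),
      (hsub.contMDiff.continuous.continuousAt.comp hc).preimage_mem_nhds
        ((chartAt F (origin H)).open_source.mem_nhds hg')] with τ h1 h2 h3
    exact (hasDerivAt_cosetChart hsub (hkd τ h1) (hy τ h1) h2 h3).deriv
  have hut : u ∈ (chartAt E (1 : G)).target := hu ▸ (chartAt E (1 : G)).map_source hg
  have hP : ContDiffAt ℝ ∞ (cosetChart E F H) (chartAt E (1 : G) (g * k t)) :=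
    contDiffAt_cosetChart hsub ((chartAt E (1 : G)).map_source hg)
      (by rwa [(chartAt E (1 : G)).left_inv hg])
  have hA : ContDiffAt ℝ ∞ (leftFrame G) (chartAt E (1 : G) (g * k t)) := by
    rw [← hu]; exact contDiffAt_leftFrame hut
  have hdd := hasDerivAt_frameDeriv_apply hP hA (u := fun τ ↦ chartAt E (1 : G) (g * k τ))
    (hasDerivAt_chartAt_mul (hkd t ht) (hy t ht) hg) hy'
  -- The chart `x ↦ ψ (g • x)`, with `ψ` the chart at the origin, is the transport of `ψ` by `g⁻¹`;
  -- by invariance its spray coefficients are those of `ψ`. The translation `g` stays free, to be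
  -- chosen as `(k t)⁻¹` or as `1`.
  have hfun : (fun τ ↦ transportChart (smulDiffeomorph hsub g⁻¹) (chartAt F (origin H))
      (k τ : G ⧸ H)) = fun τ ↦ chartAt F (origin H) ((g * k τ : G) : G ⧸ H) := by
    ext τ
    exact transportChart_smulDiffeomorph hsub g _ _
  have h := hasMFDerivAt_velocity_iff S
    (transportChart_mem_maximalAtlas (smulDiffeomorph hsub g⁻¹) he) hs (contMDiffOn_mk hsub hk) ht
    (mem_transportChart_smulDiffeomorph_source hsub g _ hg')
  rw [hfun, hev.eq_of_nhds, hev.deriv_eq, hdd.deriv,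
    transportChart_smulDiffeomorph, ← hu] at h
  have hx : chartAt F (origin H) (g • (k t : G ⧸ H)) = cosetChart E F H u := by
    rw [hu, cosetChart_chartAt hg]
    rfl
  rw [hx] at h
  rw [h hne, Spray.coeff, Spray.coeff, localCoeff_transportChart (fun p hp ↦ hS g⁻¹ p hp) he _ hne]
  rw [← hx]
  exact (chartAt F (origin H)).map_source hg'

end Geodesic


/-! ### The Lie bracket as a continuous bilinear map. -/

section Bracket

variable {E : Type*} [NormedAddCommGroup E] [NormedSpace ℝ E]
  {G : Type*} [Group G] [TopologicalSpace G] [ChartedSpace E G]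

variable [FiniteDimensional ℝ E] [LieGroup 𝓘(ℝ, E) ∞ G]

variable (E G) in
theorem isBilinearMap_lie : IsBilinearMap ℝ (fun v w : E ↦ (Bracket.bracket
    (L := GroupLieAlgebra 𝓘(ℝ, E) G) (M := GroupLieAlgebra 𝓘(ℝ, E) G) v w : E)) := by
  have : LieGroup 𝓘(ℝ, E) (minSmoothness ℝ 3) G := by
    have h3 : (3 : WithTop ℕ∞) ≤ ∞ := WithTop.coe_le_coe.2 (le_top : (3 : ℕ∞) ≤ ⊤)
    exact LieGroup.of_le (n := ∞) (by simpa using h3)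
  have : CompleteSpace E := FiniteDimensional.complete ℝ E
  exact {
    add_left := fun x y z ↦ add_lie (L := GroupLieAlgebra 𝓘(ℝ, E) G)
      (M := GroupLieAlgebra 𝓘(ℝ, E) G) x y z
    smul_left := fun r x y ↦ smul_lie (L := GroupLieAlgebra 𝓘(ℝ, E) G)
      (M := GroupLieAlgebra 𝓘(ℝ, E) G) r x y
    add_right := fun x y z ↦ lie_add (L := GroupLieAlgebra 𝓘(ℝ, E) G)
      (M := GroupLieAlgebra 𝓘(ℝ, E) G) x y z
    smul_right := fun r x y ↦ lie_smul (L := GroupLieAlgebra 𝓘(ℝ, E) G)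
      (M := GroupLieAlgebra 𝓘(ℝ, E) G) r x y }

variable (E G) in
/-- The bracket of the Lie algebra, as a continuous bilinear map on the model space. -/
noncomputable def lieCLM : E →L[ℝ] E →L[ℝ] E := (isBilinearMap_lie E G).toContinuousBilinearMap

theorem lieCLM_swap (v w : E) : lieCLM E G v w = -lieCLM E G w v := by
  have : LieGroup 𝓘(ℝ, E) (minSmoothness ℝ 3) G := by
    have h3 : (3 : WithTop ℕ∞) ≤ ∞ := WithTop.coe_le_coe.2 (le_top : (3 : ℕ∞) ≤ ⊤)
    exact LieGroup.of_le (n := ∞) (by simpa using h3)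
  have : CompleteSpace E := FiniteDimensional.complete ℝ E
  exact (lie_skew (L := GroupLieAlgebra 𝓘(ℝ, E) G) v w).symm

end Bracket

/-- The maps `ι` and `pm` are the inclusion of a complement of the isotropy algebra, and the
projection onto it. -/
structure IsIsotropyComplement {E V G : Type*} [NormedAddCommGroup E] [NormedSpace ℝ E]
    [NormedAddCommGroup V] [NormedSpace ℝ V] [Group G] [TopologicalSpace G] [ChartedSpace E G]
    (H : Subgroup G) (ι : V →L[ℝ] E) (pm : E →L[ℝ] V) : Prop where
  proj_incl : ∀ y, pm (ι y) = y
  proj_eq_zero_iff : ∀ x : GroupLieAlgebra 𝓘(ℝ, E) G, pm x = 0 ↔ x ∈ isotropyAlgebra E H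

/-! ### The spray vector field from the coefficients at the origin. -/

section SprayField

variable {E : Type*} [NormedAddCommGroup E] [NormedSpace ℝ E]
  {V : Type*} [NormedAddCommGroup V] [NormedSpace ℝ V]
  {F : Type*} [NormedAddCommGroup F] [NormedSpace ℝ F]
  {G : Type*} [Group G] [TopologicalSpace G] [ChartedSpace E G] [LieGroup 𝓘(ℝ, E) ∞ G]
  {H : Subgroup G} [ChartedSpace F (G ⧸ H)] [IsManifold 𝓘(ℝ, F) ∞ (G ⧸ H)]
  {ι : V →L[ℝ] E} {pm : E →L[ℝ] V}

/-- At the centre of the chart the frame derivative is the tangent map of the projection: onto with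
kernel `𝔥`, hence bijective on a complement. -/
theorem frameDeriv_cosetChart_bijective
    (hsub : Manifold.IsSubmersion 𝓘(ℝ, E) 𝓘(ℝ, F) ∞ (fun g : G ↦ (g : G ⧸ H)))
    (hdec : IsIsotropyComplement H ι pm) :
    Function.Bijective
      (frameDeriv (cosetChart E F H) (leftFrame G) (chartAt E (1 : G) 1) ∘L ι) := by
  constructor
  · refine (injective_iff_map_eq_zero _).2 fun y hy ↦ ?_
    have h1 : projTangent E F H (ι y) = 0 := (frameDeriv_cosetChart_one hsub _).symm.trans hy
    rw [← hdec.proj_incl y]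
    exact (hdec.proj_eq_zero_iff _).2 ((projTangent_eq_zero_iff hsub).1 h1)
  · intro z
    obtain ⟨v, hv⟩ : ∃ v : E, projTangent E F H v = z := projTangent_surjective hsub z
    refine ⟨pm v, ?_⟩
    have h1 : pm (v - ι (pm v) : E) = 0 := by rw [map_sub, hdec.proj_incl, sub_self]
    have h2 : frameDeriv (cosetChart E F H) (leftFrame G) (chartAt E (1 : G) 1)
        (v - ι (pm v) : E) = 0 := (frameDeriv_cosetChart_one hsub _).trans
      ((projTangent_eq_zero_iff hsub).2 ((hdec.proj_eq_zero_iff _).1 h1))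
    rw [map_sub, sub_eq_zero] at h2
    exact h2.symm.trans ((frameDeriv_cosetChart_one hsub v).trans hv)

variable [FiniteDimensional ℝ V]

/-- The identification of `V` with the tangent space at the origin. -/
noncomputable def projEquiv
    (hsub : Manifold.IsSubmersion 𝓘(ℝ, E) 𝓘(ℝ, F) ∞ (fun g : G ↦ (g : G ⧸ H)))
    (hdec : IsIsotropyComplement H ι pm) : V ≃L[ℝ] F :=
  (LinearEquiv.ofBijective
    (frameDeriv (cosetChart E F H) (leftFrame G) (chartAt E (1 : G) 1) ∘L ι).toLinearMap
    (frameDeriv_cosetChart_bijective hsub hdec)).toContinuousLinearEquiv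

theorem projEquiv_apply
    (hsub : Manifold.IsSubmersion 𝓘(ℝ, E) 𝓘(ℝ, F) ∞ (fun g : G ↦ (g : G ⧸ H)))
    (hdec : IsIsotropyComplement H ι pm) (y : V) : projEquiv hsub hdec y =
      frameDeriv (cosetChart E F H) (leftFrame G) (chartAt E (1 : G) 1) (ι y) := rfl

/-- The spray vector field, computed from the spray coefficients at the origin. -/
noncomputable def localSprayField
    (hsub : Manifold.IsSubmersion 𝓘(ℝ, E) 𝓘(ℝ, F) ∞ (fun g : G ↦ (g : G ⧸ H)))
    (hdec : IsIsotropyComplement H ι pm) (S : Spray F (G ⧸ H)) (y : V) : V :=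
  (projEquiv hsub hdec).symm
    ((2 : ℝ) • S.coeff (chartAt F (origin H)) (cosetChart E F H (chartAt E (1 : G) 1))
        (projEquiv hsub hdec y) +
      frameDeriv (frameDeriv (cosetChart E F H) (leftFrame G)) (leftFrame G)
        (chartAt E (1 : G) 1) (ι y) (ι y))

theorem contDiffAt_coeff {M : Type*} [TopologicalSpace M] [ChartedSpace F M]
    [IsManifold 𝓘(ℝ, F) ∞ M] (S : Spray F M) {e : OpenPartialHomeomorph M F}
    (he : e ∈ IsManifold.maximalAtlas 𝓘(ℝ, F) ∞ M) {x v : F} (hx : x ∈ e.target) (hv : v ≠ 0) :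
    ContDiffAt ℝ ∞ (fun z : F × F ↦ S.coeff e z.1 z.2) (x, v) :=
  (S.contDiffOn_coeff e he).contDiffAt
    ((e.open_target.prod isOpen_compl_singleton).mem_nhds ⟨hx, hv⟩)

omit [IsManifold 𝓘(ℝ, F) ∞ (G ⧸ H)] in
theorem cosetChart_one_mem_target :
    cosetChart E F H (chartAt E (1 : G) 1) ∈ (chartAt F (origin H)).target := by
  rw [cosetChart_chartAt (mem_chart_source E (1 : G))]
  exact mem_chart_target F (origin H)

theorem contDiffAt_localSprayField
    (hsub : Manifold.IsSubmersion 𝓘(ℝ, E) 𝓘(ℝ, F) ∞ (fun g : G ↦ (g : G ⧸ H)))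
    (hdec : IsIsotropyComplement H ι pm) (S : Spray F (G ⧸ H)) {y : V} (hy : y ≠ 0) :
    ContDiffAt ℝ ∞ (localSprayField hsub hdec S) y := by
  refine (projEquiv hsub hdec).symm.contDiff.contDiffAt.comp y (ContDiffAt.add ?_ ?_)
  · refine ContDiffAt.const_smul _ (ContDiffAt.comp
      (g := fun z : F × F ↦ S.coeff (chartAt F (origin H)) z.1 z.2) y
      (contDiffAt_coeff S (chartAt_mem_maximalAtlas _) cosetChart_one_mem_target ?_)
      (contDiffAt_const.prodMk (projEquiv hsub hdec).contDiff.contDiffAt))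
    exact (projEquiv hsub hdec).map_eq_zero_iff.not.2 hy
  · exact (contDiffAt_const.clm_apply ι.contDiff.contDiffAt).clm_apply
      ι.contDiff.contDiffAt

/-- `π ∘ k` is a geodesic if and only if the curve `y` with `k' = k_* y` is an integral curve of
`-η`. -/
theorem hasMFDerivAt_velocity_mk_iff_localSprayField
    (hsub : Manifold.IsSubmersion 𝓘(ℝ, E) 𝓘(ℝ, F) ∞ (fun g : G ↦ (g : G ⧸ H)))
    (hdec : IsIsotropyComplement H ι pm) {S : Spray F (G ⧸ H)} (hS : S.IsInvariant)
    {k : ℝ → G} {s : Set ℝ} (hs : IsOpen s) (hk : ContMDiffOn 𝓘(ℝ, ℝ) 𝓘(ℝ, E) ∞ k s) {y : ℝ → V}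
    (hy : ∀ t ∈ s, (velocity (F := E) k t).2 =
      mulInvariantVectorField (ι (y t) : GroupLieAlgebra 𝓘(ℝ, E) G) (k t)) {t : ℝ} (ht : t ∈ s)
    {y' : V} (hy' : HasDerivAt y y' t) (hne : y t ≠ 0) :
    HasMFDerivAt 𝓘(ℝ, ℝ) 𝓘(ℝ, F).tangent (velocity (F := F) fun τ ↦ (k τ : G ⧸ H)) t
        ((1 : ℝ →L[ℝ] ℝ).smulRight (S.vec (velocity (fun τ ↦ (k τ : G ⧸ H)) t))) ↔
      y' = -localSprayField hsub hdec S (y t) := by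
  -- With `g = (k t)⁻¹` the coordinates are taken at the origin, where the geodesic equation is the
  -- equation defining `localSprayField`.
  have h1 : (k t)⁻¹ * k t ∈ (chartAt E (1 : G)).source := by
    rw [inv_mul_cancel]; exact mem_chart_source E (1 : G)
  have h2 : (((k t)⁻¹ * k t : G) : G ⧸ H) ∈ (chartAt F (origin H)).source := by
    rw [inv_mul_cancel]; exact mem_chart_source F (origin H)
  rw [hasMFDerivAt_velocity_mk_iff hsub hS hs hk (y := fun τ ↦ ι (y τ)) hy ht
    (ι.hasFDerivAt.comp_hasDerivAt t hy') h1 h2 (u := chartAt E (1 : G) 1)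
    (by rw [inv_mul_cancel])]
  · rw [← projEquiv_apply hsub hdec, ← projEquiv_apply hsub hdec, localSprayField, ← map_neg,
      ContinuousLinearEquiv.eq_symm_apply]
    constructor
    · intro h
      linear_combination (norm := module) h
    · intro h
      linear_combination (norm := module) h
  · rw [← projEquiv_apply hsub hdec]
    exact (projEquiv hsub hdec).map_eq_zero_iff.not.2 hne

/-- Invariance turns the definition of the spray field at the origin into an equation at all nearby
`u`. It is proved by running a geodesic through `u` and reading its equation in two charts. -/
theorem spray_equation [CompleteSpace E]
    (hsub : Manifold.IsSubmersion 𝓘(ℝ, E) 𝓘(ℝ, F) ∞ (fun g : G ↦ (g : G ⧸ H)))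
    (hdec : IsIsotropyComplement H ι pm) {S : Spray F (G ⧸ H)} (hS : S.IsInvariant)
    {u : E} (hu : u ∈ (chartAt E (1 : G)).target)
    (hu' : (((chartAt E (1 : G)).symm u : G) : G ⧸ H) ∈ (chartAt F (origin H)).source)
    {y : V} (hy : y ≠ 0)
    (hne : frameDeriv (cosetChart E F H) (leftFrame G) u (ι y) ≠ 0) :
    (2 : ℝ) • S.coeff (chartAt F (origin H)) (cosetChart E F H u)
        (frameDeriv (cosetChart E F H) (leftFrame G) u (ι y)) =
      frameDeriv (cosetChart E F H) (leftFrame G) u (ι (localSprayField hsub hdec S y)) -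
        frameDeriv (frameDeriv (cosetChart E F H) (leftFrame G)) (leftFrame G) u
          (ι y) (ι y) := by
  have : CompleteSpace V := FiniteDimensional.complete ℝ V
  obtain ⟨ε, hε, k, z, hk0, hz0, hk, h⟩ := exists_curve_velocity_eq ι
    (η := fun z ↦ -localSprayField hsub hdec S z) (isOpen_compl_singleton (x := (0 : V)))
    (fun z hz ↦ (contDiffAt_localSprayField hsub hdec S hz).neg) (y₀ := y) hy hu
  have h0 : (0 : ℝ) ∈ Ioo (-ε) ε := by simpa using hε
  -- Seen from the origin, the curve satisfies the geodesic equation at time `0` because `y' =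
  -- -η(y)`. The rewriting below reads the same fact with `g := 1`, that is at `u`.
  have h1 := (hasMFDerivAt_velocity_mk_iff_localSprayField hsub hdec hS isOpen_Ioo hk
    (fun t ht ↦ (h t ht).1) h0 (h 0 h0).2.2 (h 0 h0).2.1).2 rfl
  rw [hasMFDerivAt_velocity_mk_iff hsub hS isOpen_Ioo hk (y := fun τ ↦ ι (z τ))
    (fun t ht ↦ (h t ht).1) h0 (ι.hasFDerivAt.comp_hasDerivAt 0 (h 0 h0).2.2) (g := 1)
    (by rw [one_mul, hk0]; exact (chartAt E (1 : G)).map_target hu)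
    (by rw [one_mul, hk0]; exact hu') (u := u)
    (by rw [one_mul, hk0, (chartAt E (1 : G)).right_inv hu]) (by rwa [hz0])] at h1
  rw [hz0, map_neg, map_neg] at h1
  linear_combination (norm := module) h1

end SprayField


/-! ### The curvature through derivatives of `G` on `F × F`. -/

section Riemann

variable {F : Type*} [NormedAddCommGroup F] [NormedSpace ℝ F]
  {M : Type*} [TopologicalSpace M] [ChartedSpace F M] [IsManifold 𝓘(ℝ, F) ∞ M]
  {e : OpenPartialHomeomorph M F}

omit [IsManifold 𝓘(ℝ, F) ∞ M] in
theorem velocity_congr {c d : ℝ → M} {s : Set ℝ} (hs : IsOpen s) (h : ∀ t ∈ s, c t = d t) {t : ℝ}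
    (ht : t ∈ s) : velocity (F := F) c t = velocity d t := by
  have h1 : c =ᶠ[𝓝 t] d := by
    filter_upwards [hs.mem_nhds ht] with r hr using h r hr
  rw [velocity, velocity, h1.mfderiv_eq (I := 𝓘(ℝ, ℝ)) (I' := 𝓘(ℝ, F))]
  exact congrArg (fun x ↦ (⟨x, (mfderiv 𝓘(ℝ, ℝ) 𝓘(ℝ, F) d t (1 : ℝ) : F)⟩ :
    TangentBundle 𝓘(ℝ, F) M)) (h t ht)

omit [IsManifold 𝓘(ℝ, F) ∞ M] in
theorem tangentCoord_snd_eq_zero {p : TangentBundle 𝓘(ℝ, F) M} (hp : p.2 = 0) :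
    (tangentCoord e p).2 = 0 := by
  change mfderiv 𝓘(ℝ, F) 𝓘(ℝ, F) e p.1 p.2 = 0
  rw [hp]
  exact map_zero _

theorem conn_eq_fderiv (S : Spray F M) (he : e ∈ IsManifold.maximalAtlas 𝓘(ℝ, F) ∞ M) {x y : F}
    (hx : x ∈ e.target) (hy : y ≠ 0) (u : F) :
    S.conn e x y u = fderiv ℝ (fun z : F × F ↦ S.coeff e z.1 z.2) (x, y) (0, u) := by
  have h1 := ((contDiffAt_coeff S he hx hy).differentiableAt (by simp)).hasFDerivAt
  have h2 := (h1.comp y (hasFDerivAt_prodMk_right (𝕜 := ℝ) x y)).fderiv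
  exact DFunLike.congr_fun h2 u

/-- The two terms with second derivatives combine into one derivative of `∂G/∂y` in the direction
`(y, -2G)` of the spray, the form in which it can be computed along the geodesic flow. -/
theorem localRiemann_eq_fderiv (S : Spray F M) (he : e ∈ IsManifold.maximalAtlas 𝓘(ℝ, F) ∞ M)
    {x y : F} (hx : x ∈ e.target) (hy : y ≠ 0) (u : F) :
    S.localRiemann e x y u =
      (2 : ℝ) • fderiv ℝ (fun z : F × F ↦ S.coeff e z.1 z.2) (x, y) (u, 0) -
      fderiv ℝ (fderiv ℝ (fun z : F × F ↦ S.coeff e z.1 z.2)) (x, y)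
        (y, -(2 : ℝ) • S.coeff e x y) (0, u) -
      fderiv ℝ (fun z : F × F ↦ S.coeff e z.1 z.2) (x, y)
        (0, fderiv ℝ (fun z : F × F ↦ S.coeff e z.1 z.2) (x, y) (0, u)) := by
  have h0 := contDiffAt_coeff S he hx hy
  set K : F × F → F := fun z ↦ S.coeff e z.1 z.2 with hK
  have h1 : HasFDerivAt K (fderiv ℝ K (x, y)) (x, y) :=
    (h0.differentiableAt (by simp)).hasFDerivAt
  have h2 : HasFDerivAt (fderiv ℝ K) (fderiv ℝ (fderiv ℝ K) (x, y)) (x, y) :=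
    ((h0.fderiv_right (m := ∞) (by simp)).differentiableAt (by simp)).hasFDerivAt
  have h3 : HasFDerivAt (fun z ↦ fderiv ℝ K z (0, u))
      ((fderiv ℝ (fderiv ℝ K) (x, y)).flip (0, u)) (x, y) := by
    refine (h2.clm_apply (hasFDerivAt_const (0, u) _)).congr_fderiv ?_
    ext <;> simp
  have e1 : fderiv ℝ (fun x' ↦ S.coeff e x' y) x u = fderiv ℝ K (x, y) (u, 0) := by
    have := h1.comp x (hasFDerivAt_prodMk_left (𝕜 := ℝ) x y)
    exact DFunLike.congr_fun this.fderiv u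
  have e2 : fderiv ℝ (fun x' ↦ S.conn e x' y u) x y =
      fderiv ℝ (fderiv ℝ K) (x, y) (y, 0) (0, u) := by
    have := h3.comp x (hasFDerivAt_prodMk_left (𝕜 := ℝ) x y)
    refine DFunLike.congr_fun (this.congr_of_eventuallyEq ?_).fderiv y
    filter_upwards [e.open_target.mem_nhds hx] with z hz
    exact conn_eq_fderiv S he hz hy u
  have e3 : fderiv ℝ (fun y' ↦ S.conn e x y' u) y (S.coeff e x y) =
      fderiv ℝ (fderiv ℝ K) (x, y) (0, S.coeff e x y) (0, u) := by
    have := h3.comp y (hasFDerivAt_prodMk_right (𝕜 := ℝ) x y)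
    refine DFunLike.congr_fun (this.congr_of_eventuallyEq ?_).fderiv _
    filter_upwards [isOpen_compl_singleton.mem_nhds hy] with z hz
    exact conn_eq_fderiv S he hx hz u
  have e4 : ((y, -(2 : ℝ) • S.coeff e x y) : F × F) =
      (y, 0) + -(2 : ℝ) • ((0, S.coeff e x y) : F × F) := by simp
  rw [Spray.localRiemann, e1, e2, e3, conn_eq_fderiv S he hx hy, conn_eq_fderiv S he hx hy, e4,
    map_add, map_smul]
  simp only [add_apply, smul_apply]
  module

/-- The preferred chart at `x` has identity derivative at `x`, so the conversions to and from
coordinates disappear. -/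
theorem riemann_eq_localRiemann (S : Spray F M) (x : M) (y u : TangentSpace 𝓘(ℝ, F) x) :
    S.riemann x y u = S.localRiemann (chartAt F x) (chartAt F x x) y u := by
  have h1 (z : F) : mfderiv 𝓘(ℝ, F) 𝓘(ℝ, F) (chartAt F x).symm (chartAt F x x) z = z := by
    have h2 : mfderiv 𝓘(ℝ, F) 𝓘(ℝ, F) (chartAt F x) ((chartAt F x).symm (chartAt F x x))
        (mfderiv 𝓘(ℝ, F) 𝓘(ℝ, F) (chartAt F x).symm (chartAt F x x) z) = z :=
      congrArg Prod.snd (tangentCoord_tangentPoint (chartAt_mem_maximalAtlas x)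
        (mem_chart_target F x) z)
    have h3 := mfderiv_chartAt_self x
      (mfderiv 𝓘(ℝ, F) 𝓘(ℝ, F) (chartAt F x).symm (chartAt F x x) z : F)
    exact (h3.symm.trans (mfderiv_congr_apply rfl
      ((chartAt F x).left_inv (mem_chart_source F x)).symm _)).trans h2
  refine (h1 _).trans ?_
  exact congrArg₂ (fun a b ↦ S.localRiemann (chartAt F x) (chartAt F x x) a b)
    (mfderiv_chartAt_self x y) (mfderiv_chartAt_self x u)

end Riemann

/-! ### Geodesics and their lifts to `G`. -/

section Lift

variable {E : Type*} [NormedAddCommGroup E] [NormedSpace ℝ E]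
  {V : Type*} [NormedAddCommGroup V] [NormedSpace ℝ V]
  {F : Type*} [NormedAddCommGroup F] [NormedSpace ℝ F]
  {G : Type*} [Group G] [TopologicalSpace G] [ChartedSpace E G]
  {H : Subgroup G} [ChartedSpace F (G ⧸ H)]
  {ι : V →L[ℝ] E} {pm : E →L[ℝ] V}

theorem velocity_mk
    (hsub : Manifold.IsSubmersion 𝓘(ℝ, E) 𝓘(ℝ, F) ∞ (fun g : G ↦ (g : G ⧸ H)))
    {k : ℝ → G} {t : ℝ} (hk : MDifferentiableAt 𝓘(ℝ, ℝ) 𝓘(ℝ, E) k t) :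
    velocity (F := F) (fun τ ↦ (k τ : G ⧸ H)) t =
      tangentMap 𝓘(ℝ, E) 𝓘(ℝ, F) (fun g : G ↦ (g : G ⧸ H)) (velocity k t) := by
  have h1 := HasMFDerivAt.comp t
    (hsub.contMDiff.mdifferentiable (by simp) (k t)).hasMFDerivAt hk.hasMFDerivAt
  exact congrArg (TotalSpace.mk _) (DFunLike.congr_fun h1.mfderiv (1 : ℝ))

theorem velocity_mk_eq_projTangent
    (hsub : Manifold.IsSubmersion 𝓘(ℝ, E) 𝓘(ℝ, F) ∞ (fun g : G ↦ (g : G ⧸ H)))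
    {k : ℝ → G} {t : ℝ} (hk : MDifferentiableAt 𝓘(ℝ, ℝ) 𝓘(ℝ, E) k t) (h1 : k t = 1)
    {v : GroupLieAlgebra 𝓘(ℝ, E) G}
    (hv : (velocity (F := E) k t).2 = mulInvariantVectorField v (k t)) :
    velocity (F := F) (fun τ ↦ (k τ : G ⧸ H)) t = ⟨origin H, projTangent E F H v⟩ := by
  have h2 : velocity (F := E) k t = ⟨k t, mulInvariantVectorField v (k t)⟩ :=
    congrArg (TotalSpace.mk _) hv
  rw [velocity_mk hsub hk, h2, h1, mulInvariantVectorField_one]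
  rfl

omit [TopologicalSpace G] in
theorem smul_origin (g : G) : g • origin H = (g : G ⧸ H) :=
  congrArg (fun x : G ↦ (x : G ⧸ H)) (mul_one g)

variable [LieGroup 𝓘(ℝ, E) ∞ G] [IsManifold 𝓘(ℝ, F) ∞ (G ⧸ H)]

/-- Gives the coordinates of `(c̄)_* w` in a translated chart: they are `Q` applied to `w`, just as
the velocity is `Q` applied to `y`. -/
theorem tangentCoord_tangentMap_smul
    (hsub : Manifold.IsSubmersion 𝓘(ℝ, E) 𝓘(ℝ, F) ∞ (fun g : G ↦ (g : G ⧸ H))) {g k : G}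
    (hg : g * k ∈ (chartAt E (1 : G)).source)
    (hg' : ((g * k : G) : G ⧸ H) ∈ (chartAt F (origin H)).source)
    (v : GroupLieAlgebra 𝓘(ℝ, E) G) :
    (tangentCoord (transportChart (smulDiffeomorph hsub g⁻¹) (chartAt F (origin H)))
      (tangentMap 𝓘(ℝ, F) 𝓘(ℝ, F) (fun x : G ⧸ H ↦ k • x) ⟨origin H, projTangent E F H v⟩)).2 =
      frameDeriv (cosetChart E F H) (leftFrame G) (chartAt E (1 : G) (g * k)) v := by
  have he := transportChart_mem_maximalAtlas (smulDiffeomorph hsub g⁻¹)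
    (chartAt_mem_maximalAtlas (F := F) (origin H))
  have hko : k • ((1 : G) : G ⧸ H) ∈
      (transportChart (smulDiffeomorph hsub g⁻¹) (chartAt F (origin H))).source := by
    refine mem_transportChart_smulDiffeomorph_source hsub g _ ?_
    rw [smul_smul]
    exact (smul_origin (H := H) (g * k)).symm ▸ hg'
  have h1 := HasMFDerivAt.comp (1 : G)
    ((contMDiff_smul_left hsub k).mdifferentiable (by simp) ((1 : G) : G ⧸ H)).hasMFDerivAt
    (hsub.contMDiff.mdifferentiable (by simp) (1 : G)).hasMFDerivAt
  have h2 := HasMFDerivAt.comp (1 : G)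
    ((mdifferentiable_of_mem_maximalAtlas he).mdifferentiableAt hko).hasMFDerivAt h1
  have h3 : (transportChart (smulDiffeomorph hsub g⁻¹) (chartAt F (origin H)) ∘
      (fun x : G ⧸ H ↦ k • x) ∘ fun z : G ↦ (z : G ⧸ H)) =
      fun z : G ↦ chartAt F (origin H) ((g * k * z : G) : G ⧸ H) := by
    ext z
    exact (transportChart_smulDiffeomorph hsub g _ _).trans
      (congrArg (chartAt F (origin H)) (smul_smul g k (z : G ⧸ H)))
  rw [h3] at h2
  rw [← mfderiv_chartAt_mk_mul hsub hg hg']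
  exact (DFunLike.congr_fun h2.mfderiv v).symm

variable [FiniteDimensional ℝ V] [CompleteSpace E]

/-- Every `y ≠ 0` is the initial value of a curve that belongs to a geodesic. -/
theorem exists_isGeodesic
    (hsub : Manifold.IsSubmersion 𝓘(ℝ, E) 𝓘(ℝ, F) ∞ (fun g : G ↦ (g : G ⧸ H)))
    (hdec : IsIsotropyComplement H ι pm) {S : Spray F (G ⧸ H)} (hS : S.IsInvariant) {y : V}
    (hy : y ≠ 0) :
    ∃ ε > (0 : ℝ), ∃ (k : ℝ → G) (z : ℝ → V),
      S.IsGeodesic (fun τ ↦ (k τ : G ⧸ H)) (Ioo (-ε) ε) ∧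
      velocity (fun τ ↦ (k τ : G ⧸ H)) 0 = ⟨origin H, projTangent E F H (ι y)⟩ ∧
      k 0 = 1 ∧ z 0 = y ∧ ContMDiffOn 𝓘(ℝ, ℝ) 𝓘(ℝ, E) ∞ k (Ioo (-ε) ε) ∧
      ∀ t ∈ Ioo (-ε) ε, (velocity (F := E) k t).2 =
          mulInvariantVectorField (ι (z t) : GroupLieAlgebra 𝓘(ℝ, E) G) (k t) ∧
        z t ≠ 0 ∧ HasDerivAt z (-localSprayField hsub hdec S (z t)) t := by
  have : CompleteSpace V := FiniteDimensional.complete ℝ V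
  obtain ⟨ε, hε, k, z, hk0, hz0, hk, h⟩ := exists_curve_velocity_eq ι
    (η := fun z ↦ -localSprayField hsub hdec S z) (isOpen_compl_singleton (x := (0 : V)))
    (fun z hz ↦ (contDiffAt_localSprayField hsub hdec S hz).neg) (y₀ := y) hy
    (mem_chart_target E (1 : G))
  rw [(chartAt E (1 : G)).left_inv (mem_chart_source E (1 : G))] at hk0
  have h0 : (0 : ℝ) ∈ Ioo (-ε) ε := by simpa using hε
  have hkd : ∀ t ∈ Ioo (-ε) ε, MDifferentiableAt 𝓘(ℝ, ℝ) 𝓘(ℝ, E) k t := fun t ht ↦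
    (hk.contMDiffAt (isOpen_Ioo.mem_nhds ht)).mdifferentiableAt (by simp)
  refine ⟨ε, hε, k, z, ⟨contMDiffOn_mk hsub hk, fun t ht hv ↦ (h t ht).2.1 ?_, fun t ht ↦ ?_⟩,
    ?_, hk0, hz0, hk, h⟩
  · have h1 : (k t)⁻¹ * k t ∈ (chartAt E (1 : G)).source := by
      rw [inv_mul_cancel]; exact mem_chart_source E (1 : G)
    have h2 : (((k t)⁻¹ * k t : G) : G ⧸ H) ∈ (chartAt F (origin H)).source := by
      rw [inv_mul_cancel]; exact mem_chart_source F (origin H)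
    have h3 := hasDerivAt_cosetChart hsub (hkd t ht) (h t ht).1 h1 h2
    have h4 := congrArg Prod.snd (tangentCoord_velocity
      (transportChart_mem_maximalAtlas (smulDiffeomorph hsub (k t)⁻¹⁻¹)
        (chartAt_mem_maximalAtlas (F := F) (origin H)))
      (((contMDiffOn_mk hsub hk).contMDiffAt (isOpen_Ioo.mem_nhds ht)).mdifferentiableAt (by simp))
      (mem_transportChart_smulDiffeomorph_source hsub (k t)⁻¹ (chartAt F (origin H))
        (x := (k t : G ⧸ H)) h2))
    have h5 : (fun τ ↦ transportChart (smulDiffeomorph hsub (k t)⁻¹⁻¹) (chartAt F (origin H))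
        (k τ : G ⧸ H)) = fun τ ↦ chartAt F (origin H) (((k t)⁻¹ * k τ : G) : G ⧸ H) := by
      ext τ
      exact transportChart_smulDiffeomorph hsub (k t)⁻¹ _ _
    rw [h5, h3.deriv] at h4
    have h6 : projEquiv hsub hdec (z t) = 0 := by
      rw [projEquiv_apply]
      rw [inv_mul_cancel] at h4
      exact h4.symm.trans (tangentCoord_snd_eq_zero hv)
    exact (projEquiv hsub hdec).map_eq_zero_iff.1 h6
  · exact ((hasMFDerivAt_velocity_mk_iff_localSprayField hsub hdec hS isOpen_Ioo hk
      (fun t ht ↦ (h t ht).1) ht (h t ht).2.2 (h t ht).2.1).2 rfl).hasMFDerivWithinAt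
  · rw [← hz0]
    exact velocity_mk_eq_projTangent hsub (hkd 0 h0) hk0 (h 0 h0).1

omit [FiniteDimensional ℝ V] in
theorem contDiffOn_of_velocity_eq_incl
    (hdec : IsIsotropyComplement H ι pm) {k : ℝ → G} {s : Set ℝ} (hs : IsOpen s)
    (hk : ContMDiffOn 𝓘(ℝ, ℝ) 𝓘(ℝ, E) ∞ k s) {y : ℝ → V}
    (hy : ∀ t ∈ s, (velocity (F := E) k t).2 =
      mulInvariantVectorField (ι (y t) : GroupLieAlgebra 𝓘(ℝ, E) G) (k t)) :
    ContDiffOn ℝ ∞ y s := by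
  have h := pm.contDiff.comp_contDiffOn (contDiffOn_of_velocity_eq hs hk (y := fun t ↦ ι (y t)) hy)
  exact h.congr fun t _ ↦ (hdec.proj_incl (y t)).symm

/-- The curve `y` that belongs to a geodesic is an integral curve of `-η`. -/
theorem hasDerivAt_of_isGeodesic
    (hsub : Manifold.IsSubmersion 𝓘(ℝ, E) 𝓘(ℝ, F) ∞ (fun g : G ↦ (g : G ⧸ H)))
    (hdec : IsIsotropyComplement H ι pm) {S : Spray F (G ⧸ H)} (hS : S.IsInvariant)
    {c : ℝ → G ⧸ H} {k : ℝ → G} {s : Set ℝ} (hs : IsOpen s) (hc : S.IsGeodesic c s)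
    (hck : ∀ t ∈ s, c t = (k t : G ⧸ H)) (hk : ContMDiffOn 𝓘(ℝ, ℝ) 𝓘(ℝ, E) ∞ k s) {y : ℝ → V}
    (hy : ∀ t ∈ s, (velocity (F := E) k t).2 =
      mulInvariantVectorField (ι (y t) : GroupLieAlgebra 𝓘(ℝ, E) G) (k t)) {t : ℝ} (ht : t ∈ s)
    (hne : y t ≠ 0) : HasDerivAt y (-localSprayField hsub hdec S (y t)) t := by
  have h1 := (((contDiffOn_of_velocity_eq_incl hdec hs hk hy).contDiffAt
    (hs.mem_nhds ht)).differentiableAt (by simp)).hasDerivAt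
  have h2 : velocity (F := F) c =ᶠ[𝓝 t] velocity (F := F) fun τ ↦ (k τ : G ⧸ H) := by
    filter_upwards [hs.mem_nhds ht] with τ hτ using velocity_congr hs hck hτ
  have h3 := (hc.isIntegralCurve t ht).hasMFDerivAt (hs.mem_nhds ht)
  have h4 := h3.congr_of_eventuallyEq h2.symm
  have h5 : HasMFDerivAt 𝓘(ℝ, ℝ) 𝓘(ℝ, F).tangent (velocity (F := F) fun τ ↦ (k τ : G ⧸ H)) t
        ((1 : ℝ →L[ℝ] ℝ).smulRight (S.vec (velocity (fun τ ↦ (k τ : G ⧸ H)) t))) := by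
    rw [← h2.eq_of_nhds]
    exact h4
  rw [hasMFDerivAt_velocity_mk_iff_localSprayField hsub hdec hS hs hk hy ht h1 hne] at h5
  rwa [← h5]

end Lift


/-! ### Linear parallelism and curvature in terms of the spray field. -/

section Curvature

variable {E : Type*} [NormedAddCommGroup E] [NormedSpace ℝ E] [FiniteDimensional ℝ E]
  {V : Type*} [NormedAddCommGroup V] [NormedSpace ℝ V] [FiniteDimensional ℝ V]
  {F : Type*} [NormedAddCommGroup F] [NormedSpace ℝ F]
  {G : Type*} [Group G] [TopologicalSpace G] [ChartedSpace E G] [LieGroup 𝓘(ℝ, E) ∞ G]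
  {H : Subgroup G} [ChartedSpace F (G ⧸ H)] [IsManifold 𝓘(ℝ, F) ∞ (G ⧸ H)]
  {ι : V →L[ℝ] E} {pm : E →L[ℝ] V}

omit [FiniteDimensional ℝ E] [FiniteDimensional ℝ V] in
theorem frameDeriv_cosetChart_sub_proj
    (hsub : Manifold.IsSubmersion 𝓘(ℝ, E) 𝓘(ℝ, F) ∞ (fun g : G ↦ (g : G ⧸ H)))
    (hdec : IsIsotropyComplement H ι pm) {u : E} (hu : u ∈ (chartAt E (1 : G)).target)
    (hu' : (((chartAt E (1 : G)).symm u : G) : G ⧸ H) ∈ (chartAt F (origin H)).source) (x : E) :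
    frameDeriv (cosetChart E F H) (leftFrame G) u (x - ι (pm x)) = 0 := by
  refine frameDeriv_cosetChart_isotropy hsub hu hu' ((hdec.proj_eq_zero_iff _).1 ?_)
  exact (map_sub pm x (ι (pm x))).trans (by rw [hdec.proj_incl, sub_self])

/-- The commutator of the frame gives `Q [v, w]`, and `Q` sees only the `𝔪`-part. -/
theorem frameDeriv_frameDeriv_sub
    (hsub : Manifold.IsSubmersion 𝓘(ℝ, E) 𝓘(ℝ, F) ∞ (fun g : G ↦ (g : G ⧸ H)))
    (hdec : IsIsotropyComplement H ι pm) (v w : E) :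
    frameDeriv (frameDeriv (cosetChart E F H) (leftFrame G)) (leftFrame G)
        (chartAt E (1 : G) 1) v w -
      frameDeriv (frameDeriv (cosetChart E F H) (leftFrame G)) (leftFrame G)
        (chartAt E (1 : G) 1) w v = projEquiv hsub hdec (pm (lieCLM E G v w)) := by
  have : CompleteSpace E := FiniteDimensional.complete ℝ E
  obtain ⟨hu, hu'⟩ := (mem_cosetChart_nhds (E := E) hsub).self_of_nhds
  rw [frameDeriv_commutator (contDiffAt_cosetChart hsub hu hu') (contDiffAt_leftFrame hu)
    (z := lieCLM E G v w) (leftFrame_lie hu v w), projEquiv_apply, ← sub_eq_zero, ← map_sub]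
  exact frameDeriv_cosetChart_sub_proj hsub hdec hu hu' _

omit [FiniteDimensional ℝ E] in
theorem fderiv_localSprayField
    (hsub : Manifold.IsSubmersion 𝓘(ℝ, E) 𝓘(ℝ, F) ∞ (fun g : G ↦ (g : G ⧸ H)))
    (hdec : IsIsotropyComplement H ι pm) (S : Spray F (G ⧸ H)) {y : V} (hy : y ≠ 0) (v : V) :
    projEquiv hsub hdec (fderiv ℝ (localSprayField hsub hdec S) y v) =
      (2 : ℝ) • S.conn (chartAt F (origin H)) (cosetChart E F H (chartAt E (1 : G) 1))
        (projEquiv hsub hdec y) (projEquiv hsub hdec v) +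
      (frameDeriv (frameDeriv (cosetChart E F H) (leftFrame G)) (leftFrame G)
        (chartAt E (1 : G) 1) (ι v) (ι y) +
      frameDeriv (frameDeriv (cosetChart E F H) (leftFrame G)) (leftFrame G)
        (chartAt E (1 : G) 1) (ι y) (ι v)) := by
  have hy' : projEquiv hsub hdec y ≠ 0 := (projEquiv hsub hdec).map_eq_zero_iff.not.2 hy
  have h1 := (projEquiv hsub hdec).hasFDerivAt.comp y
    ((contDiffAt_localSprayField hsub hdec S hy).differentiableAt (by simp)).hasFDerivAt
  have h2 : ContDiffAt ℝ ∞ (fun v ↦ S.coeff (chartAt F (origin H))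
      (cosetChart E F H (chartAt E (1 : G) 1)) v) (projEquiv hsub hdec y) :=
    (contDiffAt_coeff S (chartAt_mem_maximalAtlas _) cosetChart_one_mem_target hy').comp
      (projEquiv hsub hdec y) (contDiffAt_const.prodMk contDiffAt_id)
  have h3 := ((h2.differentiableAt (by simp)).hasFDerivAt.comp y
    (projEquiv hsub hdec).hasFDerivAt).const_smul (2 : ℝ)
  have h4 := ((hasFDerivAt_const (frameDeriv (frameDeriv (cosetChart E F H) (leftFrame G))
    (leftFrame G) (chartAt E (1 : G) 1)) y).clm_apply (ι.hasFDerivAt (x := y))).clm_apply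
    (ι.hasFDerivAt (x := y))
  have h5 : (projEquiv hsub hdec ∘ localSprayField hsub hdec S) = _ :=
    funext fun y ↦ (projEquiv hsub hdec).apply_symm_apply _
  have h6 := DFunLike.congr_fun ((h3.add h4).unique (h5 ▸ h1)) v
  simp at h6
  rw [← h6, Spray.conn]
  abel

/-- The equation for `w`, where `k_* w` is a linearly parallel vector field along a geodesic. -/
theorem eq_of_isLinearlyParallel
    (hsub : Manifold.IsSubmersion 𝓘(ℝ, E) 𝓘(ℝ, F) ∞ (fun g : G ↦ (g : G ⧸ H)))
    (hdec : IsIsotropyComplement H ι pm) {S : Spray F (G ⧸ H)} (hS : S.IsInvariant)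
    {c : ℝ → G ⧸ H} {k : ℝ → G} {s : Set ℝ} (hs : IsOpen s)
    (hc : ContMDiffOn 𝓘(ℝ, ℝ) 𝓘(ℝ, F) ∞ c s) (hck : ∀ t ∈ s, c t = (k t : G ⧸ H))
    (hk : ContMDiffOn 𝓘(ℝ, ℝ) 𝓘(ℝ, E) ∞ k s) {y : ℝ → V}
    (hy : ∀ t ∈ s, (velocity (F := E) k t).2 =
      mulInvariantVectorField (ι (y t) : GroupLieAlgebra 𝓘(ℝ, E) G) (k t))
    {W : ℝ → TangentBundle 𝓘(ℝ, F) (G ⧸ H)} {w : ℝ → V}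
    (hWw : ∀ t ∈ s, W t = tangentMap 𝓘(ℝ, F) 𝓘(ℝ, F) (fun x : G ⧸ H ↦ k t • x)
      ⟨origin H, projTangent E F H (ι (w t))⟩)
    (hW : S.IsLinearlyParallel c W s) {t : ℝ} (ht : t ∈ s) (hne : y t ≠ 0) {w' : V}
    (hw : HasDerivAt w w' t) :
    w' = -((1 / 2 : ℝ) • fderiv ℝ (localSprayField hsub hdec S) (y t) (w t) +
      (1 / 2 : ℝ) • pm (lieCLM E G (ι (y t)) (ι (w t)))) := by
  have he := chartAt_mem_maximalAtlas (F := F) (origin H)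
  -- The chart at the origin composed with translation by `(k t)⁻¹`: at time `t` everything is
  -- evaluated at the origin, with the spray coefficients unchanged.
  obtain ⟨e', he'⟩ : ∃ e', e' =
    transportChart (smulDiffeomorph hsub (k t)⁻¹⁻¹) (chartAt F (origin H)) := ⟨_, rfl⟩
  have hem : e' ∈ IsManifold.maximalAtlas 𝓘(ℝ, F) ∞ (G ⧸ H) := by
    rw [he']; exact transportChart_mem_maximalAtlas _ he
  obtain ⟨hu, hu'⟩ := (mem_cosetChart_nhds (E := E) hsub).self_of_nhds
  have h1 : (k t)⁻¹ * k t ∈ (chartAt E (1 : G)).source := by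
    rw [inv_mul_cancel]; exact mem_chart_source E (1 : G)
  have h2 : (((k t)⁻¹ * k t : G) : G ⧸ H) ∈ (chartAt F (origin H)).source := by
    rw [inv_mul_cancel]; exact mem_chart_source F (origin H)
  have hsrc : c t ∈ e'.source := by
    rw [hck t ht, he']
    exact mem_transportChart_smulDiffeomorph_source hsub (k t)⁻¹ (chartAt F (origin H))
      (x := (k t : G ⧸ H)) h2
  have hkd : ∀ t ∈ s, MDifferentiableAt 𝓘(ℝ, ℝ) 𝓘(ℝ, E) k t := fun t ht ↦
    (hk.contMDiffAt (hs.mem_nhds ht)).mdifferentiableAt (by simp)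
  have hcont : ContinuousAt (fun τ ↦ (k t)⁻¹ * k τ) t :=
    (contMDiff_mul_left (I := 𝓘(ℝ, E)) (n := ∞) (a := (k t)⁻¹)).continuous.continuousAt.comp
      (hkd t ht).continuousAt
  have h0 := hW.covDeriv_eq_zero e' hem t ht hsrc
  -- the coordinates of the vector field
  have hev : (fun τ ↦ (tangentCoord e' (W τ)).2) =ᶠ[𝓝 t] fun τ ↦ frameDeriv (cosetChart E F H)
      (leftFrame G) (chartAt E (1 : G) ((k t)⁻¹ * k τ)) (ι (w τ)) := by
    filter_upwards [hs.mem_nhds ht,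
      hcont.preimage_mem_nhds ((chartAt E (1 : G)).open_source.mem_nhds h1),
      (hsub.contMDiff.continuous.continuousAt.comp hcont).preimage_mem_nhds
        ((chartAt F (origin H)).open_source.mem_nhds h2)] with τ e1 e2 e3
    rw [hWw τ e1, he']
    exact tangentCoord_tangentMap_smul hsub e2 e3 _
  have hut : chartAt E (1 : G) ((k t)⁻¹ * k t) = chartAt E (1 : G) 1 := by rw [inv_mul_cancel]
  have hd := hasDerivAt_frameDeriv_apply (P := cosetChart E F H) (A := leftFrame G)
    (u := fun τ ↦ chartAt E (1 : G) ((k t)⁻¹ * k τ)) (y := fun τ ↦ ι (w τ))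
    (by rw [hut]; exact contDiffAt_cosetChart hsub hu hu')
    (by rw [hut]; exact contDiffAt_leftFrame hu)
    (hasDerivAt_chartAt_mul (hkd t ht) (hy t ht) h1) (ι.hasFDerivAt.comp_hasDerivAt t hw)
  -- the coordinates of the velocity
  have hvel := tangentCoord_velocity hem ((hc.contMDiffAt (hs.mem_nhds ht)).mdifferentiableAt
    (by simp)) hsrc
  have hec : (fun τ ↦ e' (c τ)) =ᶠ[𝓝 t]
      fun τ ↦ chartAt F (origin H) (((k t)⁻¹ * k τ : G) : G ⧸ H) := by
    filter_upwards [hs.mem_nhds ht] with τ hτ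
    rw [hck τ hτ, he']
    exact transportChart_smulDiffeomorph hsub (k t)⁻¹ _ _
  rw [hec.deriv_eq, (hasDerivAt_cosetChart hsub (hkd t ht) (hy t ht) h1 h2).deriv,
    hec.eq_of_nhds, ← cosetChart_chartAt h1] at hvel
  rw [Spray.covDeriv, hev.deriv_eq, hd.deriv, hev.eq_of_nhds, hvel, hut] at h0
  have hconn (x v : F) (hx : x ∈ (chartAt F (origin H)).target) (hv : v ≠ 0) (z : F) :
      S.conn e' x v z = S.conn (chartAt F (origin H)) x v z := by
    have : (fun v ↦ S.coeff e' x v) =ᶠ[𝓝 v] fun v ↦ S.coeff (chartAt F (origin H)) x v := by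
      filter_upwards [isOpen_compl_singleton.mem_nhds hv] with v hv
      rw [he']
      exact localCoeff_transportChart (fun p hp ↦ hS (k t)⁻¹⁻¹ p hp) he hx hv
    rw [Spray.conn, Spray.conn, this.fderiv_eq]
  have hne' : projEquiv hsub hdec (y t) ≠ 0 := (projEquiv hsub hdec).map_eq_zero_iff.not.2 hne
  have h0' : frameDeriv (frameDeriv (cosetChart E F H) (leftFrame G)) (leftFrame G)
      (chartAt E (1 : G) 1) (ι (y t)) (ι (w t)) + projEquiv hsub hdec w' +
      S.conn e' (cosetChart E F H (chartAt E (1 : G) 1)) (projEquiv hsub hdec (y t))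
        (projEquiv hsub hdec (w t)) = 0 := h0
  rw [hconn _ _ cosetChart_one_mem_target hne'] at h0'
  -- The vertical derivative of `G` contains the symmetric half of `-B(y, w)`, while the derivative
  -- of `Q w` contains `B(y, w)`. The antisymmetric half survives and equals `½ Q [y, w]_𝔪`.
  have h3 := fderiv_localSprayField hsub hdec S hne (w t)
  have h4 := frameDeriv_frameDeriv_sub hsub hdec (ι (y t)) (ι (w t))
  apply (projEquiv hsub hdec).injective
  rw [map_neg, map_add, map_smul, map_smul, h3, ← h4]
  linear_combination (norm := module) h0'

/-- The Riemann curvature at the origin, in terms of the spray vector field. -/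
theorem riemann_origin_eq
    (hsub : Manifold.IsSubmersion 𝓘(ℝ, E) 𝓘(ℝ, F) ∞ (fun g : G ↦ (g : G ⧸ H)))
    (hdec : IsIsotropyComplement H ι pm) {S : Spray F (G ⧸ H)} (hS : S.IsInvariant) {y v m n : V}
    (hne : y ≠ 0)
    (hm : m = (1 / 2 : ℝ) • fderiv ℝ (localSprayField hsub hdec S) y v +
      (1 / 2 : ℝ) • pm (lieCLM E G (ι y) (ι v)))
    (hn : n = (1 / 2 : ℝ) • fderiv ℝ (localSprayField hsub hdec S) y v -
      (1 / 2 : ℝ) • pm (lieCLM E G (ι y) (ι v))) :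
    S.riemann (origin H) (projTangent E F H (ι y)) (projTangent E F H (ι v)) =
      projTangent E F H (ι (pm (lieCLM E G (ι y)
          (lieCLM E G (ι v) (ι y) - ι (pm (lieCLM E G (ι v) (ι y))))) -
        (-(1 / 2 : ℝ) • fderiv ℝ (fderiv ℝ (localSprayField hsub hdec S)) y
            (localSprayField hsub hdec S y) v -
          (1 / 2 : ℝ) • fderiv ℝ (localSprayField hsub hdec S) y m +
          (1 / 2 : ℝ) • pm (lieCLM E G (ι (localSprayField hsub hdec S y)) (ι v)) +
          (1 / 2 : ℝ) • pm (lieCLM E G (ι y) (ι m)) +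
          fderiv ℝ (localSprayField hsub hdec S) y n))) := by
  have : CompleteSpace E := FiniteDimensional.complete ℝ E
  have he := chartAt_mem_maximalAtlas (F := F) (origin H)
  have hne' : projEquiv hsub hdec y ≠ 0 := (projEquiv hsub hdec).map_eq_zero_iff.not.2 hne
  have hnb := (mem_cosetChart_nhds (E := E) hsub)
  have hQ : ContinuousAt (fun p : E × V ↦ frameDeriv (cosetChart E F H) (leftFrame G) p.1 (ι p.2))
      (chartAt E (1 : G) 1, y) := by
    have h1 : ContDiffAt ℝ ∞ (frameDeriv (cosetChart E F H) (leftFrame G)) (chartAt E (1 : G) 1) :=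
      (contDiffAt_cosetChart hsub hnb.self_of_nhds.1 hnb.self_of_nhds.2).frameDeriv
        (contDiffAt_leftFrame hnb.self_of_nhds.1)
    have h2 : ContinuousAt (fun p : E × V ↦ frameDeriv (cosetChart E F H) (leftFrame G) p.1)
        (chartAt E (1 : G) 1, y) :=
      ContinuousAt.comp (f := Prod.fst) (g := frameDeriv (cosetChart E F H) (leftFrame G))
        h1.continuousAt continuousAt_fst
    exact h2.clm_apply (ι.continuous.continuousAt.comp continuousAt_snd)
  have key := curvature_of_spray_equation (P := cosetChart E F H) (A := leftFrame G)
    (G := fun z : F × F ↦ S.coeff (chartAt F (origin H)) z.1 z.2)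
    (η := localSprayField hsub hdec S) (ι := ι) (u₀ := chartAt E (1 : G) 1) (y := y)
    (br := lieCLM E G) (pm := pm) (ph := fun x ↦ x - ι (pm x)) (v := v)
    (hnb.mono fun u hu ↦ contDiffAt_cosetChart hsub hu.1 hu.2)
    (hnb.mono fun u hu ↦ contDiffAt_leftFrame hu.1)
    (by
      filter_upwards [((chartAt F (origin H)).open_target.prod
        (isOpen_compl_singleton (x := (0 : F)))).mem_nhds
        ⟨cosetChart_one_mem_target (E := E), hne'⟩] with z hz
      exact contDiffAt_coeff S he hz.1 hz.2)
    (by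
      filter_upwards [isOpen_compl_singleton.mem_nhds hne] with z hz
      exact contDiffAt_localSprayField hsub hdec S hz)
    (hnb.mono fun u hu v w ↦ leftFrame_lie hu.1 v w) lieCLM_swap
    (fun x ↦ (add_sub_cancel _ _).symm)
    (hnb.mono fun u hu x ↦ frameDeriv_cosetChart_sub_proj hsub hdec hu.1 hu.2 x)
    (by
      filter_upwards [continuousAt_fst.eventually hnb,
        continuousAt_snd.eventually (isOpen_compl_singleton.mem_nhds hne),
        hQ.eventually (isOpen_compl_singleton.mem_nhds hne')] with p hp1 hp2 hp3
      exact spray_equation hsub hdec hS hp1.1 hp1.2 hp2 hp3) hm hn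
  refine Eq.trans ?_ (frameDeriv_cosetChart_one hsub _)
  refine Eq.trans ?_ key
  rw [riemann_eq_localRiemann]
  have hx : chartAt F (origin H) (origin H) = cosetChart E F H (chartAt E (1 : G) 1) :=
    (cosetChart_chartAt (mem_chart_source E (1 : G))).symm
  have h1 := localRiemann_eq_fderiv S he (cosetChart_one_mem_target (E := E)) hne'
    (projEquiv hsub hdec v)
  refine Eq.trans ?_ h1
  rw [hx]
  exact congrArg₂ (fun a b ↦ S.localRiemann (chartAt F (origin H))
    (cosetChart E F H (chartAt E (1 : G) 1)) a b) (frameDeriv_cosetChart_one hsub _).symm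
    (frameDeriv_cosetChart_one hsub _).symm

end Curvature


/-! ### Identification with the spray vector field and connection operator of the statement. -/

section Final

variable {E : Type*} [NormedAddCommGroup E] [NormedSpace ℝ E] [FiniteDimensional ℝ E]
  {F : Type*} [NormedAddCommGroup F] [NormedSpace ℝ F]
  {G : Type*} [Group G] [TopologicalSpace G] [ChartedSpace E G]
  {H : Subgroup G} {𝔪 : Submodule ℝ (GroupLieAlgebra 𝓘(ℝ, E) G)}

/-- A subspace of the Lie algebra, as a subspace of the model space. -/
def modelSubmodule (𝔪 : Submodule ℝ (GroupLieAlgebra 𝓘(ℝ, E) G)) : Submodule ℝ E := 𝔪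

/-- The projection `v ↦ v_𝔪`. -/
noncomputable def modelProj (hdec : IsCompl (isotropyAlgebra E H) 𝔪) : E →L[ℝ] modelSubmodule 𝔪 :=
  LinearMap.toContinuousLinearMap
    (Submodule.projectionOnto 𝔪 (isotropyAlgebra E H) hdec.symm : E →ₗ[ℝ] modelSubmodule 𝔪)

theorem isIsotropyComplement_model (hdec : IsCompl (isotropyAlgebra E H) 𝔪) :
    IsIsotropyComplement H (modelSubmodule 𝔪).subtypeL (modelProj hdec) where
  proj_incl y := Submodule.projectionOnto_apply_left hdec.symm y
  proj_eq_zero_iff _ := Submodule.projectionOnto_apply_eq_zero_iff hdec.symm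

variable [LieGroup 𝓘(ℝ, E) ∞ G] [ChartedSpace F (G ⧸ H)] [IsManifold 𝓘(ℝ, F) ∞ (G ⧸ H)]

/-- Only the derivative at `0` is involved: any admissible curve satisfies `y' = -η(y)` there, and
its initial value is determined by the initial velocity since `𝔪` meets the kernel of `projTangent`
trivially. Uniqueness of geodesics and lifts is not needed. -/
theorem isSprayVector_iff
    (hsub : Manifold.IsSubmersion 𝓘(ℝ, E) 𝓘(ℝ, F) ∞ (fun g : G ↦ (g : G ⧸ H)))
    (hdec : IsCompl (isotropyAlgebra E H) 𝔪) {S : Spray F (G ⧸ H)} (hS : S.IsInvariant) {y z : 𝔪}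
    (hy : y ≠ 0) : IsSprayVector S 𝔪 y z ↔
      z = localSprayField hsub (isIsotropyComplement_model hdec) S y := by
  have : CompleteSpace E := FiniteDimensional.complete ℝ E
  constructor
  · rintro ⟨ε, hε, c, cbar, yc, hc, hv, hl, hz⟩
    have h0 : (0 : ℝ) ∈ Ioo (-ε) ε := by simpa using hε
    have hck : ∀ t ∈ Ioo (-ε) ε, c t = (cbar t : G ⧸ H) := fun t ht ↦
      (hl.proj_eq t ht).trans (smul_origin _)
    have h1 := hasDerivAt_of_isGeodesic hsub (isIsotropyComplement_model hdec) hS isOpen_Ioo hc hck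
      hl.contMDiffOn hl.velocity_eq h0 (hl.ne_zero 0 h0)
    have h2 := velocity_mk_eq_projTangent hsub ((hl.contMDiffOn.contMDiffAt
      (isOpen_Ioo.mem_nhds h0)).mdifferentiableAt (by simp)) hl.map_zero (hl.velocity_eq 0 h0)
    rw [← velocity_congr isOpen_Ioo hck h0, hv] at h2
    have h3 : projTangent E F H (y : GroupLieAlgebra 𝓘(ℝ, E) G) = projTangent E F H (yc 0) :=
      TotalSpace.mk_inj.1 h2
    have h4 : y = yc 0 := by
      refine (projEquiv hsub (isIsotropyComplement_model hdec)).injective ?_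
      exact (frameDeriv_cosetChart_one hsub _).trans
        (h3.trans (frameDeriv_cosetChart_one hsub _).symm)
    have hz' : HasDerivAt (F := modelSubmodule 𝔪) yc (-z) 0 := hz
    have h5 := hz'.unique h1
    rw [h4]
    exact neg_injective h5
  · rintro rfl
    obtain ⟨ε, hε, k, z, h1, h2, h3, h4, h5, h6⟩ := exists_isGeodesic hsub
      (isIsotropyComplement_model hdec) hS (y := y) hy
    have h0 : (0 : ℝ) ∈ Ioo (-ε) ε := by simpa using hε
    refine ⟨ε, hε, fun τ ↦ (k τ : G ⧸ H), k, z, h1, h2, ⟨h5, h3, fun t _ ↦ (smul_origin _).symm,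
      fun t ht ↦ (h6 t ht).1, fun t ht ↦ (h6 t ht).2.1⟩, ?_⟩
    have h7 := (h6 0 h0).2.2
    rw [h4] at h7
    exact h7

theorem sprayVectorField_eq
    (hsub : Manifold.IsSubmersion 𝓘(ℝ, E) 𝓘(ℝ, F) ∞ (fun g : G ↦ (g : G ⧸ H)))
    (hdec : IsCompl (isotropyAlgebra E H) 𝔪) {S : Spray F (G ⧸ H)} (hS : S.IsInvariant) {y : 𝔪}
    (hy : y ≠ 0) : sprayVectorField S 𝔪 y =
      localSprayField hsub (isIsotropyComplement_model hdec) S y := by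
  have h : ∃ z, IsSprayVector S 𝔪 y z := ⟨_, (isSprayVector_iff hsub hdec hS hy).2 rfl⟩
  rw [sprayVectorField, dif_pos h]
  exact (isSprayVector_iff hsub hdec hS hy).1 h.choose_spec

theorem sprayVectorField_eventuallyEq
    (hsub : Manifold.IsSubmersion 𝓘(ℝ, E) 𝓘(ℝ, F) ∞ (fun g : G ↦ (g : G ⧸ H)))
    (hdec : IsCompl (isotropyAlgebra E H) 𝔪) {S : Spray F (G ⧸ H)} (hS : S.IsInvariant)
    {y : modelSubmodule 𝔪} (hy : y ≠ 0) : (sprayVectorField S 𝔪 : modelSubmodule 𝔪 → _) =ᶠ[𝓝 y]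
      localSprayField hsub (isIsotropyComplement_model hdec) S := by
  filter_upwards [isOpen_compl_singleton.mem_nhds hy] with z hz
  exact sprayVectorField_eq hsub hdec hS hz

theorem connectionOperator_eq
    (hsub : Manifold.IsSubmersion 𝓘(ℝ, E) 𝓘(ℝ, F) ∞ (fun g : G ↦ (g : G ⧸ H)))
    (hdec : IsCompl (isotropyAlgebra E H) 𝔪) {S : Spray F (G ⧸ H)} (hS : S.IsInvariant)
    {y : modelSubmodule 𝔪} (hy : y ≠ 0) (v : modelSubmodule 𝔪) :
    connectionOperator S hdec y v =
      (1 / 2 : ℝ) • fderiv ℝ (localSprayField hsub (isIsotropyComplement_model hdec) S) y v -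
      (1 / 2 : ℝ) • modelProj hdec
        (lieCLM E G ((modelSubmodule 𝔪).subtypeL y) ((modelSubmodule 𝔪).subtypeL v)) := by
  have h1 : connectionOperator S hdec y v =
      (1 / 2 : ℝ) • deriv (F := modelSubmodule 𝔪)
        (fun t : ℝ ↦ sprayVectorField S 𝔪 (y + t • v : modelSubmodule 𝔪)) 0 -
      (1 / 2 : ℝ) • modelProj hdec
        (lieCLM E G ((modelSubmodule 𝔪).subtypeL y) ((modelSubmodule 𝔪).subtypeL v)) := rfl
  have h2 : HasDerivAt (fun t : ℝ ↦ y + t • v) v 0 := by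
    simpa using ((hasDerivAt_id (0 : ℝ)).smul_const v).const_add y
  have h3 := ((contDiffAt_localSprayField hsub (isIsotropyComplement_model hdec) S
    hy).differentiableAt (by simp)).hasFDerivAt
  have h4 : HasFDerivAt (E := modelSubmodule 𝔪) (F := modelSubmodule 𝔪) (sprayVectorField S 𝔪)
      (fderiv ℝ (localSprayField hsub (isIsotropyComplement_model hdec) S) y)
      (y + (0 : ℝ) • v) := by
    rw [zero_smul, add_zero]
    exact h3.congr_of_eventuallyEq (sprayVectorField_eventuallyEq hsub hdec hS hy)
  have h5 := (h4.comp_hasDerivAt (0 : ℝ) h2).deriv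
  exact h1.trans (by rw [← h5]; rfl)

end Final


/-! ### Brackets and the derivative of `N` along the curve. -/

section Brackets

variable {E : Type*} [NormedAddCommGroup E] [NormedSpace ℝ E] [FiniteDimensional ℝ E]
  {G : Type*} [Group G] [TopologicalSpace G] [ChartedSpace E G] [LieGroup 𝓘(ℝ, E) ∞ G]
  {H : Subgroup G} {𝔪 : Submodule ℝ (GroupLieAlgebra 𝓘(ℝ, E) G)}

theorem coe_bracketH (hdec : IsCompl (isotropyAlgebra E H) 𝔪)
    (v w : GroupLieAlgebra 𝓘(ℝ, E) G) :
    ((bracketH hdec v w : GroupLieAlgebra 𝓘(ℝ, E) G) : E) = lieCLM E G v w -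
      (modelSubmodule 𝔪).subtypeL (modelProj hdec (lieCLM E G v w)) := by
  have h : (bracketH hdec v w : GroupLieAlgebra 𝓘(ℝ, E) G) =
      (⁅v, w⁆ : GroupLieAlgebra 𝓘(ℝ, E) G) - (bracketM hdec v w : GroupLieAlgebra 𝓘(ℝ, E) G) :=
    eq_sub_of_add_eq (Submodule.projection_add_projection_eq_self hdec _)
  exact h

end Brackets

section Curve

variable {V : Type*} [NormedAddCommGroup V] [NormedSpace ℝ V] {η : V → V} {B : V →L[ℝ] V →L[ℝ] V}

/-- With `x = η(y)`, this is the derivative of `N(t)`, in the shape in which it occurs in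
`riemann_origin_eq`. -/
theorem hasDerivAt_half_fderiv_sub {y w : ℝ → V} {t : ℝ} {x m : V} (hη : ContDiffAt ℝ ∞ η (y t))
    (hy : HasDerivAt y (-x) t) (hw : HasDerivAt w (-m) t) :
    HasDerivAt (fun τ ↦ (1 / 2 : ℝ) • fderiv ℝ η (y τ) (w τ) - (1 / 2 : ℝ) • B (y τ) (w τ))
      (-(1 / 2 : ℝ) • fderiv ℝ (fderiv ℝ η) (y t) x (w t) - (1 / 2 : ℝ) • fderiv ℝ η (y t) m +
        (1 / 2 : ℝ) • B x (w t) + (1 / 2 : ℝ) • B (y t) m) t := by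
  have h1 : HasFDerivAt (fderiv ℝ η) (fderiv ℝ (fderiv ℝ η) (y t)) (y t) :=
    ((hη.fderiv_right (m := ∞) (by simp)).differentiableAt (by simp)).hasFDerivAt
  have h2 := (h1.comp_hasDerivAt t hy).clm_apply hw
  have h3 := (B.hasFDerivAt.comp_hasDerivAt t hy).clm_apply hw
  refine ((h2.const_smul (1 / 2 : ℝ)).sub (h3.const_smul (1 / 2 : ℝ))).congr_deriv ?_
  simp only [map_neg, neg_apply, Function.comp_apply]
  module

end Curve

end SprayGeometry

/-! ### Assembly of the theorem. -/

open SprayGeometry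
theorem corollary6p7
    {E : Type*} [NormedAddCommGroup E] [NormedSpace ℝ E] [FiniteDimensional ℝ E]
    {F : Type*} [NormedAddCommGroup F] [NormedSpace ℝ F] [FiniteDimensional ℝ F]
    -- the Lie group `G`, its closed subgroup `H`, the smooth coset space `G/H`
    {G : Type*} [Group G] [TopologicalSpace G] [T2Space G] [ChartedSpace E G]
    [LieGroup 𝓘(ℝ, E) ∞ G] (H : Subgroup G) (hH : IsClosed (H : Set G))
    [ChartedSpace F (G ⧸ H)] [IsManifold 𝓘(ℝ, F) ∞ (G ⧸ H)]
    (hsub : Manifold.IsSubmersion 𝓘(ℝ, E) 𝓘(ℝ, F) ∞ (fun g : G ↦ (g : G ⧸ H)))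
    -- the homogeneous spray structure and the linear decomposition `𝔤 = 𝔥 + 𝔪`
    (S : Spray F (G ⧸ H)) (hS : S.IsInvariant)
    (𝔪 : Submodule ℝ (GroupLieAlgebra 𝓘(ℝ, E) G))
    (hdec : IsCompl (isotropyAlgebra E H) 𝔪)
    -- the geodesic `c` with `c(0) = o`, the curve `c̄` on `G`, and the curve `y(t)` in `𝔪 \ {0}`
    {a b : ℝ} (ha : a < 0) (hb : 0 < b)
    (c : ℝ → G ⧸ H) (hc : S.IsGeodesic c (Ioo a b)) (hc0 : c 0 = origin H)
    (cbar : ℝ → G) (y : ℝ → 𝔪) (hlift : IsHorizontalLift 𝔪 c cbar y (Ioo a b))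
    -- the linearly parallel vector field `W(t) = (c̄(t))_* w(t)` along `c`
    (w : ℝ → 𝔪) (hw : ContDiffOn ℝ ∞ w (Ioo a b))
    (W : ℝ → TangentBundle 𝓘(ℝ, F) (G ⧸ H))
    (hWw : ∀ t ∈ Ioo a b, W t = tangentMap 𝓘(ℝ, F) 𝓘(ℝ, F) (fun x : G ⧸ H ↦ cbar t • x)
      ⟨origin H, projTangent E F H (w t)⟩)
    (hW : S.IsLinearlyParallel c W (Ioo a b)) :
    -- `η` is smooth on `𝔪 \ {0}`, `y(t)` is an integral curve of `-η`, `N(t)` is smooth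
    ContDiffOn ℝ ∞ (sprayVectorField S 𝔪) {0}ᶜ ∧
    (∀ t ∈ Ioo a b, HasDerivAt y (-sprayVectorField S 𝔪 (y t)) t) ∧
    ContDiffOn ℝ ∞ (fun t ↦ connectionOperator S hdec (y t) (w t)) (Ioo a b) ∧
    -- `N(t) = [w(t), η]`
    (∀ t ∈ Ioo a b, connectionOperator S hdec (y t) (w t) =
      bracketRight (sprayVectorField S 𝔪) y w t) ∧
    -- `R(t) = [y(t), [w(t), y(t)]_𝔥]_𝔪 + [η, N(t)]`
    (∀ t ∈ Ioo a b,
      S.riemann (origin H) (projTangent E F H (y t)) (projTangent E F H (w t)) =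
        projTangent E F H
          ((bracketM hdec (y t : GroupLieAlgebra 𝓘(ℝ, E) G)
              (bracketH hdec (w t : GroupLieAlgebra 𝓘(ℝ, E) G) (y t)) +
            bracketLeft (sprayVectorField S 𝔪) y
              (fun τ ↦ connectionOperator S hdec (y τ) (w τ)) t : 𝔪) :
            GroupLieAlgebra 𝓘(ℝ, E) G)) := by
  have : CompleteSpace E := FiniteDimensional.complete ℝ E
  have hcompl := isIsotropyComplement_model hdec
  -- All data are retyped over a subspace of the model space `E`, definitionally equal to `𝔪`, so
  -- that a single normed structure is used; the closing `exact` steps convert back.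
  let V : Submodule ℝ E := modelSubmodule 𝔪
  let ι : V →L[ℝ] E := V.subtypeL
  let pm : E →L[ℝ] V := modelProj hdec
  let B : V →L[ℝ] V →L[ℝ] V :=
    (ContinuousLinearMap.compL ℝ V E V pm ∘L (lieCLM E G).bilinearComp ι ι)
  let η : V → V := localSprayField hsub hcompl S
  have hη : ∀ z : V, z ≠ 0 → ContDiffAt ℝ ∞ η z := fun z hz ↦
    contDiffAt_localSprayField hsub hcompl S hz
  let σ : V → V := sprayVectorField S 𝔪
  have hev : ∀ z : V, z ≠ 0 → σ =ᶠ[𝓝 z] η := fun z hz ↦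
    sprayVectorField_eventuallyEq hsub hdec hS hz
  let y' : ℝ → V := y
  let w' : ℝ → V := w
  have hne : ∀ t ∈ Ioo a b, y' t ≠ 0 := hlift.ne_zero
  have hck : ∀ t ∈ Ioo a b, c t = (cbar t : G ⧸ H) := fun t ht ↦
    (hlift.proj_eq t ht).trans (smul_origin _)
  have hyc : ContDiffOn ℝ ∞ y' (Ioo a b) :=
    contDiffOn_of_velocity_eq_incl hcompl isOpen_Ioo hlift.contMDiffOn hlift.velocity_eq
  have hwc : ContDiffOn ℝ ∞ w' (Ioo a b) := hw
  have hyd : ∀ t ∈ Ioo a b, HasDerivAt y' (-η (y' t)) t := fun t ht ↦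
    hasDerivAt_of_isGeodesic hsub hcompl hS isOpen_Ioo hc hck hlift.contMDiffOn
      hlift.velocity_eq ht (hne t ht)
  have hwd' : ∀ t ∈ Ioo a b, HasDerivAt w' (deriv w' t) t := fun t ht ↦
    ((hwc.contDiffAt (isOpen_Ioo.mem_nhds ht)).differentiableAt (by simp)).hasDerivAt
  have hwd : ∀ t ∈ Ioo a b, HasDerivAt w'
      (-((1 / 2 : ℝ) • fderiv ℝ η (y' t) (w' t) + (1 / 2 : ℝ) • B (y' t) (w' t))) t := by
    intro t ht
    have h := eq_of_isLinearlyParallel hsub hcompl hS isOpen_Ioo hc.contMDiffOn hck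
      hlift.contMDiffOn hlift.velocity_eq hWw hW ht (hne t ht) (hwd' t ht)
    have h1 := hwd' t ht
    rw [h] at h1
    exact h1
  let N : ℝ → V := fun t ↦ connectionOperator S hdec (y t) (w t)
  have hN : ∀ t ∈ Ioo a b, N t =
      (1 / 2 : ℝ) • fderiv ℝ η (y' t) (w' t) - (1 / 2 : ℝ) • B (y' t) (w' t) := fun t ht ↦
    connectionOperator_eq hsub hdec hS (hne t ht) _
  have hNc : ContDiffOn ℝ ∞ N (Ioo a b) := by
    refine ContDiffOn.congr (fun t ht ↦ ContDiffAt.contDiffWithinAt ?_) hN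
    have h1 := hyc.contDiffAt (isOpen_Ioo.mem_nhds ht)
    have h2 := hwc.contDiffAt (isOpen_Ioo.mem_nhds ht)
    exact (((((hη _ (hne t ht)).fderiv_right (m := ∞) (by simp)).comp t h1).clm_apply
      h2).const_smul _).sub (((B.contDiff.contDiffAt.comp t h1).clm_apply h2).const_smul _)
  have hneg : ∀ t ∈ Ioo a b, ∀ x : V,
      fderiv ℝ (fun v ↦ -σ v) (y' t) x = -fderiv ℝ η (y' t) x := by
    intro t ht x
    have h : (fun v ↦ -σ v) =ᶠ[𝓝 (y' t)] fun v ↦ -η v := (hev _ (hne t ht)).neg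
    rw [h.fderiv_eq]
    exact DFunLike.congr_fun fderiv_neg x
  refine ⟨?_, ?_, hNc, ?_, ?_⟩
  · have h : ContDiffOn ℝ ∞ σ {0}ᶜ := fun z hz ↦
      ((hη z hz).congr_of_eventuallyEq (hev z hz)).contDiffWithinAt
    exact h
  · intro t ht
    have h : HasDerivAt y' (-σ (y' t)) t := by
      rw [(hev _ (hne t ht)).eq_of_nhds]
      exact hyd t ht
    exact h
  · intro t ht
    -- The bracket is `w' + Dη(y, w)`; inserting the parallel equation for `w'` leaves half of `Dη`
    -- and minus half of the bracket.
    have h : N t = deriv w' t - fderiv ℝ (fun v ↦ -σ v) (y' t) (w' t) := by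
      rw [hneg t ht, (hwd t ht).deriv, hN t ht]
      module
    exact h
  · intro t ht
    obtain ⟨m, hm⟩ : ∃ m : V, m = (1 / 2 : ℝ) • fderiv ℝ η (y' t) (w' t) +
      (1 / 2 : ℝ) • B (y' t) (w' t) := exists_eq
    have hwm : HasDerivAt w' (-m) t := by
      rw [hm]
      exact hwd t ht
    have hNd := ((hasDerivAt_half_fderiv_sub (B := B) (hη _ (hne t ht)) (hyd t ht)
      hwm).congr_of_eventuallyEq (by
        filter_upwards [isOpen_Ioo.mem_nhds ht] with τ hτ using hN τ hτ :
        N =ᶠ[𝓝 t] _)).deriv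
    have h1 := riemann_origin_eq hsub hcompl hS (y := y' t) (v := w' t) (hne t ht) hm (hN t ht)
    -- The right-hand side of the goal with the generalized bracket unfolded; it is matched with the
    -- expression from `riemann_origin_eq` by inserting the derivative of `N`.
    let Z : V := pm (lieCLM E G (ι (y' t))
        ((bracketH hdec (w t : GroupLieAlgebra 𝓘(ℝ, E) G) (y t) : GroupLieAlgebra 𝓘(ℝ, E) G) : E)) +
      -(deriv N t - fderiv ℝ (fun v ↦ -σ v) (y' t) (N t))
    have hZ : Z = pm (lieCLM E G (ι (y' t)) (lieCLM E G (ι (w' t)) (ι (y' t)) -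
          ι (pm (lieCLM E G (ι (w' t)) (ι (y' t)))))) -
        (-(1 / 2 : ℝ) • fderiv ℝ (fderiv ℝ η) (y' t) (η (y' t)) (w' t) -
          (1 / 2 : ℝ) • fderiv ℝ η (y' t) m + (1 / 2 : ℝ) • B (η (y' t)) (w' t) +
          (1 / 2 : ℝ) • B (y' t) m + fderiv ℝ η (y' t) (N t)) := by
      have h2 : Z = pm (lieCLM E G (ι (y' t)) (lieCLM E G (ι (w' t)) (ι (y' t)) -
          ι (pm (lieCLM E G (ι (w' t)) (ι (y' t)))))) +
          -(deriv N t - fderiv ℝ (fun v ↦ -σ v) (y' t) (N t)) :=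
        congrArg (fun x : E ↦ pm (lieCLM E G (ι (y' t)) x) +
          -(deriv N t - fderiv ℝ (fun v ↦ -σ v) (y' t) (N t))) (coe_bracketH hdec _ _)
      rw [h2, hneg t ht, hNd, sub_neg_eq_add, ← sub_eq_add_neg]
    have h3 : projTangent E F H (ι _) = projTangent E F H (ι Z) :=
      congrArg (fun z : V ↦ projTangent E F H (ι z)) hZ.symm
    exact h1.trans h3
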